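/- All graphs are finite and simple. A diamond is $K_4-e$. A graph $G=(V,E)$ is *(nonpartitioned) probe diamond-free* if $V$ has a partition $(P,N)$ with $N$ independent (a *probe partition*) and there is a set $F$ of non-edges of $G$, each with both ends in $N$ (a *completion set*), such that $(V,E\cup F)$ contains no induced diamond. *Obstructions.* Consider the following 17 graphs, each given on ordered vertices $1,2,\dots$ (we write $ij$ for an edge, and "diamond $ab|cd$" for the diamond with tips $a,b$ and degree-three vertices $c,d$). - LUCS obstructions: (1) the gem $\overline{P_4+K_1}$: $12,13,14,15,23,24,35$; (2) $W_4=\overline{2K_2+K_1}$: $12,13,14,15,23,24,35,45$; (3) $\overline{P_3+2K_1}$: $12,13,14,15,23,24,25,34$. - (4) $S_1$: diamonds $17|23$ and $56|14$. (5) $S_4=\overline{P_3+K_2}$: diamond $14|23$ and edges $15,45$. (6) $S_2$: diamonds $16|23$ and $17|45$ and the edge $67$. (17) $S_3$: diamonds $12|45$, $13|67$ and $23|89$. - ($6+i$) $T_i$, $1\le i\le 10$: two disjoint diamonds joined by a matching, namely $T_1$: $37|12$, $48|56$; $34$. $T_2$: $47|13$, $58|26$; $45,12$. $T_3$: $34|12$,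 $56|78$; $35,46$. $T_4$: $38|12$, $45|67$; $35,14$. $T_5$: $57|12$, $68|34$; $56,13,24$. $T_6$: $48|12$, $56|37$; $46,13,25$. $T_7$: $45|13$, $67|28$; $46,12,57$. $T_8$: $36|15$, $48|27$; $68,14,23$. $T_9$: $56|12$, $78|34$; $57,13,24,68$. $T_{10}$: $56|12$, $78|34$; $68,13,45,27$. A sequence $Q=(q_1,\dots,q_k)$ of distinct vertices of $G$ is *degree–lexicographically ordered* if the degrees in $G[\{q_1,\dots,q_k\}]$ do not increase along $Q$ and, whenever $i<j$ and $q_i,q_j$ have the same degree there, either $q_i$ and $q_j$ have the same neighbors among $q_1,\dots,q_{i-1}$, or at the first $q_p$ ($p<i$) that is adjacent to exactly one of them it is adjacent to $q_i$. **Theorem.** There is an algorithm (a program of a word RAM with words of $O(\log n)$ bits and unit-cost instructions) and a constant $c$ such that, for every graph $G$ on $\{0,\dots,n-1\}$ with $m$ edges, given by adjacency lists in any order, the algorithm halts after at most $c\,(nm+n+1)$ steps (hence in $O(nm)$ time whenever $m\ge 1$) and correctly decides whether $G$ is probe diamond-free. - If $G$ is probe diamond-free, the algorithm answers "yes" and outputs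 a probe partition $(P,N)$ and a completion set $F\subseteq\{uv:u,v\in N\}$ of non-edges such that $(V,E\cup F)$ is diamond-free. - If $G$ is not probe diamond-free, the algorithm answers "no" and outputs an indicator $\mathrm{Ind}\in\{1,\dots,17\}$ and a degree–lexicographically ordered sequence $Q$ of distinct vertices of $G$ such that mapping vertex $i$ of obstruction number $\mathrm{Ind}$ to the $i$-th vertex of $Q$ is an isomorphism onto the subgraph of $G$ induced by $Q$. This induced subgraph is a minimal forbidden induced subgraph for the class of probe diamond-free graphs: it is not probe diamond-free, but all its proper induced subgraphs are. -/

import Mathlib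

/-! ### Probe diamond-free graphs -/

/-- The diamond `K₄ - e`. -/
def diamond : SimpleGraph (Fin 4) := (⊤ : SimpleGraph (Fin 4)).deleteEdges {s(0, 1)}

/-- `G` has no induced subgraph isomorphic to the diamond. -/
def IsDiamondFree {V : Type*} (G : SimpleGraph V) : Prop :=
  ¬ diamond.IsIndContained G

/-- `(P, N)` is a partition of the vertices in which the set `N` of nonprobes is independent. -/
def IsProbePartition {V : Type*} (G : SimpleGraph V) (P N : Set V) : Prop :=
  P ∪ N = Set.univ ∧ Disjoint P N ∧ G.IsIndepSet N

/-- `F` is a set of non-edges of `G` with both ends in `N`, and adding `F` to `G` gives a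
diamond-free graph. -/
def IsDiamondFreeCompletion {V : Type*} (G : SimpleGraph V) (N : Set V) (F : Set (Sym2 V)) :
    Prop :=
  (∀ u v : V, s(u, v) ∈ F → u ≠ v ∧ ¬ G.Adj u v ∧ u ∈ N ∧ v ∈ N) ∧
    IsDiamondFree (G ⊔ SimpleGraph.fromEdgeSet F)

/-- Nonpartitioned probe diamond-free graphs. -/
def IsProbeDiamondFree {V : Type*} (G : SimpleGraph V) : Prop :=
  ∃ (P N : Set V) (F : Set (Sym2 V)), IsProbePartition G P N ∧ IsDiamondFreeCompletion G N F

/-- `H` is a minimal forbidden induced subgraph for the class of probe diamond-free graphs. -/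
def IsMinimalForbidden {V : Type*} (H : SimpleGraph V) : Prop :=
  ¬ IsProbeDiamondFree H ∧ ∀ A : Set V, A ≠ Set.univ → IsProbeDiamondFree (H.induce A)

/-! ### The obstructions, with their ordered vertices -/

/-- A graph whose vertices are ordered; the vertex `i : Fin order` is at position `i + 1`. -/
structure OrderedGraph where
  order : ℕ
  graph : SimpleGraph (Fin order)

/-- The ordered graph on the positions `1, …, k` with the listed edges. -/
def OrderedGraph.ofEdges (k : ℕ) (E : List (ℕ × ℕ)) : OrderedGraph where
  order := k
  graph := SimpleGraph.fromRel fun i j => (i.val + 1, j.val + 1) ∈ E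

/-- The 17 obstructions, each with its fixed degree-lexicographic vertex order, numbered by the
indicator that the algorithm reports. -/
def obstruction : ℕ → OrderedGraph
  -- LUCS obstructions: the gem (complement of `P₄ + K₁`), the wheel `W₄` (complement of
  -- `2K₂ + K₁`) and the complement of `P₃ + 2K₁`
  | 1 => .ofEdges 5 [(1,2), (1,3), (1,4), (1,5), (2,3), (2,4), (3,5)]
  | 2 => .ofEdges 5 [(1,2), (1,3), (1,4), (1,5), (2,3), (2,4), (3,5), (4,5)]
  | 3 => .ofEdges 5 [(1,2), (1,3), (1,4), (1,5), (2,3), (2,4), (2,5), (3,4)]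
  -- `S₁`, `S₄` (complement of `P₃ + K₂`), `S₂`
  | 4 => .ofEdges 7 [(1,2), (1,3), (2,3), (2,7), (3,7), (1,4), (1,5), (1,6), (4,5), (4,6)]
  | 5 => .ofEdges 5 [(1,2), (1,3), (2,3), (2,4), (3,4), (1,5), (4,5)]
  | 6 => .ofEdges 7 [(1,2), (1,3), (2,3), (2,6), (3,6), (1,4), (1,5), (4,5), (4,7), (5,7), (6,7)]
  -- `T₁`, …, `T₁₀`: two disjoint diamonds (first two groups of five edges) and a matching
  -- between them (last group)
  | 7 => .ofEdges 8 [(1,2), (1,3), (1,7), (2,3), (2,7), (4,5), (4,6), (5,6), (5,8), (6,8),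
      (3,4)]
  | 8 => .ofEdges 8 [(1,3), (1,4), (1,7), (3,4), (3,7), (2,5), (2,6), (2,8), (5,6), (6,8),
      (4,5), (1,2)]
  | 9 => .ofEdges 8 [(1,2), (1,3), (1,4), (2,3), (2,4), (5,7), (5,8), (6,7), (6,8), (7,8),
      (3,5), (4,6)]
  | 10 => .ofEdges 8 [(1,2), (1,3), (1,8), (2,3), (2,8), (4,6), (4,7), (5,6), (5,7), (6,7),
      (3,5), (1,4)]
  | 11 => .ofEdges 8 [(1,2), (1,5), (1,7), (2,5), (2,7), (3,4), (3,6), (3,8), (4,6), (4,8),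
      (5,6), (1,3), (2,4)]
  | 12 => .ofEdges 8 [(1,2), (1,4), (1,8), (2,4), (2,8), (3,5), (3,6), (3,7), (5,7), (6,7),
      (4,6), (1,3), (2,5)]
  | 13 => .ofEdges 8 [(1,3), (1,4), (1,5), (3,4), (3,5), (2,6), (2,7), (2,8), (6,8), (7,8),
      (4,6), (1,2), (5,7)]
  | 14 => .ofEdges 8 [(1,3), (1,5), (1,6), (3,5), (5,6), (2,4), (2,7), (2,8), (4,7), (7,8),
      (6,8), (1,4), (2,3)]
  | 15 => .ofEdges 8 [(1,2), (1,5), (1,6), (2,5), (2,6), (3,4), (3,7), (3,8), (4,7), (4,8),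
      (5,7), (1,3), (2,4), (6,8)]
  | 16 => .ofEdges 8 [(1,2), (1,5), (1,6), (2,5), (2,6), (3,4), (3,7), (3,8), (4,7), (4,8),
      (6,8), (1,3), (4,5), (2,7)]
  -- `S₃`
  | 17 => .ofEdges 9 [(1,4), (1,5), (4,5), (2,4), (2,5), (1,6), (1,7), (6,7), (3,6), (3,7),
      (2,8), (2,9), (8,9), (3,8), (3,9)]
  | _ => .ofEdges 0 []

/-- The sequence `Q` lists distinct vertices, and sending position `i` of `H` to `Q i` is an
isomorphism from `H` onto the subgraph of `G` induced by the vertices of `Q`. -/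
def InducesOrdered {V : Type*} (G : SimpleGraph V) (H : OrderedGraph) (Q : Fin H.order → V) :
    Prop :=
  Function.Injective Q ∧ ∀ i j, G.Adj (Q i) (Q j) ↔ H.graph.Adj i j

/-- The degree of the `i`-th vertex of the sequence `Q` in the subgraph induced by `Q`
(for a sequence of distinct vertices). -/
noncomputable def seqDegree {V : Type*} (G : SimpleGraph V) {k : ℕ} (Q : Fin k → V)
    (i : Fin k) : ℕ :=
  {j : Fin k | G.Adj (Q i) (Q j)}.ncard

/-- Degree-lexicographic order: the degrees in the induced subgraph do not increase along the
sequence, and for equal degrees the vertices are ordered lexicographically by their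
neighborhoods among the preceding vertices. That is, if positions `i < j` have the same degree
and `p < i` is the first position at which the neighborhoods of `Q i` and `Q j` differ, then
it is `Q i` that is adjacent to `Q p`. -/
def IsDegreeLex {V : Type*} (G : SimpleGraph V) {k : ℕ} (Q : Fin k → V) : Prop :=
  ∀ i j : Fin k, i < j →
    seqDegree G Q j ≤ seqDegree G Q i ∧
    (seqDegree G Q j = seqDegree G Q i →
      ∀ p : Fin k, p < i →
        (∀ q : Fin k, q < p → (G.Adj (Q i) (Q q) ↔ G.Adj (Q j) (Q q))) →
        G.Adj (Q j) (Q p) → G.Adj (Q i) (Q p))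

/-! ### The machine model: a word RAM with unit-cost instructions -/

namespace Ram

/-- A memory: registers `reg x`, and arrays `arr a` with cells `arr a i`. -/
structure State where
  reg : ℕ → ℕ
  arr : ℕ → ℕ → ℕ

def State.setReg (s : State) (x v : ℕ) : State :=
  { s with reg := Function.update s.reg x v }

def State.setArr (s : State) (a i v : ℕ) : State :=
  { s with arr := Function.update s.arr a (Function.update (s.arr a) i v) }

/-- Tests compare two registers. -/
inductive Test where
  | lt (x y : ℕ)
  | eq (x y : ℕ)

def Test.holds (s : State) : Test → Prop
  | lt x y => s.reg x < s.reg y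
  | eq x y => s.reg x = s.reg y

/-- Programs. The parameters `x y z` are names of registers, `a` is the name of an array and
`k` is a literal; all of them are fixed in the program text. -/
inductive Prog where
  | skip
  | const (x k : ℕ)
  | move (x y : ℕ)
  | add (x y z : ℕ)
  | sub (x y z : ℕ)
  | load (x a y : ℕ)
  | store (a y x : ℕ)
  | seq (c d : Prog)
  | cond (b : Test) (c d : Prog)
  | loop (b : Test) (c : Prog)

/-- `Run W c s t k`: the program `c`, started in the memory `s`, halts in the memory `t` after
exactly `k` steps; each elementary instruction and each evaluation of a test is one step.
All values that it writes by arithmetic are smaller than `W`: a program that produces a number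
that does not fit into a machine word has no run. -/
inductive Run (W : ℕ) : Prog → State → State → ℕ → Prop where
  | skip (s) : Run W .skip s s 1
  | const (s x k) (h : k < W) : Run W (.const x k) s (s.setReg x k) 1
  | move (s x y) : Run W (.move x y) s (s.setReg x (s.reg y)) 1
  | add (s x y z) (h : s.reg y + s.reg z < W) :
      Run W (.add x y z) s (s.setReg x (s.reg y + s.reg z)) 1
  | sub (s x y z) : Run W (.sub x y z) s (s.setReg x (s.reg y - s.reg z)) 1
  | load (s x a y) : Run W (.load x a y) s (s.setReg x (s.arr a (s.reg y))) 1
  | store (s a y x) : Run W (.store a y x) s (s.setArr a (s.reg y) (s.reg x)) 1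
  | seq {c d s t u k l} (h₁ : Run W c s t k) (h₂ : Run W d t u l) :
      Run W (.seq c d) s u (k + l)
  | cond_true {b c d s t k} (hb : b.holds s) (h : Run W c s t k) :
      Run W (.cond b c d) s t (k + 1)
  | cond_false {b c d s t k} (hb : ¬ b.holds s) (h : Run W d s t k) :
      Run W (.cond b c d) s t (k + 1)
  | loop_done {b c s} (hb : ¬ b.holds s) : Run W (.loop b c) s s 1
  | loop_step {b c s t u k l} (hb : b.holds s) (h₁ : Run W c s t k)
      (h₂ : Run W (.loop b c) t u l) : Run W (.loop b c) s u (k + l + 1)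

end Ram

/-! ### Input and output -/

/-- `L` is an adjacency-list representation of `G`: the list `L v` enumerates the neighbors of
`v` without repetition, in an arbitrary order. -/
def IsAdjacencyList {n : ℕ} (G : SimpleGraph (Fin n)) (L : Fin n → List (Fin n)) : Prop :=
  ∀ v, (L v).Nodup ∧ ∀ w, w ∈ L v ↔ G.Adj v w

/-- The memory that holds the adjacency lists `L`: register `0` contains `n`, array `1` contains
the lists of the vertices `0, …, n - 1` one after the other, and for `i ≤ n` the cell `i` of
array `0` contains the total length of the first `i` lists, so that the list of the vertex `v`
occupies the cells from `arr 0 v` to `arr 0 (v + 1) - 1` of array `1`. Everything else is `0`. -/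
def inputState {n : ℕ} (L : Fin n → List (Fin n)) : Ram.State where
  reg x := if x = 0 then n else 0
  arr a i :=
    if a = 0 then
      if i ≤ n then (((List.finRange n).take i).map fun v => (L v).length).sum else 0
    else if a = 1 then
      (((List.finRange n).flatMap L).map Fin.val).getD i 0
    else 0

/-- The memory `t` contains the answer "yes" (register `0` is `1`), the partition `(P, N)` (cell
`v` of array `2` is `0` if `v ∈ P` and `1` if `v ∈ N`) and the set `F` (register `1` is the
length of a list of the elements of `F`, whose ends are in the arrays `3` and `4`). -/
def OutputsYes {n : ℕ} (t : Ram.State) (P N : Set (Fin n)) (F : Set (Sym2 (Fin n))) : Prop :=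
  t.reg 0 = 1 ∧
  (∀ v : Fin n, (v ∈ P ↔ t.arr 2 v = 0) ∧ (v ∈ N ↔ t.arr 2 v = 1)) ∧
  ∃ l : List (Fin n × Fin n),
    t.reg 1 = l.length ∧
    (∀ (i : ℕ) (hi : i < l.length), t.arr 3 i = l[i].1.val ∧ t.arr 4 i = l[i].2.val) ∧
    F = {e | ∃ p ∈ l, e = s(p.1, p.2)}

/-- The memory `t` contains the answer "no" (register `0` is `0`), the indicator `ind`
(register `1`) and the sequence `Q` (the first cells of array `2`). -/
def OutputsNo {n : ℕ} (t : Ram.State) (ind : ℕ) {k : ℕ} (Q : Fin k → Fin n) : Prop :=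
  t.reg 0 = 0 ∧ t.reg 1 = ind ∧ ∀ i : Fin k, t.arr 2 i = (Q i).val

/-! ### Completions -/

/-! In a diamond-free graph any two common neighbors of an edge are adjacent, so every edge lies in
exactly one maximal clique. Let `H` be a completion of `G` with nonprobes `N`, and let `T` be a
triangle of `G`. As `N` is independent, `T` has at most one vertex in `N`, and therefore the maximal
clique of `H` through `T` consists exactly of the vertices that are equal or adjacent in `G` to at
least two vertices of `T` (`Completes.adj_of_onLine`, `Completes.onLine_of_adj`). This set, the line
of `T`, depends on `G` alone. Hence the points of a line are pairwise adjacent in every completion,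
nonadjacent points of a line are nonprobes, and a vertex off a line is never joined to two of its
points. Conversely, if the last condition holds for a family of lines that covers every edge in a
triangle, and if the forced nonprobes are independent, then joining all points of each line gives a
completion (`completes_of_lines`).

The algorithm computes the lines and tests these conditions. A failure is witnessed by at most
thirteen vertices: a few points and the triangles of at most three lines
(`not_isProbeDiamondFree_of_two`, `not_isProbeDiamondFree_of_tips`). These vertices already induce a
graph that is not probe diamond-free.

By a separate structure theorem (`ObstructionFree.isProbeDiamondFree`) such an induced graph
contains one of the 17 obstructions, so trying all placements of obstructions on thirteen vertices,
a constant number, finds one. For the structure theorem, the closed common neighborhood of the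
middle vertices of a diamond is called its block. Without the obstructions of order five a vertex
with two neighbors in a block belongs to it (`Dia.blk_of_two`); without `S₁`, `S₂` and the `Tᵢ` the
tips of diamonds are independent (`Dia.not_adj_tips`); without `S₃` three vertices that are pairwise
tips share a block (`Dia.blk_of_three`). Adding all pairs of tips is then a completion. That the 17
graphs are minimal and correctly ordered is a finite check.

For the running time, every step spends `O(n)` per dart (an edge with a direction), except that
marking a new line with `b` points costs `O(nb)`. Such a line newly covers at least `b` darts
(`card_line_add_covered_le`), so all markings together cost `O(nm)`. -/

/-- The four-point form of diamond-freeness. -/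
def FourPoint {V : Type*} (H : SimpleGraph V) : Prop :=
  ∀ a b c d : V, a ≠ b → H.Adj a c → H.Adj a d → H.Adj b c → H.Adj b d → H.Adj c d → H.Adj a b

theorem isDiamondFree_iff_fourPoint {V : Type*} (H : SimpleGraph V) :
    IsDiamondFree H ↔ FourPoint H := by
  constructor
  · intro h a b c d hab hac had hbc hbd hcd
    by_contra hn
    refine h ⟨⟨⟨![a, b, c, d], ?_⟩, ?_⟩⟩
    · have := hac.ne; have := had.ne; have := hbc.ne; have := hbd.ne; have := hcd.ne
      intro i j hij
      fin_cases i <;> fin_cases j <;> simp_all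
    · intro i j
      change H.Adj (![a, b, c, d] i) (![a, b, c, d] j) ↔ _
      have := hac.symm; have := had.symm; have := hbc.symm; have := hbd.symm
      have := hcd.symm; have hn' : ¬ H.Adj b a := fun h => hn h.symm
      fin_cases i <;> fin_cases j <;> simp_all [diamond]
  · rintro h ⟨f⟩
    have e : ∀ i j, H.Adj (f i) (f j) ↔ diamond.Adj i j := fun i j => f.map_rel_iff
    have := (e 0 1).1 (h (f 0) (f 1) (f 2) (f 3) (f.injective.ne (by simp))
      ((e 0 2).2 (by simp [diamond])) ((e 0 3).2 (by simp [diamond]))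
      ((e 1 2).2 (by simp [diamond])) ((e 1 3).2 (by simp [diamond]))
      ((e 2 3).2 (by simp [diamond])))
    simp [diamond] at this

/-- `H` is a diamond-free supergraph of `G` all of whose new edges join vertices of the
independent set `N`. -/
structure Completes {V : Type*} (G : SimpleGraph V) (N : Set V) (H : SimpleGraph V) : Prop where
  indep : ∀ u v, u ∈ N → v ∈ N → ¬ G.Adj u v
  le : ∀ u v, G.Adj u v → H.Adj u v
  fourPoint : FourPoint H
  new : ∀ u v, H.Adj u v → ¬ G.Adj u v → u ∈ N ∧ v ∈ N

theorem Completes.isProbePartition {V : Type*} {G H : SimpleGraph V} {N : Set V}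
    (h : Completes G N H) : IsProbePartition G Nᶜ N :=
  ⟨Set.compl_union_self N, disjoint_compl_left, fun u hu v hv _ => h.indep u v hu hv⟩

theorem Completes.isDiamondFreeCompletion {V : Type*} {G H : SimpleGraph V} {N : Set V}
    (h : Completes G N H) {F : Set (Sym2 V)}
    (hF : ∀ u v, s(u, v) ∈ F ↔ H.Adj u v ∧ ¬ G.Adj u v) :
    IsDiamondFreeCompletion G N F := by
  have e : G ⊔ SimpleGraph.fromEdgeSet F = H := by
    ext u v
    simp only [SimpleGraph.sup_adj, SimpleGraph.fromEdgeSet_adj, hF]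
    constructor
    · rintro (h1 | ⟨⟨h1, -⟩, -⟩)
      · exact h.le u v h1
      · exact h1
    · intro h1
      by_cases h2 : G.Adj u v
      · exact .inl h2
      · exact .inr ⟨⟨h1, h2⟩, h1.ne⟩
  refine ⟨fun u v huv => ?_, ?_⟩
  · rw [hF] at huv
    exact ⟨huv.1.ne, huv.2, h.new u v huv.1 huv.2⟩
  · rw [e, isDiamondFree_iff_fourPoint]
    exact h.fourPoint

theorem isProbeDiamondFree_iff {V : Type*} {G : SimpleGraph V} :
    IsProbeDiamondFree G ↔ ∃ N H, Completes G N H := by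
  constructor
  · rintro ⟨P, N, F, hP, hF, hd⟩
    refine ⟨N, G ⊔ SimpleGraph.fromEdgeSet F, ?_, fun u v h => .inl h,
      (isDiamondFree_iff_fourPoint _).1 hd, ?_⟩
    · intro u v hu hv huv
      exact hP.2.2 hu hv huv.ne huv
    · rintro u v (h | h) hn
      · exact absurd h hn
      · exact (hF u v ((SimpleGraph.fromEdgeSet_adj _).1 h).1).2.2
  · rintro ⟨N, H, h⟩
    refine ⟨Nᶜ, N, {e | e ∈ H.edgeSet ∧ e ∉ G.edgeSet}, h.isProbePartition,
      h.isDiamondFreeCompletion fun u v => by simp⟩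

theorem IsProbeDiamondFree.of_embedding {V W : Type*} {G : SimpleGraph V} {H : SimpleGraph W}
    (f : H ↪g G) (h : IsProbeDiamondFree G) : IsProbeDiamondFree H := by
  obtain ⟨N, K, hK⟩ := isProbeDiamondFree_iff.1 h
  refine isProbeDiamondFree_iff.2 ⟨f ⁻¹' N, K.comap f, ?_, ?_, ?_, ?_⟩
  · exact fun u v hu hv huv => hK.indep _ _ hu hv (f.map_rel_iff.2 huv)
  · exact fun u v huv => hK.le _ _ (f.map_rel_iff.2 huv)
  · exact fun a b c d hab => hK.fourPoint _ _ _ _ (f.injective.ne hab)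
  · exact fun u v huv hn => hK.new _ _ huv fun h => hn (f.map_rel_iff.1 h)

/-! ### Lines -/

/-- `z` is equal or adjacent to at least two of the vertices `v`, `w`, `a`. -/
def OnLine {V : Type*} (G : SimpleGraph V) (v w a z : V) : Prop :=
  ((z = v ∨ G.Adj z v) ∧ (z = w ∨ G.Adj z w)) ∨ ((z = v ∨ G.Adj z v) ∧ (z = a ∨ G.Adj z a)) ∨
    ((z = w ∨ G.Adj z w) ∧ (z = a ∨ G.Adj z a))

def IsTriangle {V : Type*} (G : SimpleGraph V) (v w a : V) : Prop :=
  G.Adj v w ∧ G.Adj v a ∧ G.Adj w a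

/-- `x` and `y` are different points of the line of a triangle with vertices in `X`. -/
def OnCommonLine {V : Type*} (G : SimpleGraph V) (X : Set V) (x y : V) : Prop :=
  x ≠ y ∧ ∃ v w a, v ∈ X ∧ w ∈ X ∧ a ∈ X ∧ IsTriangle G v w a ∧ OnLine G v w a x ∧ OnLine G v w a y

section
variable {V : Type*} {G H : SimpleGraph V} {N : Set V}

/-- Two vertices of the triangle are joined to `z`; the four-point condition on the edge between
them, applied to `z` and the third vertex, gives the third adjacency. -/
theorem Completes.adj_of_onLine (h : Completes G N H) {v w a z : V} (ht : IsTriangle G v w a)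
    (hz : OnLine G v w a z) :
    (z = v ∨ H.Adj z v) ∧ (z = w ∨ H.Adj z w) ∧ (z = a ∨ H.Adj z a) := by
  obtain ⟨h1, h2, h3⟩ := ht
  have g1 := h.le _ _ h1
  have g2 := h.le _ _ h2
  have g3 := h.le _ _ h3
  have cv : (z = v ∨ G.Adj z v) → (z = v ∨ H.Adj z v) := Or.imp_right (h.le _ _)
  have cw : (z = w ∨ G.Adj z w) → (z = w ∨ H.Adj z w) := Or.imp_right (h.le _ _)
  have ca : (z = a ∨ G.Adj z a) → (z = a ∨ H.Adj z a) := Or.imp_right (h.le _ _)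
  have key : ∀ p q r, H.Adj p q → H.Adj p r → H.Adj q r → (z = p ∨ H.Adj z p) →
      (z = q ∨ H.Adj z q) → (z = r ∨ H.Adj z r) := by
    intro p q r hpq hpr hqr e1 e2
    by_cases hzr : z = r
    · exact .inl hzr
    rcases e1 with rfl | e1
    · exact .inr hpr
    rcases e2 with rfl | e2
    · exact .inr hqr
    exact .inr (h.fourPoint z r p q hzr e1 e2 hpr.symm hqr.symm hpq)
  rcases hz with ⟨e1, e2⟩ | ⟨e1, e2⟩ | ⟨e1, e2⟩
  · exact ⟨cv e1, cw e2, key v w a g1 g2 g3 (cv e1) (cw e2)⟩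
  · exact ⟨cv e1, key v a w g2 g1 g3.symm (cv e1) (ca e2), ca e2⟩
  · exact ⟨key w a v g3 g1.symm g2.symm (cw e1) (ca e2), cw e1, ca e2⟩

/-- A new edge from `z` to a vertex of the triangle puts that vertex into `N`. The triangle has at
most one vertex in the independent set `N`, so at least two of the three adjacencies are already in
`G`. -/
theorem Completes.onLine_of_adj (h : Completes G N H) {v w a z : V} (ht : IsTriangle G v w a)
    (hv : z = v ∨ H.Adj z v) (hw : z = w ∨ H.Adj z w) (ha : z = a ∨ H.Adj z a) :
    OnLine G v w a z := by
  have key : ∀ u, (z = u ∨ H.Adj z u) → (z = u ∨ G.Adj z u) ∨ u ∈ N := by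
    rintro u (rfl | hu)
    · exact .inl (.inl rfl)
    · by_cases hg : G.Adj z u
      · exact .inl (.inr hg)
      · exact .inr (h.new _ _ hu hg).2
  have i1 : v ∈ N → w ∈ N → False := fun a b => h.indep _ _ a b ht.1
  have i2 : v ∈ N → a ∈ N → False := fun a b => h.indep _ _ a b ht.2.1
  have i3 : w ∈ N → a ∈ N → False := fun a b => h.indep _ _ a b ht.2.2
  rcases key v hv with p | p <;> rcases key w hw with q | q
  · exact .inl ⟨p, q⟩
  · exact .inr (.inl ⟨p, (key a ha).resolve_right (i3 q)⟩)
  · exact .inr (.inr ⟨q, (key a ha).resolve_right (i2 p)⟩)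
  · exact (i1 p q).elim

/-- In a diamond-free graph a vertex that is adjacent to two points of a clique is adjacent to
all of its other points. -/
theorem FourPoint.adj_extend (h : FourPoint H) {x y z u : V} (hxy : H.Adj x y) (hzx : H.Adj z x)
    (hzy : H.Adj z y) (hx : x = u ∨ H.Adj x u) (hy : y = u ∨ H.Adj y u) : z = u ∨ H.Adj z u := by
  by_cases hzu : z = u
  · exact .inl hzu
  rcases hx with rfl | hx
  · exact .inr hzx
  rcases hy with rfl | hy
  · exact .inr hzy
  exact .inr (h z u x y hzu hzx hzy hx.symm hy.symm hxy)

theorem Completes.adj_of_onCommonLine (h : Completes G N H) {X : Set V} {x y : V}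
    (hxy : OnCommonLine G X x y) : H.Adj x y := by
  obtain ⟨hne, v, w, a, -, -, -, ht, hx, hy⟩ := hxy
  obtain ⟨x1, x2, x3⟩ := h.adj_of_onLine ht hx
  obtain ⟨y1, y2, y3⟩ := h.adj_of_onLine ht hy
  have g1 := h.le _ _ ht.1
  have := h.fourPoint.adj_extend (u := y) (z := x) (x := v) (y := w) g1
  rcases x1 with rfl | x1
  · rcases y1 with rfl | y1
    · exact absurd rfl hne
    · exact y1.symm
  rcases x2 with rfl | x2
  · rcases y2 with rfl | y2
    · exact absurd rfl hne
    · exact y2.symm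
  have := this x1 x2 (y1.imp Eq.symm fun h => h.symm) (y2.imp Eq.symm fun h => h.symm)
  exact this.resolve_left hne

/-- The line is a maximal clique of `H`, and `x`, `y` span an edge of it, so a vertex joined to both
is joined to the whole triangle. This is the basic contradiction behind the conflicts found by the
algorithm and behind `S₃` and `S₄`. -/
theorem Completes.onLine_of_two (h : Completes G N H) {X : Set V} {v w a x y z : V}
    (ht : IsTriangle G v w a) (hxy : x ≠ y) (hx : OnLine G v w a x) (hy : OnLine G v w a y)
    (hzx : z = x ∨ G.Adj z x ∨ OnCommonLine G X z x)
    (hzy : z = y ∨ G.Adj z y ∨ OnCommonLine G X z y) :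
    OnLine G v w a z := by
  rcases hzx with rfl | hzx
  · exact hx
  rcases hzy with rfl | hzy
  · exact hy
  have e : ∀ u, (G.Adj z u ∨ OnCommonLine G X z u) → H.Adj z u := fun u hu =>
    hu.elim (h.le _ _) h.adj_of_onCommonLine
  have hH : H.Adj x y :=
    h.adj_of_onCommonLine (X := Set.univ) ⟨hxy, v, w, a, trivial, trivial, trivial, ht, hx, hy⟩
  obtain ⟨x1, x2, x3⟩ := h.adj_of_onLine ht hx
  obtain ⟨y1, y2, y3⟩ := h.adj_of_onLine ht hy
  exact h.onLine_of_adj ht (h.fourPoint.adj_extend hH (e _ hzx) (e _ hzy) x1 y1)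
    (h.fourPoint.adj_extend hH (e _ hzx) (e _ hzy) x2 y2)
    (h.fourPoint.adj_extend hH (e _ hzx) (e _ hzy) x3 y3)

theorem Completes.mem_of_onCommonLine (h : Completes G N H) {X : Set V} {x y : V}
    (hxy : OnCommonLine G X x y) (hn : ¬ G.Adj x y) : x ∈ N :=
  (h.new _ _ (h.adj_of_onCommonLine hxy) hn).1

theorem onLine_induce {X : Set V} {v w a z : X} :
    OnLine (G.induce X) v w a z ↔ OnLine G v w a z := by
  simp [OnLine, Subtype.ext_iff]

/-- The triangle of the common line is required to lie in `X` so that the reason for joining `x` and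
`y` survives the restriction to `X`. -/
theorem onCommonLine_induce {X : Set V} {x y : X} (h : OnCommonLine G X x y) :
    OnCommonLine (G.induce X) Set.univ x y := by
  obtain ⟨h1, v, w, a, hv, hw, ha, ht, hx, hy⟩ := h
  exact ⟨fun e => h1 (congrArg _ e), ⟨v, hv⟩, ⟨w, hw⟩, ⟨a, ha⟩, trivial, trivial, trivial,
    ht, onLine_induce.2 hx, onLine_induce.2 hy⟩

/-- A vertex off a line that is joined to two points of the line. -/
theorem not_isProbeDiamondFree_of_two {X : Set V} {v w a x y z : V}
    (hv : v ∈ X) (hw : w ∈ X) (ha : a ∈ X) (hxX : x ∈ X) (hyX : y ∈ X) (hzX : z ∈ X)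
    (ht : IsTriangle G v w a) (hxy : x ≠ y) (hx : OnLine G v w a x) (hy : OnLine G v w a y)
    (hzx : z = x ∨ G.Adj z x ∨ OnCommonLine G X z x)
    (hzy : z = y ∨ G.Adj z y ∨ OnCommonLine G X z y)
    (hz : ¬ OnLine G v w a z) : ¬ IsProbeDiamondFree (G.induce X) := by
  intro h
  obtain ⟨N, H, h⟩ := isProbeDiamondFree_iff.1 h
  refine hz (onLine_induce.1 (h.onLine_of_two (X := Set.univ) (v := ⟨v, hv⟩) (w := ⟨w, hw⟩)
    (a := ⟨a, ha⟩) (x := ⟨x, hxX⟩) (y := ⟨y, hyX⟩) (z := ⟨z, hzX⟩) ht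
    (by simpa using hxy) (onLine_induce.2 hx) (onLine_induce.2 hy) ?_ ?_))
  · exact hzx.imp (fun h => Subtype.ext h) (Or.imp id fun h => onCommonLine_induce h)
  · exact hzy.imp (fun h => Subtype.ext h) (Or.imp id fun h => onCommonLine_induce h)

/-- Two adjacent vertices that must both be nonprobes. -/
theorem not_isProbeDiamondFree_of_tips {X : Set V} {x y x' y' : V}
    (hx : x ∈ X) (hy : y ∈ X) (hx' : x' ∈ X) (hy' : y' ∈ X) (h1 : OnCommonLine G X x y)
    (h2 : OnCommonLine G X x' y') (n1 : ¬ G.Adj x y) (n2 : ¬ G.Adj x' y') (ha : G.Adj x x') :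
    ¬ IsProbeDiamondFree (G.induce X) := by
  intro h
  obtain ⟨N, H, h⟩ := isProbeDiamondFree_iff.1 h
  have m1 := h.mem_of_onCommonLine (onCommonLine_induce (x := ⟨x, hx⟩) (y := ⟨y, hy⟩) h1) n1
  have m2 := h.mem_of_onCommonLine (onCommonLine_induce (x := ⟨x', hx'⟩) (y := ⟨y', hy'⟩) h2) n2
  exact h.indep _ _ m1 m2 ha

/-- A sufficient criterion for a completion: a family `mem` of lines such that every edge in a
triangle is on a line, the line graph `H` has no vertex off a line that is joined to two points of
it, and the vertices that get new edges are independent. -/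
theorem completes_of_lines {ι : Type*} (mem : ι → V → Prop)
    (hH : ∀ u v, H.Adj u v ↔ G.Adj u v ∨ u ≠ v ∧ ∃ j, mem j u ∧ mem j v)
    (cover : ∀ u v c, G.Adj u v → G.Adj u c → G.Adj v c → ∃ j, mem j u ∧ mem j v)
    (two : ∀ j x y z, x ≠ y → mem j x → mem j y → H.Adj z x → H.Adj z y → mem j z)
    (indep : ∀ u v, u ∈ N → v ∈ N → ¬ G.Adj u v)
    (new : ∀ u v, H.Adj u v → ¬ G.Adj u v → u ∈ N) : Completes G N H := by
  refine ⟨indep, fun u v h => (hH u v).2 (.inl h), ?_,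
    fun u v h hn => ⟨new u v h hn, new v u h.symm fun h' => hn h'.symm⟩⟩
  intro a b c d hab hac had hbc hbd hcd
  -- Suppose `cd` is an edge of `G` on no line. If `ac` were not an edge of `G`, then `a` and `c`
  -- would be on a line, and `d`, joined to both, would be on it too. The same holds for `ad`, so `a
  -- c d` is a triangle of `G` and `cover` applies.
  have line : ∃ j, mem j c ∧ mem j d := by
    rcases (hH c d).1 hcd with h | h
    · by_contra hno
      have one : ∀ u v, (u = c ∧ v = d ∨ u = d ∧ v = c) → H.Adj a u → H.Adj a v → G.Adj a u := by
        intro u v huv hu hv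
        rcases (hH a u).1 hu with h' | ⟨-, j, ja, ju⟩
        · exact h'
        · have uv : H.Adj u v := by
            rcases huv with ⟨rfl, rfl⟩ | ⟨rfl, rfl⟩
            · exact hcd
            · exact hcd.symm
          have := two j a u v hu.ne ja ju hv.symm uv.symm
          rcases huv with ⟨rfl, rfl⟩ | ⟨rfl, rfl⟩
          · exact absurd ⟨j, ju, this⟩ hno
          · exact absurd ⟨j, this, ju⟩ hno
      exact hno (cover c d a h (one c d (.inl ⟨rfl, rfl⟩) hac had).symm
        (one d c (.inr ⟨rfl, rfl⟩) had hac).symm)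
    · exact h.2
  obtain ⟨j, jc, jd⟩ := line
  exact (hH a b).2 (.inr ⟨hab, j, two j c d a hcd.ne jc jd hac had,
    two j c d b hcd.ne jc jd hbc hbd⟩)

end

/-! ### Finite facts about the obstructions -/

/-- The adjacency matrices of the obstructions: bit `9 * i + j` for the positions `i`, `j`. -/
def obsMask : ℕ → ℕ
  | 1 => 344005024286
  | 2 => 895908321822
  | 3 => 207100852766
  | 4 => 108403675475249726
  | 5 => 621430970902
  | 6 => 1011274249979841054
  | 7 => 442781260540969519686
  | 8 => 313689861052990579278
  | 9 => 1036195252613541534222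
  | 10 => 28682025536810977934
  | 11 => 110735495227710419542
  | 12 => 28609543660426834574
  | 13 => 906525421984117277214
  | 14 => 906381550891647735868
  | 15 => 406337386563452039734
  | 16 => 406085181137907671606
  | 17 => 635214301139413525278840
  | _ => 0

/-- The diamonds of the obstructions, each with its tips first. -/
def obsDiamonds : ℕ → List (ℕ × ℕ × ℕ × ℕ)
  | 1 => [(2, 3, 0, 1), (1, 4, 0, 2)]
  | 2 => [(2, 3, 0, 1), (1, 4, 0, 2), (1, 4, 0, 3), (2, 3, 0, 4)]
  | 3 => [(2, 4, 0, 1), (3, 4, 0, 1)]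
  | 4 => [(4, 5, 0, 3), (0, 6, 1, 2)]
  | 5 => [(0, 3, 1, 2)]
  | 6 => [(0, 5, 1, 2), (0, 6, 3, 4)]
  | 7 => [(2, 6, 0, 1), (3, 7, 4, 5)]
  | 8 => [(3, 6, 0, 2), (4, 7, 1, 5)]
  | 9 => [(2, 3, 0, 1), (4, 5, 6, 7)]
  | 10 => [(2, 7, 0, 1), (3, 4, 5, 6)]
  | 11 => [(4, 6, 0, 1), (5, 7, 2, 3)]
  | 12 => [(3, 7, 0, 1), (4, 5, 2, 6)]
  | 13 => [(3, 4, 0, 2), (5, 6, 1, 7)]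
  | 14 => [(2, 5, 0, 4), (3, 7, 1, 6)]
  | 15 => [(4, 5, 0, 1), (6, 7, 2, 3)]
  | 16 => [(4, 5, 0, 1), (6, 7, 2, 3)]
  | 17 => [(0, 1, 3, 4), (0, 2, 5, 6), (1, 2, 7, 8)]
  | _ => []

def obsAdj (ind i j : ℕ) : Bool := (obsMask ind).testBit (9 * i + j)

/-- Whether `i`, `j` are the tips of a listed diamond that avoids `v`. -/
def obsTips (ind v i j : ℕ) : Bool :=
  (obsDiamonds ind).any fun t =>
    (t.1 == i && t.2.1 == j || t.1 == j && t.2.1 == i) && t.1 != v && t.2.1 != v &&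
      t.2.2.1 != v && t.2.2.2 != v

/-- The completion of the obstruction without its vertex `v`. -/
def obsJoined (ind v i j : ℕ) : Bool := obsAdj ind i j || obsTips ind v i j

/-- The number of vertices of an obstruction. -/
def obsOrder (ind : ℕ) : ℕ := (obstruction ind).order

/-- The bridge to bit masks, on which all later finite facts are evaluated by `decide`. -/
theorem obstruction_adj {ind : ℕ} (h1 : 1 ≤ ind) (h2 : ind ≤ 17) :
    ∀ i j, (obstruction ind).graph.Adj i j ↔ obsAdj ind i j = true := by
  have key : ∀ (k : ℕ) (E : List (ℕ × ℕ)) (ind : ℕ),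
      (∀ i j : Fin k, (i ≠ j ∧ ((i.val + 1, j.val + 1) ∈ E ∨ (j.val + 1, i.val + 1) ∈ E)) ↔
        obsAdj ind i j = true) →
      ∀ i j, (OrderedGraph.ofEdges k E).graph.Adj i j ↔ obsAdj ind i j = true := by
    intro k E ind h i j
    rw [← h i j]
    exact SimpleGraph.fromRel_adj _ _ _
  interval_cases ind <;> exact key _ _ _ (by decide)

/-- In the completion, the common neighbors of `c` and `d` are pairwise adjacent. -/
def obsClosed (ind v c d : ℕ) : Bool :=
  (List.range (obsOrder ind)).all fun a =>
    a == v || !obsJoined ind v a c || !obsJoined ind v a d ||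
      (List.range (obsOrder ind)).all fun b =>
        b == v || a == b || !obsJoined ind v b c || !obsJoined ind v b d || obsJoined ind v a b

-- The four-point condition for every vertex-deleted completion, arranged so that the inner searches
-- run only for pairs `c`, `d` that are already joined; this keeps the evaluation small.
set_option maxRecDepth 100000 in
theorem obs_closed {ind : ℕ} (h1 : 1 ≤ ind) (h2 : ind ≤ 17) :
    ((List.range (obsOrder ind)).all fun v => (List.range (obsOrder ind)).all fun c =>
      (List.range (obsOrder ind)).all fun d =>
        c == v || d == v || !obsJoined ind v c d || obsClosed ind v c d) = true := by
  interval_cases ind <;> decide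

theorem obs_fourPoint {ind : ℕ} (h1 : 1 ≤ ind) (h2 : ind ≤ 17) {v a b c d : ℕ}
    (hv : v < obsOrder ind) (ha : a < obsOrder ind) (hb : b < obsOrder ind)
    (hc : c < obsOrder ind) (hd : d < obsOrder ind) (av : a ≠ v) (bv : b ≠ v) (cv : c ≠ v)
    (dv : d ≠ v) (ab : a ≠ b) (ac : obsJoined ind v a c = true) (ad : obsJoined ind v a d = true)
    (bc : obsJoined ind v b c = true) (bd : obsJoined ind v b d = true)
    (cd : obsJoined ind v c d = true) : obsJoined ind v a b = true := by
  have h := obs_closed h1 h2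
  simp only [List.all_eq_true, List.mem_range] at h
  have h := h v hv c hc d hd
  simp only [beq_eq_false_iff_ne.2 cv, beq_eq_false_iff_ne.2 dv, cd, Bool.false_or, Bool.not_true,
    obsClosed, List.all_eq_true, List.mem_range] at h
  have h := h a ha
  simp only [beq_eq_false_iff_ne.2 av, ac, ad, Bool.false_or, Bool.not_true,
    List.all_eq_true, List.mem_range] at h
  simpa [beq_eq_false_iff_ne.2 bv, beq_eq_false_iff_ne.2 ab, bc, bd] using h b hb

-- After the deletion of `v`, the tips of the surviving diamonds can serve as the nonprobes.
set_option maxRecDepth 100000 in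
theorem obs_indep {ind : ℕ} (h1 : 1 ≤ ind) (h2 : ind ≤ 17) :
    ((List.range (obsOrder ind)).all fun v => (List.range (obsOrder ind)).all fun x =>
      (List.range (obsOrder ind)).all fun y => !obsTips ind v x y ||
        (List.range (obsOrder ind)).all fun x' => !obsAdj ind x x' ||
          (List.range (obsOrder ind)).all fun y' => !obsTips ind v x' y') = true := by
  interval_cases ind <;> decide

theorem obsTips_comm (ind v x y : ℕ) : obsTips ind v x y = obsTips ind v y x := by
  simp only [obsTips, Bool.or_comm]

/-- Vertex-deleted subgraphs of the obstructions are probe diamond-free. -/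
theorem isProbeDiamondFree_obstruction_delete {ind : ℕ} (h1 : 1 ≤ ind) (h2 : ind ≤ 17)
    (v : Fin (obstruction ind).order) :
    IsProbeDiamondFree ((obstruction ind).graph.induce {v}ᶜ) := by
  have hadj := obstruction_adj h1 h2
  have symm : ∀ i j : Fin (obstruction ind).order, obsAdj ind i j = obsAdj ind j i := by
    intro i j
    rw [Bool.eq_iff_iff, ← hadj, ← hadj]
    exact SimpleGraph.adj_comm _ _ _
  refine isProbeDiamondFree_iff.2 ⟨{x | ∃ y : Fin (obstruction ind).order,
    obsTips ind v x.1 y = true},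
    SimpleGraph.mk (fun x y => x ≠ y ∧ obsJoined ind v x.1 y.1 = true) ?_ ?_, ?_, ?_, ?_, ?_⟩
  · refine ⟨?_⟩
    rintro x y ⟨hne, hxy⟩
    refine ⟨hne.symm, ?_⟩
    rwa [obsJoined, symm, obsTips_comm]
  · exact ⟨fun x h => h.1 rfl⟩
  · rintro x x' ⟨y, hy⟩ ⟨y', hy'⟩ hxx'
    have h := obs_indep h1 h2
    simp only [List.all_eq_true, List.mem_range] at h
    have h := h v v.2 x.1 x.1.2 y y.2
    simp only [hy, Bool.false_or, Bool.not_true, List.all_eq_true, List.mem_range] at h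
    have h := h x'.1 x'.1.2
    have e : obsAdj ind x.1 x'.1 = true := (hadj _ _).1 hxx'
    simp only [e, Bool.false_or, Bool.not_true, List.all_eq_true, List.mem_range] at h
    have h := h y' y'.2
    simp [hy'] at h
  · intro x y hxy
    refine ⟨hxy.ne, ?_⟩
    have e : obsAdj ind x.1 y.1 = true := (hadj _ _).1 hxy
    simp [obsJoined, e]
  · intro a b c d hab hac had hbc hbd hcd
    have ne : ∀ x : ({v}ᶜ : Set (Fin (obstruction ind).order)), x.1.val ≠ v.val := fun x h =>
      x.2 (Fin.ext h)
    refine ⟨hab, obs_fourPoint h1 h2 v.2 a.1.2 b.1.2 c.1.2 d.1.2 (ne a) (ne b) (ne c) (ne d) ?_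
      hac.2 had.2 hbc.2 hbd.2 hcd.2⟩
    exact fun h => hab (Subtype.ext (Fin.ext h))
  · rintro x y ⟨-, hxy⟩ hn
    have hn : obsAdj ind x.1 y.1 = false := by
      rw [Bool.eq_false_iff]
      exact fun h => hn ((hadj _ _).2 h)
    have hxy : obsTips ind v x.1 y.1 = true := by simpa [obsJoined, hn] using hxy
    exact ⟨⟨y.1, hxy⟩, ⟨x.1, by rwa [obsTips_comm]⟩⟩

/-- Two diamonds with adjacent tips. -/
def obsClash (ind : ℕ) : Bool :=
  (List.finRange (obsOrder ind)).any fun x => (List.finRange (obsOrder ind)).any fun x' =>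
    obsAdj ind x x' && [x, x'].all fun u => (List.finRange (obsOrder ind)).any fun y =>
      u != y && !obsAdj ind u y && (List.finRange (obsOrder ind)).any fun c =>
        obsAdj ind u c && obsAdj ind y c && (List.finRange (obsOrder ind)).any fun d =>
          obsAdj ind u d && obsAdj ind y d && obsAdj ind c d

-- All obstructions but `S₄` (number 5) and `S₃` (number 17) fail for this reason: tips of diamonds
-- must be nonprobes, and two of them are adjacent.
set_option maxRecDepth 100000 in
theorem obsClash_eq_true {ind : ℕ} (h1 : 1 ≤ ind) (h2 : ind ≤ 16) (h5 : ind ≠ 5) :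
    obsClash ind = true := by
  interval_cases ind <;> first | contradiction | decide

/-- In `S₄` the vertex `4` is off the line of the triangle `0 1 2` but adjacent to its points `0`
and `3`. In `S₃` the vertex `2` is off the line through `0` and `1` but joined to both by the lines
of the other two diamonds. The remaining graphs have adjacent tips. -/
theorem not_isProbeDiamondFree_obstruction {ind : ℕ} (h1 : 1 ≤ ind) (h2 : ind ≤ 17) :
    ¬ IsProbeDiamondFree (obstruction ind).graph := by
  intro h
  obtain ⟨N, H, h⟩ := isProbeDiamondFree_iff.1 h
  have hadj := obstruction_adj h1 h2
  by_cases h5 : ind = 5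
  · subst h5
    have := h.onLine_of_two (X := Set.univ) (v := (0 : Fin 5)) (w := (1 : Fin 5)) (a := (2 : Fin 5))
      (x := (0 : Fin 5)) (y := (3 : Fin 5)) (z := (4 : Fin 5)) ⟨(hadj _ _).2 rfl, (hadj _ _).2 rfl,
        (hadj _ _).2 rfl⟩ (by decide : (0 : Fin 5) ≠ 3) (.inl ⟨.inl rfl, .inr ((hadj _ _).2 rfl)⟩)
        (.inr (.inr ⟨.inr ((hadj _ _).2 rfl), .inr ((hadj _ _).2 rfl)⟩))
        (.inr (.inl ((hadj _ _).2 rfl))) (.inr (.inl ((hadj _ _).2 rfl)))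
    rcases this with ⟨-, h⟩ | ⟨-, h⟩ | ⟨-, h⟩
    · exact h.elim (by decide : (4 : Fin 5) ≠ 1) fun h =>
        (by decide : ¬ obsAdj 5 4 1 = true) ((hadj _ _).1 h)
    · exact h.elim (by decide : (4 : Fin 5) ≠ 2) fun h =>
        (by decide : ¬ obsAdj 5 4 2 = true) ((hadj _ _).1 h)
    · exact h.elim (by decide : (4 : Fin 5) ≠ 2) fun h =>
        (by decide : ¬ obsAdj 5 4 2 = true) ((hadj _ _).1 h)
  by_cases h17 : ind = 17
  · subst h17
    have onl : ∀ {v w a z : Fin 9}, obsAdj 17 z w = true → obsAdj 17 z a = true →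
        OnLine (obstruction 17).graph v w a z := fun e1 e2 =>
      .inr (.inr ⟨.inr ((hadj _ _).2 e1), .inr ((hadj _ _).2 e2)⟩)
    have tri : ∀ {v w a : Fin 9}, obsAdj 17 v w = true → obsAdj 17 v a = true →
        obsAdj 17 w a = true → IsTriangle (obstruction 17).graph v w a := fun e1 e2 e3 =>
      ⟨(hadj _ _).2 e1, (hadj _ _).2 e2, (hadj _ _).2 e3⟩
    have := h.onLine_of_two (X := Set.univ) (v := (0 : Fin 9)) (w := (3 : Fin 9)) (a := (4 : Fin 9))
      (x := (0 : Fin 9)) (y := (1 : Fin 9)) (z := (2 : Fin 9)) (tri rfl rfl rfl)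
      (by decide : (0 : Fin 9) ≠ 1)
      (onl rfl rfl) (onl rfl rfl)
      (.inr (.inr ⟨(by decide : (2 : Fin 9) ≠ 0), (0 : Fin 9), (5 : Fin 9), (6 : Fin 9), trivial, trivial,
        trivial,
        tri rfl rfl rfl, onl rfl rfl, onl rfl rfl⟩))
      (.inr (.inr ⟨(by decide : (2 : Fin 9) ≠ 1), (1 : Fin 9), (7 : Fin 9), (8 : Fin 9), trivial, trivial,
        trivial,
        tri rfl rfl rfl, onl rfl rfl, onl rfl rfl⟩))
    rcases this with ⟨-, h⟩ | ⟨-, h⟩ | ⟨-, h⟩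
    · exact h.elim (by decide : (2 : Fin 9) ≠ 3) fun h =>
        (by decide : ¬ obsAdj 17 2 3 = true) ((hadj _ _).1 h)
    · exact h.elim (by decide : (2 : Fin 9) ≠ 4) fun h =>
        (by decide : ¬ obsAdj 17 2 4 = true) ((hadj _ _).1 h)
    · exact h.elim (by decide : (2 : Fin 9) ≠ 4) fun h =>
        (by decide : ¬ obsAdj 17 2 4 = true) ((hadj _ _).1 h)
  · have hc := obsClash_eq_true h1 (by omega) h5
    simp only [obsClash, List.any_eq_true, List.all_eq_true, List.mem_finRange, true_and,
      Bool.and_eq_true, bne_iff_ne, Bool.not_eq_true'] at hc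
    obtain ⟨x, x', hxx', hc⟩ := hc
    have key : ∀ u ∈ [x, x'], u ∈ N := by
      intro u hu
      obtain ⟨y, ⟨huy, hn⟩, c, ⟨huc, hyc⟩, d, ⟨hud, hyd⟩, hcd⟩ := hc u hu
      have e : ∀ i j : Fin (obsOrder ind), obsAdj ind i j = true → H.Adj i j := fun i j hij =>
        h.le _ _ ((hadj i j).2 hij)
      refine (h.new u y (h.fourPoint u y c d huy (e _ _ huc) (e _ _ hud) (e _ _ hyc) (e _ _ hyd)
        (e _ _ hcd)) ?_).1
      intro h'
      have := (hadj u y).1 h'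
      simp [hn] at this
    exact h.indep x x' (key x (by simp)) (key x' (by simp)) ((hadj x x').2 hxx')

theorem isMinimalForbidden_obstruction {ind : ℕ} (h1 : 1 ≤ ind) (h2 : ind ≤ 17) :
    IsMinimalForbidden (obstruction ind).graph := by
  refine ⟨not_isProbeDiamondFree_obstruction h1 h2, fun A hA => ?_⟩
  obtain ⟨v, hv⟩ := (Set.ne_univ_iff_exists_notMem A).1 hA
  refine (isProbeDiamondFree_obstruction_delete h1 h2 v).of_embedding
    (SimpleGraph.induceHomOfLE _ ?_)
  intro x hx
  simp only [Set.mem_compl_iff, Set.mem_singleton_iff]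
  rintro rfl
  exact hv hx

def obsDegree (ind i : ℕ) : ℕ := (List.range (obsOrder ind)).countP fun j => obsAdj ind i j

set_option maxRecDepth 100000 in
theorem obs_degreeLex {ind : ℕ} (h1 : 1 ≤ ind) (h2 : ind ≤ 17) :
    ((List.range (obsOrder ind)).all fun j => (List.range j).all fun i =>
      decide (obsDegree ind j ≤ obsDegree ind i) &&
        (obsDegree ind j != obsDegree ind i || (List.range i).all fun p =>
          (List.range p).any (fun q => obsAdj ind i q != obsAdj ind j q) ||
            !obsAdj ind j p || obsAdj ind i p)) = true := by
  interval_cases ind <;> decide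

/-! ### Minimality and vertex order of an induced copy of an obstruction. -/

variable {V : Type*} {G : SimpleGraph V} {ind : ℕ} {Q : Fin (obstruction ind).order → V}

theorem InducesOrdered.isMinimalForbidden (h1 : 1 ≤ ind) (h2 : ind ≤ 17)
    (hQ : InducesOrdered G (obstruction ind) Q) :
    IsMinimalForbidden (G.induce (Set.range Q)) := by
  let e : (obstruction ind).graph ≃g G.induce (Set.range Q) :=
    ⟨Equiv.ofInjective Q hQ.1, fun {i j} => hQ.2 i j⟩
  have hm := isMinimalForbidden_obstruction h1 h2
  refine ⟨fun h => hm.1 (h.of_embedding e.toEmbedding), fun A hA => ?_⟩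
  have hB : e ⁻¹' A ≠ Set.univ := by
    intro h
    apply hA
    rw [Set.eq_univ_iff_forall] at h ⊢
    intro x
    simpa using h (e.symm x)
  refine (hm.2 _ hB).of_embedding ⟨⟨fun x => ⟨e.symm x.1, by simp⟩, ?_⟩, ?_⟩
  · intro x y hxy
    simpa [Subtype.ext_iff] using hxy
  · intro x y
    exact e.symm.map_rel_iff

theorem InducesOrdered.isDegreeLex (h1 : 1 ≤ ind) (h2 : ind ≤ 17)
    (hQ : InducesOrdered G (obstruction ind) Q) : IsDegreeLex G Q := by
  have hadj : ∀ i j, G.Adj (Q i) (Q j) ↔ obsAdj ind i j = true := fun i j =>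
    (hQ.2 i j).trans (obstruction_adj h1 h2 i j)
  have hdeg : ∀ i, seqDegree G Q i = obsDegree ind i := by
    intro i
    rw [seqDegree, obsDegree, List.countP_eq_length_filter,
      ← List.toFinset_card_of_nodup (List.nodup_range.filter _)]
    rw [← Set.ncard_image_of_injective _ Fin.val_injective, ← Set.ncard_coe_finset]
    congr 1
    ext x
    simp only [hadj, Set.mem_image, Set.mem_ofPred_eq, List.coe_toFinset, List.mem_filter,
      List.mem_range]
    constructor
    · rintro ⟨j, hj, rfl⟩
      exact ⟨j.2, hj⟩
    · rintro ⟨hx, hj⟩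
      exact ⟨⟨x, hx⟩, hj, rfl⟩
  intro i j hij
  have h := obs_degreeLex h1 h2
  simp only [List.all_eq_true, List.mem_range, Bool.and_eq_true, decide_eq_true_eq] at h
  obtain ⟨hle, hlex⟩ := h j j.2 i hij
  rw [hdeg, hdeg]
  refine ⟨hle, fun he p hp hq hjp => ?_⟩
  simp only [he, bne_self_eq_false, Bool.false_or, List.all_eq_true, List.mem_range] at hlex
  have h := hlex p hp
  rw [hadj] at hjp ⊢
  simp only [hjp, Bool.not_true, Bool.or_false, Bool.or_eq_true, List.any_eq_true,
    List.mem_range, bne_iff_ne] at h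
  refine h.resolve_left ?_
  rintro ⟨q, hqp, hne⟩
  have := hq ⟨q, by omega⟩ hqp
  rw [hadj, hadj] at this
  exact hne (Bool.eq_iff_iff.2 this)

/-! ### Obstruction-free graphs are probe diamond-free -/

/-- `a b` are the tips and `c d` the other vertices of an induced diamond. -/
structure Dia {V : Type*} (G : SimpleGraph V) (a b c d : V) : Prop where
  ne : a ≠ b
  nadj : ¬ G.Adj a b
  ac : G.Adj a c
  ad : G.Adj a d
  bc : G.Adj b c
  bd : G.Adj b d
  cd : G.Adj c d

/-- `G` contains none of the 17 obstructions. -/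
def ObstructionFree {V : Type*} (G : SimpleGraph V) : Prop :=
  ∀ ind, 1 ≤ ind → ind ≤ 17 → ∀ Q, ¬ InducesOrdered G (obstruction ind) Q

/-- The closed common neighborhood of `c` and `d`. -/
def Blk {V : Type*} (G : SimpleGraph V) (c d z : V) : Prop :=
  z = c ∨ z = d ∨ (G.Adj z c ∧ G.Adj z d)

section
variable {V : Type*} {G : SimpleGraph V} {a b c d a' b' c' d' : V}

theorem Dia.swap_tips (h : Dia G a b c d) : Dia G b a c d :=
  ⟨h.ne.symm, fun e => h.nadj e.symm, h.bc, h.bd, h.ac, h.ad, h.cd⟩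

theorem Dia.swap_centers (h : Dia G a b c d) : Dia G a b d c :=
  ⟨h.ne, h.nadj, h.ad, h.ac, h.bd, h.bc, h.cd.symm⟩

/-- Reduces an induced copy to one condition for each pair `i < j`. Only nonadjacent positions need
an explicit inequality, since adjacent vertices differ anyway. -/
theorem ObstructionFree.elim (hG : ObstructionFree G) {ind : ℕ} (h1 : 1 ≤ ind) (h2 : ind ≤ 17)
    (Q : Fin (obstruction ind).order → V)
    (h : ∀ i j : Fin (obstruction ind).order, i < j → (obsAdj ind i j = true → G.Adj (Q i) (Q j)) ∧
      (obsAdj ind i j = false → Q i ≠ Q j ∧ ¬ G.Adj (Q i) (Q j))) : False := by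
  have ne : ∀ i j, i < j → Q i ≠ Q j := by
    intro i j hij
    cases e : obsAdj ind i j
    · exact ((h i j hij).2 e).1
    · exact ((h i j hij).1 e).ne
  have adj : ∀ i j, i < j → (G.Adj (Q i) (Q j) ↔ (obstruction ind).graph.Adj i j) := by
    intro i j hij
    rw [obstruction_adj h1 h2]
    cases e : obsAdj ind i j
    · simpa using ((h i j hij).2 e).2
    · simpa using (h i j hij).1 e
  refine hG ind h1 h2 Q ⟨fun i j hij => ?_, fun i j => ?_⟩
  · rcases lt_trichotomy i j with h' | h' | h'
    · exact absurd hij (ne i j h')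
    · exact h'
    · exact absurd hij.symm (ne j i h')
  · rcases lt_trichotomy i j with h' | rfl | h'
    · exact adj i j h'
    · simp
    · rw [G.adj_comm, (obstruction ind).graph.adj_comm]
      exact adj j i h'

/-- If `z` is adjacent to both tips but not to `c`, there is a wheel `W₄` with hub `d` and rim `a c
b z` when `z` is adjacent to `d`, and an `S₄` otherwise. -/
theorem Dia.adj_of_tips (h : Dia G a b c d) (hG : ObstructionFree G) {z : V} (ha : G.Adj z a)
    (hb : G.Adj z b) (hc : z ≠ c) : G.Adj z c := by
  by_contra hn
  obtain ⟨h1, h2, h3, h4, h5, h6, h7⟩ := h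
  have hd : z ≠ d := by rintro rfl; exact hn h7.symm
  by_cases e : G.Adj z d
  · refine hG.elim (ind := 2) (by simp) (by simp) (![d, a, c, z, b] : Fin 5 → V) ?_
    intro (i : Fin 5) (j : Fin 5) hij
    fin_cases i <;> fin_cases j <;> first
      | exact absurd hij (by decide)
      | exact ⟨fun _ => by first | assumption | (apply SimpleGraph.Adj.symm; assumption),
          fun h => absurd h (by decide)⟩
      | exact ⟨fun h => absurd h (by decide), fun _ =>
          ⟨by first | assumption | (apply Ne.symm; assumption),
            by first | assumption | (rw [G.adj_comm]; assumption)⟩⟩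
  · refine hG.elim (ind := 5) (by simp) (by simp) (![a, c, d, b, z] : Fin 5 → V) ?_
    intro (i : Fin 5) (j : Fin 5) hij
    fin_cases i <;> fin_cases j <;> first
      | exact absurd hij (by decide)
      | exact ⟨fun _ => by first | assumption | (apply SimpleGraph.Adj.symm; assumption),
          fun h => absurd h (by decide)⟩
      | exact ⟨fun h => absurd h (by decide), fun _ =>
          ⟨by first | assumption | (apply Ne.symm; assumption),
            by first | assumption | (rw [G.adj_comm]; assumption)⟩⟩

/-- If `z` is adjacent to `b`, the previous lemma applies. Otherwise a missing edge `zd` leaves a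
gem with hub `c` and path `z a d b`. -/
theorem Dia.adj_of_tip_center (h : Dia G a b c d) (hG : ObstructionFree G) {z : V}
    (ha : G.Adj z a) (hc : G.Adj z c) (hd : z ≠ d) : G.Adj z d := by
  by_cases hb : G.Adj z b
  · exact h.swap_centers.adj_of_tips hG ha hb hd
  by_contra hn
  have hzb : z ≠ b := by rintro rfl; exact h.nadj ha.symm
  obtain ⟨h1, h2, h3, h4, h5, h6, h7⟩ := h
  refine hG.elim (ind := 1) (by simp) (by simp) (![c, a, d, z, b] : Fin 5 → V) ?_
  intro (i : Fin 5) (j : Fin 5) hij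
  fin_cases i <;> fin_cases j <;> first
    | exact absurd hij (by decide)
    | exact ⟨fun _ => by first | assumption | (apply SimpleGraph.Adj.symm; assumption),
        fun h => absurd h (by decide)⟩
    | exact ⟨fun h => absurd h (by decide), fun _ =>
        ⟨by first | assumption | (apply Ne.symm; assumption),
          by first | assumption | (rw [G.adj_comm]; assumption)⟩⟩

/-- A counterexample is the complement of `P₃ + 2K₁`: its complement has the path `a b z` and the
isolated vertices `c`, `d`. -/
theorem Dia.adj_of_centers (h : Dia G a b c d) (hG : ObstructionFree G) {z : V}
    (hc : G.Adj z c) (hd : G.Adj z d) (ha : G.Adj z a) (hzb : z ≠ b) : G.Adj z b := by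
  by_contra hn
  obtain ⟨h1, h2, h3, h4, h5, h6, h7⟩ := h
  refine hG.elim (ind := 3) (by simp) (by simp) (![c, d, z, a, b] : Fin 5 → V) ?_
  intro (i : Fin 5) (j : Fin 5) hij
  fin_cases i <;> fin_cases j <;> first
    | exact absurd hij (by decide)
    | exact ⟨fun _ => by first | assumption | (apply SimpleGraph.Adj.symm; assumption),
        fun h => absurd h (by decide)⟩
    | exact ⟨fun h => absurd h (by decide), fun _ => ⟨by assumption, by assumption⟩⟩

theorem Blk.swap {z : V} (h : Blk G c d z) : Blk G d c z := by
  unfold Blk at *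
  tauto

/-- A neighbor of one of the two middle vertices of a diamond and of another vertex of the block
is in the block. -/
theorem Dia.blk_of_center (h : Dia G a b c d) (hG : ObstructionFree G) {y z : V}
    (hyc : G.Adj y c) (hyd : G.Adj y d) (hzc : G.Adj z c) (hzy : G.Adj z y) : Blk G c d z := by
  by_cases hzd : z = d
  · exact .inr (.inl hzd)
  refine .inr (.inr ⟨hzc, ?_⟩)
  by_cases hya : y = a
  · subst hya
    exact h.adj_of_tip_center hG hzy hzc hzd
  by_cases hyb : y = b
  · subst hyb
    exact h.swap_tips.adj_of_tip_center hG hzy hzc hzd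
  by_cases ha : G.Adj y a
  · have hb := h.adj_of_centers hG hyc hyd ha hyb
    -- A point `y` adjacent to both tips can replace `d` as a middle vertex.
    have h' : Dia G a b c y := ⟨h.ne, h.nadj, h.ac, ha.symm, h.bc, hb.symm, hyc.symm⟩
    by_cases hza : z = a
    · subst hza
      exact h.ad
    by_cases e : G.Adj z a
    · exact h.adj_of_tip_center hG e hzc hzd
    · have h'' : Dia G a z c y :=
        ⟨Ne.symm hza, fun e' => e e'.symm, h.ac, ha.symm, hzc, hzy, hyc.symm⟩
      exact (h''.adj_of_centers hG h.cd.symm hyd.symm h.ad.symm (Ne.symm hzd)).symm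
  · have h' : Dia G y a c d := ⟨hya, ha, hyc, hyd, h.ac, h.ad, h.cd⟩
    exact h'.adj_of_tip_center hG hzy hzc hzd

/-- A vertex with two neighbors in the block of a diamond is in the block. -/
theorem Dia.blk_of_two (h : Dia G a b c d) (hG : ObstructionFree G) {x y z : V} (hxy : x ≠ y)
    (hx : Blk G c d x) (hy : Blk G c d y) (hzx : G.Adj z x) (hzy : G.Adj z y) : Blk G c d z := by
  rcases hx with rfl | rfl | ⟨hxc, hxd⟩
  · rcases hy with rfl | rfl | ⟨hyc, hyd⟩
    · exact absurd rfl hxy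
    · exact .inr (.inr ⟨hzx, hzy⟩)
    · exact h.blk_of_center hG hyc hyd hzx hzy
  · rcases hy with rfl | rfl | ⟨hyc, hyd⟩
    · exact .inr (.inr ⟨hzy, hzx⟩)
    · exact absurd rfl hxy
    · exact (h.swap_centers.blk_of_center hG hyd hyc hzx hzy).swap
  rcases hy with rfl | rfl | ⟨hyc, hyd⟩
  · exact h.blk_of_center hG hxc hxd hzy hzx
  · exact (h.swap_centers.blk_of_center hG hxd hxc hzy hzx).swap
  by_cases hzc : z = c
  · exact .inl hzc
  suffices hs : G.Adj z c from h.blk_of_center hG hxc hxd hs hzx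
  by_cases e : G.Adj x y
  · by_cases hn : ∃ t, Dia G x t c d
    · obtain ⟨t, ht⟩ := hn
      by_cases hyt : y = t
      · subst hyt
        exact absurd e ht.nadj
      have hyt' := ht.adj_of_centers hG hyc hyd e.symm hyt
      have h' : Dia G x t y c :=
        ⟨ht.ne, ht.nadj, e, ht.ac, hyt'.symm, ht.bc, hyc⟩
      exact h'.adj_of_tip_center hG hzx hzy hzc
    · have adj : ∀ t, G.Adj t c → G.Adj t d → x ≠ t → G.Adj x t := by
        intro t htc htd hxt
        by_contra hna
        exact hn ⟨t, hxt, hna, hxc, hxd, htc, htd, h.cd⟩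
      have hxa : x ≠ a := by
        rintro rfl
        exact h.nadj (adj b h.bc h.bd h.ne)
      have hxb : x ≠ b := by
        rintro rfl
        exact h.nadj (adj a h.ac h.ad h.ne.symm).symm
      have xa := adj a h.ac h.ad hxa
      have xb := adj b h.bc h.bd hxb
      have h' : Dia G a b c x := ⟨h.ne, h.nadj, h.ac, xa.symm, h.bc, xb.symm, hxc.symm⟩
      by_cases hza : z = a
      · subst hza
        exact h.ac
      by_cases za : G.Adj z a
      · exact h'.swap_centers.adj_of_tip_center hG za hzx hzc
      by_cases hya : y = a
      · subst hya
        exact absurd hzy za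
      by_cases ya : G.Adj y a
      · have h'' : Dia G a z x y :=
          ⟨Ne.symm hza, fun e' => za e'.symm, xa.symm, ya.symm, hzx, hzy, e⟩
        exact (h''.adj_of_centers hG hxc.symm hyc.symm h.ac.symm (Ne.symm hzc)).symm
      · have h'' : Dia G y a c x := ⟨hya, ya, hyc, e.symm, h.ac, xa.symm, hxc.symm⟩
        exact h''.swap_centers.adj_of_tip_center hG hzy hzx hzc
  · have h' : Dia G x y c d := ⟨hxy, e, hxc, hxd, hyc, hyd, h.cd⟩
    exact h'.adj_of_tips hG hzx hzy hzc

/-- The middle vertices are adjacent to every other point of the block, so neither `x` nor `y` is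
one of them. -/
theorem Dia.of_blk (h : Dia G a b c d) {x y : V} (hx : Blk G c d x) (hy : Blk G c d y)
    (hne : x ≠ y) (hn : ¬ G.Adj x y) : Dia G x y c d := by
  have hcd := h.cd
  have hdc := h.cd.symm
  have e : ∀ u v, Blk G c d u → Blk G c d v → u ≠ v → ¬ G.Adj u v → G.Adj u c ∧ G.Adj u d := by
    intro u v hu hv huv hn
    rcases hu with rfl | rfl | hu
    · rcases hv with rfl | rfl | hv
      · exact absurd rfl huv
      · exact absurd hcd hn
      · exact absurd hv.1.symm hn
    · rcases hv with rfl | rfl | hv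
      · exact absurd hdc hn
      · exact absurd rfl huv
      · exact absurd hv.2.symm hn
    · exact hu
  obtain ⟨xc, xd⟩ := e x y hx hy hne hn
  obtain ⟨yc, yd⟩ := e y x hy hx hne.symm fun h => hn h.symm
  exact ⟨hne, hn, xc, xd, yc, yd, hcd⟩

theorem Dia.blk_a (h : Dia G a b c d) : Blk G c d a := .inr (.inr ⟨h.ac, h.ad⟩)
theorem Dia.blk_b (h : Dia G a b c d) : Blk G c d b := .inr (.inr ⟨h.bc, h.bd⟩)
theorem Dia.blk_c (_ : Dia G a b c d) : Blk G c d c := .inl rfl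
theorem Dia.blk_d (_ : Dia G a b c d) : Blk G c d d := .inr (.inl rfl)

theorem Dia.blk_tips_of_blk_centers (h : Dia G a b c d) (h' : Dia G a' b' c' d')
    (hG : ObstructionFree G) (hc : Blk G c d c') (hd : Blk G c d d') :
    Blk G c d a' ∧ Blk G c d b' :=
  ⟨h.blk_of_two hG h'.cd.ne hc hd h'.ac h'.ad, h.blk_of_two hG h'.cd.ne hc hd h'.bc h'.bd⟩

/-- The second middle vertex `d'` sees both `a'` and `c'`, so it is drawn into the block, and then
so is every other vertex of the second diamond. -/
theorem Dia.blk_tips_of_blk_tip_center (h : Dia G a b c d) (h' : Dia G a' b' c' d')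
    (hG : ObstructionFree G) (ha : Blk G c d a') (hc : Blk G c d c') :
    Blk G c d a' ∧ Blk G c d b' :=
  h.blk_tips_of_blk_centers h' hG hc
    (h.blk_of_two hG h'.ac.ne ha hc h'.ad.symm h'.cd.symm)

/-- A diamond with a tip that is a middle vertex of another one, whose tips avoid its block. -/
theorem Dia.not_tip_center (hG : ObstructionFree G) {p : V} (h : Dia G a b p d)
    (h' : Dia G p b' c' d') : False := by
  have nb : ¬ Blk G p d b' := by
    rintro (e | rfl | e)
    · exact h'.ne e.symm
    · exact h'.nadj h.cd
    · exact h'.nadj e.1.symm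
  have nc : ¬ Blk G p d c' := fun e =>
    nb (h.blk_tips_of_blk_tip_center h' hG h.blk_c e).2
  have nd : ¬ Blk G p d d' := fun e =>
    nb (h.blk_tips_of_blk_tip_center h'.swap_centers hG h.blk_c e).2
  have ne : ∀ {u v}, ¬ Blk G p d u → Blk G p d v → v ≠ u := by
    rintro u v hu hv rfl
    exact hu hv
  -- The diamonds share only `p`, and there is no edge between their remaining vertices, so they
  -- form `S₁`: an edge from `x` to `c'` or `d'` would draw that vertex into the block of `p`, `d`,
  -- and an edge to `b'` would make `x` adjacent to both tips `p`, `b'` and hence to `c'`.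
  have key : ∀ x, Blk G p d x → G.Adj p x →
      (x ≠ b' ∧ x ≠ c' ∧ x ≠ d') ∧ ¬ G.Adj x b' ∧ ¬ G.Adj x c' ∧ ¬ G.Adj x d' := by
    intro x hx hpx
    have e1 : ¬ G.Adj x c' := fun e => nc (h.blk_of_two hG hpx.ne h.blk_c hx h'.ac.symm e.symm)
    refine ⟨⟨ne nb hx, ne nc hx, ne nd hx⟩, fun e => ?_, e1, fun e =>
      nd (h.blk_of_two hG hpx.ne h.blk_c hx h'.ad.symm e.symm)⟩
    exact e1 (h'.adj_of_tips hG hpx.symm e (ne nc hx))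
  obtain ⟨⟨a1, a2, a3⟩, a4, a5, a6⟩ := key a h.blk_a h.ac.symm
  obtain ⟨⟨b1, b2, b3⟩, b4, b5, b6⟩ := key b h.blk_b h.bc.symm
  obtain ⟨⟨d1, d2, d3⟩, d4, d5, d6⟩ := key d h.blk_d h.cd
  obtain ⟨h1, h2, h3, h4, h5, h6, h7⟩ := h
  obtain ⟨k1, k2, k3, k4, k5, k6, k7⟩ := h'
  refine hG.elim (ind := 4) (by simp) (by simp) (![p, c', d', d, a, b, b'] : Fin 7 → V) ?_
  intro (i : Fin 7) (j : Fin 7) hij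
  fin_cases i <;> fin_cases j <;> first
    | exact absurd hij (by decide)
    | exact ⟨fun _ => by first | assumption | (apply SimpleGraph.Adj.symm; assumption),
        fun h => absurd h (by decide)⟩
    | exact ⟨fun h => absurd h (by decide), fun _ =>
        ⟨by first | assumption | (apply Ne.symm; assumption),
          by first | assumption | (rw [G.adj_comm]; assumption)⟩⟩

/-- If the tips `a` of one diamond and `a'` of another are adjacent, no diamond with tip `a`
has `a'` in its block. -/
theorem Dia.not_blk_tip (hG : ObstructionFree G) (h : Dia G a b c d) (h' : Dia G a' b' c' d')
    (haa : G.Adj a a') : ¬ Blk G c d a' := by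
  rintro (rfl | rfl | ⟨e1, e2⟩)
  · exact Dia.not_tip_center hG h h'
  · exact Dia.not_tip_center hG h.swap_centers h'
  -- As a common neighbor of `c`, `d` and the tip `a`, the vertex `a'` is also adjacent to `b`. It
  -- is then a middle vertex of one diamond and a tip of another.
  · have e3 : G.Adj a' b := h.adj_of_centers hG e1 e2 haa.symm (by
      rintro rfl; exact h.nadj haa)
    exact Dia.not_tip_center hG (p := a') (d := c) ⟨h.ne, h.nadj, haa, h.ac, e3.symm, h.bc, e1⟩ h'

/-- Otherwise `a`, `b'` would be tips of a diamond with middle vertices `c`, `d`. This diamond and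
the second one share only `b'`, and `aa'` is the only edge between their other vertices, which is
`S₂`. -/
theorem Dia.not_blk_tip_other (hG : ObstructionFree G) (h : Dia G a b c d)
    (h' : Dia G a' b' c' d') (haa : G.Adj a a') : ¬ Blk G c d b' := by
  intro hb
  have na := Dia.not_blk_tip hG h h' haa
  have na' := Dia.not_blk_tip hG h' h haa.symm
  have a_uniq : ∀ x, Blk G c' d' x → x ≠ a' → ¬ G.Adj a x := fun x hx hne e =>
    na' (h'.blk_of_two hG hne.symm h'.blk_a hx haa e)
  have a'_uniq : ∀ x, Blk G c d x → x ≠ a → ¬ G.Adj a' x := fun x hx hne e =>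
    na (h.blk_of_two hG hne.symm h.blk_a hx haa.symm e)
  have hab' : a ≠ b' := by rintro rfl; exact h'.nadj haa.symm
  have k : Dia G a b' c d := h.of_blk h.blk_a hb hab' (a_uniq _ h'.blk_b h'.ne.symm)
  have nc : ¬ Blk G c d c' := fun e =>
    na (h.blk_tips_of_blk_tip_center h'.swap_tips hG hb e).2
  have nd : ¬ Blk G c d d' := fun e =>
    na (h.blk_tips_of_blk_tip_center h'.swap_tips.swap_centers hG hb e).2
  have ne : ∀ {u v}, ¬ Blk G c d u → Blk G c d v → v ≠ u := by
    rintro u v hu hv rfl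
    exact hu hv
  have key : ∀ x, Blk G c d x → x ≠ b' →
      (x ≠ a' ∧ x ≠ c' ∧ x ≠ d') ∧ ¬ G.Adj x c' ∧ ¬ G.Adj x d' := fun x hx hxb =>
    ⟨⟨ne na hx, ne nc hx, ne nd hx⟩,
      fun e => nc (h.blk_of_two hG hxb hx hb e.symm h'.bc.symm),
      fun e => nd (h.blk_of_two hG hxb hx hb e.symm h'.bd.symm)⟩
  obtain ⟨⟨a1, a2, a3⟩, a5, a6⟩ := key a h.blk_a hab'
  obtain ⟨⟨c1, c2, c3⟩, c5, c6⟩ := key c h.blk_c k.bc.ne.symm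
  obtain ⟨⟨d1, d2, d3⟩, d5, d6⟩ := key d h.blk_d k.bd.ne.symm
  have c4 := a'_uniq c h.blk_c h.ac.ne.symm
  have d4 := a'_uniq d h.blk_d h.ad.ne.symm
  clear h a_uniq a'_uniq
  obtain ⟨h1, h2, h3, h4, h5, h6, h7⟩ := k
  obtain ⟨k1, k2, k3, k4, k5, k6, k7⟩ := h'
  refine hG.elim (ind := 6) (by simp) (by simp) (![b', c, d, c', d', a, a'] : Fin 7 → V) ?_
  intro (i : Fin 7) (j : Fin 7) hij
  fin_cases i <;> fin_cases j <;> first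
    | exact absurd hij (by decide)
    | exact ⟨fun _ => by first | assumption | (apply SimpleGraph.Adj.symm; assumption),
        fun h => absurd h (by decide)⟩
    | exact ⟨fun h => absurd h (by decide), fun _ =>
        ⟨by first | assumption | (apply Ne.symm; assumption),
          by first | assumption | (rw [G.adj_comm]; assumption)⟩⟩

end

/-! ### Two disjoint diamonds joined by a matching -/

/-- All matchings between two diamonds `0 1 | 2 3` and `4 5 | 6 7` that contain the edge `0 4`: the
partners of `1`, `2`, `3` (less `4`, and `0` for no partner), the number of the obstruction and its
vertices in their order. -/
def matchingTable : List (List ℕ × ℕ × List ℕ) :=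
  [([0, 0, 0], 7, [2, 3, 0, 4, 6, 7, 1, 5]), ([0, 0, 1], 10, [3, 2, 0, 5, 4, 6, 7, 1]),
   ([0, 0, 2], 8, [3, 6, 2, 0, 4, 7, 1, 5]), ([0, 0, 3], 8, [3, 7, 2, 0, 4, 6, 1, 5]),
   ([0, 1, 0], 10, [2, 3, 0, 5, 4, 6, 7, 1]), ([0, 1, 2], 12, [3, 2, 6, 0, 5, 4, 7, 1]),
   ([0, 1, 3], 12, [3, 2, 7, 0, 5, 4, 6, 1]), ([0, 2, 0], 8, [2, 6, 3, 0, 4, 7, 1, 5]),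
   ([0, 2, 1], 12, [2, 3, 6, 0, 5, 4, 7, 1]), ([0, 2, 3], 11, [2, 3, 6, 7, 0, 4, 1, 5]),
   ([0, 3, 0], 8, [2, 7, 3, 0, 4, 6, 1, 5]), ([0, 3, 1], 12, [2, 3, 7, 0, 5, 4, 6, 1]),
   ([0, 3, 2], 11, [2, 3, 7, 6, 0, 4, 1, 5]), ([1, 0, 0], 9, [2, 3, 0, 1, 4, 5, 6, 7]),
   ([1, 0, 2], 13, [3, 6, 2, 0, 1, 4, 5, 7]), ([1, 0, 3], 13, [3, 7, 2, 0, 1, 4, 5, 6]),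
   ([1, 2, 0], 13, [2, 6, 3, 0, 1, 4, 5, 7]), ([1, 2, 3], 15, [2, 3, 6, 7, 0, 1, 4, 5]),
   ([1, 3, 0], 13, [2, 7, 3, 0, 1, 4, 5, 6]), ([1, 3, 2], 15, [2, 3, 7, 6, 0, 1, 4, 5]),
   ([2, 0, 0], 10, [6, 7, 4, 1, 0, 2, 3, 5]), ([2, 0, 1], 14, [3, 6, 1, 5, 2, 0, 7, 4]),
   ([2, 0, 3], 12, [7, 6, 3, 4, 1, 0, 2, 5]), ([2, 1, 0], 14, [2, 6, 1, 5, 3, 0, 7, 4]),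
   ([2, 1, 3], 16, [3, 2, 7, 6, 1, 0, 5, 4]), ([2, 3, 0], 12, [7, 6, 2, 4, 1, 0, 3, 5]),
   ([2, 3, 1], 16, [2, 3, 7, 6, 1, 0, 5, 4]), ([3, 0, 0], 10, [7, 6, 4, 1, 0, 2, 3, 5]),
   ([3, 0, 1], 14, [3, 7, 1, 5, 2, 0, 6, 4]), ([3, 0, 2], 12, [6, 7, 3, 4, 1, 0, 2, 5]),
   ([3, 1, 0], 14, [2, 7, 1, 5, 3, 0, 6, 4]), ([3, 1, 2], 16, [3, 2, 6, 7, 1, 0, 5, 4]),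
   ([3, 2, 0], 12, [6, 7, 2, 4, 1, 0, 3, 5]), ([3, 2, 1], 16, [2, 3, 6, 7, 1, 0, 5, 4])]

/-- The cross edges of a matching with the partners `f`. -/
def matchingCross (f : List ℕ) (i j : ℕ) : Bool :=
  if i = 0 then j == 0 else f.getD (i - 1) 0 == j && j != 0

def diamondAdj (i j : ℕ) : Bool := i != j && (decide (2 ≤ i) || decide (2 ≤ j))

/-- Two diamonds joined by a matching. -/
def matchingAdj (f : List ℕ) (x y : ℕ) : Bool :=
  if x < 4 then if y < 4 then diamondAdj x y else matchingCross f x (y - 4)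
  else if y < 4 then matchingCross f y (x - 4) else diamondAdj (x - 4) (y - 4)

def matchingEntryCheck (t : List ℕ × ℕ × List ℕ) : Bool :=
  decide (7 ≤ t.2.1) && decide (t.2.1 ≤ 16) && (obsOrder t.2.1 == 8) &&
    (List.range 8).all fun j => decide (t.2.2.getD j 0 < 8) && (List.range j).all fun i =>
      t.2.2.getD i 0 != t.2.2.getD j 0 &&
        obsAdj t.2.1 i j == matchingAdj t.1 (t.2.2.getD i 0) (t.2.2.getD j 0)

set_option maxRecDepth 100000 in
theorem matchingTable_check : matchingTable.all matchingEntryCheck = true := by decide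

-- The edge between the vertices `0` and `4` is fixed, so the rest of a matching is a partial
-- injection of `{1, 2, 3}` into itself. There are 34 of them, one for each entry of the table.
set_option maxRecDepth 100000 in
theorem matchingTable_complete :
    ((List.range 4).all fun x => (List.range 4).all fun y => (List.range 4).all fun z =>
      (x == y && x != 0) || (x == z && x != 0) || (y == z && y != 0) ||
        matchingTable.any fun t => t.1 == [x, y, z]) = true := by decide

section
variable {V : Type*} {G : SimpleGraph V} {a b c d a' b' c' d' : V}

theorem Dia.injective (h : Dia G a b c d) : Function.Injective ![a, b, c, d] := by
  have := h.ne; have := h.ac.ne; have := h.ad.ne; have := h.bc.ne; have := h.bd.ne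
  have := h.cd.ne
  intro i j hij
  fin_cases i <;> fin_cases j <;> simp_all

theorem Dia.adj_iff (h : Dia G a b c d) (i j : Fin 4) :
    G.Adj (![a, b, c, d] i) (![a, b, c, d] j) ↔ diamondAdj i j = true := by
  obtain ⟨h1, h2, h3, h4, h5, h6, h7⟩ := h
  have h2' : ¬ G.Adj b a := fun e => h2 e.symm
  fin_cases i <;> fin_cases j <;>
    simp [diamondAdj, h2, h2', h3, h4, h5, h6, h7, h3.symm, h4.symm, h5.symm, h6.symm, h7.symm]

/-- By `row` and `col` the edges between the two diamonds form a matching. The table names an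
obstruction among `T₁, …, T₁₀` and a placement for each matching that contains the edge between the
tips numbered `0`. -/
theorem ObstructionFree.no_matching (hG : ObstructionFree G) {p q : Fin 4 → V}
    (hp : Function.Injective p) (hq : Function.Injective q) (hpq : ∀ i j, p i ≠ q j)
    (dp : ∀ i j : Fin 4, G.Adj (p i) (p j) ↔ diamondAdj i j = true)
    (dq : ∀ i j : Fin 4, G.Adj (q i) (q j) ↔ diamondAdj i j = true)
    (h0 : G.Adj (p 0) (q 0)) (row : ∀ i j k, G.Adj (p i) (q j) → G.Adj (p i) (q k) → j = k)
    (col : ∀ i j k, G.Adj (p i) (q k) → G.Adj (p j) (q k) → i = j) : False := by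
  -- The value `0` can encode a missing partner, because `q 0` is already matched with `p 0`.
  have hf : ∀ i : Fin 4, i ≠ 0 → ∃ m < 4, ∀ j : Fin 4,
      G.Adj (p i) (q j) ↔ (m == j.val && j.val != 0) = true := by
    intro i hi
    by_cases e : ∃ j, G.Adj (p i) (q j)
    · obtain ⟨j, hj⟩ := e
      refine ⟨j, j.2, fun k => ?_⟩
      simp only [Bool.and_eq_true, beq_iff_eq, bne_iff_ne, Fin.val_inj]
      constructor
      · intro hk
        refine ⟨row i j k hj hk, fun h => hi (col i 0 k hk ?_)⟩
        have : k = 0 := Fin.ext h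
        rwa [this]
      · rintro ⟨rfl, -⟩
        exact hj
    · refine ⟨0, by simp, fun k => ?_⟩
      have : ¬ G.Adj (p i) (q k) := fun h => e ⟨k, h⟩
      simp only [this, false_iff, Bool.and_eq_true, beq_iff_eq, bne_iff_ne, not_and, not_not]
      exact fun h => h.symm
  obtain ⟨x, hx, fx⟩ := hf 1 (by simp)
  obtain ⟨y, hy, fy⟩ := hf 2 (by simp)
  obtain ⟨z, hz, fz⟩ := hf 3 (by simp)
  have ne : ∀ (u : ℕ) (i j : Fin 4), i ≠ j → u < 4 →
      (∀ k : Fin 4, G.Adj (p i) (q k) ↔ (u == k.val && k.val != 0) = true) →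
      (∀ k : Fin 4, G.Adj (p j) (q k) ↔ (u == k.val && k.val != 0) = true) → u = 0 := by
    intro u i j hij hu h1 h2
    by_contra h
    exact hij (col i j ⟨u, hu⟩ ((h1 _).2 (by simp [h])) ((h2 _).2 (by simp [h])))
  have hc := matchingTable_complete
  simp only [List.all_eq_true, List.mem_range] at hc
  have hc := hc x hx y hy z hz
  simp only [Bool.or_eq_true, Bool.and_eq_true, beq_iff_eq, bne_iff_ne, List.any_eq_true] at hc
  rcases hc with ((⟨rfl, h⟩ | ⟨rfl, h⟩) | ⟨rfl, h⟩) | ⟨⟨f, ind, σ⟩, ht, hfe⟩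
  · exact h (ne _ _ _ (by decide) hx fx fy)
  · exact h (ne _ _ _ (by decide) hx fx fz)
  · exact h (ne _ _ _ (by decide) hy fy fz)
  simp only at hfe
  subst hfe
  have hcheck := List.all_eq_true.1 matchingTable_check _ ht
  simp only [matchingEntryCheck, Bool.and_eq_true, decide_eq_true_eq, beq_iff_eq,
    List.all_eq_true, List.mem_range, bne_iff_ne] at hcheck
  obtain ⟨⟨⟨l7, l16⟩, ho⟩, hσ⟩ := hcheck
  have cross : ∀ i j : Fin 4, G.Adj (p i) (q j) ↔ matchingCross [x, y, z] i j = true := by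
    intro i j
    fin_cases i
    · change G.Adj (p 0) (q j) ↔ (j.val == 0) = true
      simp only [beq_iff_eq]
      constructor
      · intro h
        simp [row 0 j 0 h h0]
      · intro h
        have : j = 0 := Fin.ext h
        rwa [this]
    · exact fx j
    · exact fy j
    · exact fz j
  have adj : ∀ u w : Fin (4 + 4), G.Adj (Fin.append p q u) (Fin.append p q w) ↔
      matchingAdj [x, y, z] u w = true := by
    intro u w
    refine Fin.addCases (fun i => ?_) (fun i => ?_) u <;>
      refine Fin.addCases (fun j => ?_) (fun j => ?_) w <;>
      simp only [Fin.append_left, Fin.append_right, matchingAdj, Fin.val_castAdd, Fin.val_natAdd,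
        Fin.is_lt, if_true, Nat.add_sub_cancel_left, not_lt_of_ge (Nat.le_add_right 4 _), if_false]
    · exact dp i j
    · exact cross i j
    · rw [G.adj_comm]
      exact cross j i
    · exact dq i j
  have inj : Function.Injective (Fin.append p q) :=
    Fin.append_injective_iff.2 ⟨hp, hq, hpq⟩
  have lt : ∀ i : Fin (obsOrder ind), σ.getD i 0 < 4 + 4 := fun i => (hσ i (ho ▸ i.2)).1
  refine hG.elim (ind := ind) (by omega) (by omega)
    (fun i => Fin.append p q ⟨σ.getD i 0, lt i⟩) fun i j hij => ?_
  obtain ⟨hne, heq⟩ := (hσ j (ho ▸ j.2)).2 i hij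
  rw [heq]
  refine ⟨fun h => (adj _ _).2 h, fun h => ⟨fun e => hne ?_, fun e => ?_⟩⟩
  · simpa using inj e
  · have := (adj _ _).1 e
    exact Bool.false_ne_true (h.symm.trans this)

/-- The tips of the diamonds form an independent set. -/
theorem Dia.not_adj_tips (hG : ObstructionFree G) (h : Dia G a b c d) (h' : Dia G a' b' c' d') :
    ¬ G.Adj a a' := by
  intro haa
  -- Neither diamond has a vertex in the block of the other. A vertex outside a block has at most
  -- one neighbor in it, so the diamonds are disjoint and the edges between them form a matching.
  have out : ∀ {a b c d a' b' c' d' : V}, Dia G a b c d → Dia G a' b' c' d' → G.Adj a a' →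
      (∀ i, Blk G c d (![a, b, c, d] i)) ∧ ∀ j, ¬ Blk G c d (![a', b', c', d'] j) := by
    intro a b c d a' b' c' d' h h' haa
    have n1 := Dia.not_blk_tip hG h h' haa
    have n1' := Dia.not_blk_tip hG h' h haa.symm
    have n3 : ¬ Blk G c d c' := fun e => n1 (h.blk_of_two hG
      (by rintro rfl; exact n1' h'.blk_c) h.blk_a e haa.symm h'.ac)
    have n4 : ¬ Blk G c d d' := fun e => n1 (h.blk_of_two hG
      (by rintro rfl; exact n1' h'.blk_d) h.blk_a e haa.symm h'.ad)
    refine ⟨fun i => ?_, fun j => ?_⟩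
    · fin_cases i
      · exact h.blk_a
      · exact h.blk_b
      · exact h.blk_c
      · exact h.blk_d
    · fin_cases j
      · exact n1
      · exact Dia.not_blk_tip_other hG h h' haa
      · exact n3
      · exact n4
  obtain ⟨hp, hq⟩ := out h h' haa
  obtain ⟨hp', hq'⟩ := out h' h haa.symm
  refine hG.no_matching h.injective h'.injective (fun i j e => hq j (e ▸ hp i)) h.adj_iff
    h'.adj_iff haa (fun i j k e1 e2 => ?_) (fun i j k e1 e2 => ?_)
  · by_contra hne
    exact hq' i (h'.blk_of_two hG (h'.injective.ne hne) (hp' j) (hp' k) e1 e2)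
  · by_contra hne
    exact hq k (h.blk_of_two hG (h.injective.ne hne) (hp i) (hp j) e1.symm e2.symm)

/-- Three pairwise tip pairs lie in a common block. -/
theorem Dia.blk_of_three (hG : ObstructionFree G) {x y z c d c' d' c'' d'' : V}
    (h : Dia G x y c d) (h' : Dia G y z c' d') (h'' : Dia G z x c'' d'') : Blk G c d z := by
  by_contra hz
  have sep : ∀ {x y z c d c' d' : V}, Dia G x y c d → Dia G y z c' d' → ¬ Blk G c d z →
      ¬ Blk G c d c' ∧ ¬ Blk G c d d' ∧ ¬ Blk G c' d' x := by
    intro x y z c d c' d' h h' hz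
    have n1 : ¬ Blk G c d c' := fun e =>
      hz (h.blk_tips_of_blk_tip_center h' hG h.blk_b e).2
    refine ⟨n1, fun e =>
      hz (h.blk_tips_of_blk_tip_center h'.swap_centers hG h.blk_b e).2, fun e => ?_⟩
    have k := h'.of_blk h'.blk_a e h.ne.symm fun e => h.nadj e.symm
    exact n1 (h.blk_of_two hG h.ne h.blk_a h.blk_b k.bc.symm k.ac.symm)
  obtain ⟨c1, c2, hx⟩ := sep h h' hz
  obtain ⟨c3, c4, hy⟩ := sep h' h'' hx
  obtain ⟨c5, c6, -⟩ := sep h'' h hy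
  have ne : ∀ {c d u v}, ¬ Blk G c d u → Blk G c d v → v ≠ u := by
    rintro c d u v hu hv rfl
    exact hu hv
  -- If `z` is outside the first block, the three diamonds meet only in `x`, `y`, `z`, and any
  -- further edge between two of them would draw a middle vertex into a foreign block. What remains
  -- is `S₃`.
  have key : ∀ {x y z c d c' d' : V}, Dia G x y c d → Dia G y z c' d' → ¬ Blk G c d z →
      ¬ Blk G c d c' → ¬ Blk G c d d' →
      (∀ u, Blk G c d u → u ≠ y → u ≠ c' ∧ u ≠ d' ∧ ¬ G.Adj u c' ∧ ¬ G.Adj u d') := by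
    intro x y z c d c' d' h h' hz n1 n2 u hu huy
    exact ⟨ne n1 hu, ne n2 hu, fun e => n1 (h.blk_of_two hG huy hu h.blk_b e.symm h'.ac.symm),
      fun e => n2 (h.blk_of_two hG huy hu h.blk_b e.symm h'.ad.symm)⟩
  have k1 := key h h' hz c1 c2
  have k2 := key h' h'' hx c3 c4
  have k3 := key h'' h hy c5 c6
  obtain ⟨p1, p2, p3, p4⟩ := k1 x h.blk_a h.ne
  obtain ⟨p5, p6, p7, p8⟩ := k1 c h.blk_c h.bc.ne.symm
  obtain ⟨p9, p10, p11, p12⟩ := k1 d h.blk_d h.bd.ne.symm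
  obtain ⟨q1, q2, q3, q4⟩ := k2 y h'.blk_a h'.ne
  obtain ⟨q5, q6, q7, q8⟩ := k2 c' h'.blk_c h'.bc.ne.symm
  obtain ⟨q9, q10, q11, q12⟩ := k2 d' h'.blk_d h'.bd.ne.symm
  obtain ⟨r1, r2, r3, r4⟩ := k3 z h''.blk_a h''.ne
  obtain ⟨r5, r6, r7, r8⟩ := k3 c'' h''.blk_c h''.bc.ne.symm
  obtain ⟨r9, r10, r11, r12⟩ := k3 d'' h''.blk_d h''.bd.ne.symm
  clear k1 k2 k3 key sep
  obtain ⟨a1, a2, a3, a4, a5, a6, a7⟩ := h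
  obtain ⟨b1, b2, b3, b4, b5, b6, b7⟩ := h'
  obtain ⟨e1, e2, e3, e4, e5, e6, e7⟩ := h''
  refine hG.elim (ind := 17) (by simp) (by simp) (![x, y, z, c, d, c'', d'', c', d'] : Fin 9 → V) ?_
  intro (i : Fin 9) (j : Fin 9) hij
  fin_cases i <;> fin_cases j <;> first
    | exact absurd hij (by decide)
    | exact ⟨fun _ => by first | assumption | (apply SimpleGraph.Adj.symm; assumption),
        fun h => absurd h (by decide)⟩
    | exact ⟨fun h => absurd h (by decide), fun _ =>
        ⟨by first | assumption | (apply Ne.symm; assumption),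
          by first | assumption | (rw [G.adj_comm]; assumption)⟩⟩

/-- Being the tips of a diamond. -/
def IsTips (G : SimpleGraph V) (u v : V) : Prop := ∃ c d, Dia G u v c d

/-- The completion adds the pairs of tips of diamonds and takes all tips as nonprobes. The
four-point condition holds because each configuration with a new pair is confined to a single block.
-/
theorem ObstructionFree.isProbeDiamondFree (hG : ObstructionFree G) : IsProbeDiamondFree G := by
  have symm : ∀ {u v}, IsTips G u v → IsTips G v u := fun ⟨c, d, h⟩ => ⟨c, d, h.swap_tips⟩
  have indep : ∀ {u v u' v'}, IsTips G u v → IsTips G u' v' → ¬ G.Adj u u' :=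
    fun ⟨_, _, h⟩ ⟨_, _, h'⟩ => Dia.not_adj_tips hG h h'
  have blk : ∀ {a b c d u v}, Dia G a b c d → Blk G c d u → Blk G c d v → u ≠ v →
      G.Adj u v ∨ IsTips G u v := by
    intro a b c d u v h hu hv huv
    by_cases e : G.Adj u v
    · exact .inl e
    · exact .inr ⟨c, d, h.of_blk hu hv huv e⟩
  -- a vertex joined to both tips of a diamond is in its block
  have third : ∀ {r s c d p}, Dia G r s c d → (G.Adj p r ∨ IsTips G p r) →
      (G.Adj p s ∨ IsTips G p s) → Blk G c d p := by
    rintro r s c d p h (h1 | h1) (h2 | h2)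
    · exact h.blk_of_two hG h.ne h.blk_a h.blk_b h1 h2
    · exact absurd h1 (indep h2 ⟨c, d, h⟩)
    · exact absurd h2 (indep h1 ⟨c, d, h.swap_tips⟩)
    · obtain ⟨_, _, k1⟩ := h1
      obtain ⟨_, _, k2⟩ := h2
      exact h.blk_of_three hG k2.swap_tips k1
  refine isProbeDiamondFree_iff.2 ⟨{u | ∃ v, IsTips G u v},
    SimpleGraph.mk (fun u v => G.Adj u v ∨ IsTips G u v) ⟨fun u v h => h.imp (·.symm) symm⟩
      ⟨fun u h => h.elim (fun h => h.ne rfl) fun ⟨_, _, h⟩ => h.ne rfl⟩, ?_, ?_, ?_, ?_⟩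
  · rintro u u' ⟨v, h⟩ ⟨v', h'⟩
    exact indep h h'
  · exact fun u v h => .inl h
  · have main : ∀ p q r s, p ≠ q → (G.Adj p r ∨ IsTips G p r) → (G.Adj p s ∨ IsTips G p s) →
        (G.Adj q r ∨ IsTips G q r) → (G.Adj q s ∨ IsTips G q s) → G.Adj r s → IsTips G p r →
        G.Adj p q ∨ IsTips G p q := by
      rintro p q r s hpq - ps qr qs rs ⟨c, d, pr⟩
      have hs := third pr (ps.imp (·.symm) symm) (.inl rs.symm)
      by_cases hq : Blk G c d q
      · exact blk pr pr.blk_a hq hpq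
      rcases qr with qr | ⟨c', d', qr⟩
      · rcases qs with qs | qs
        · exact absurd (pr.blk_of_two hG rs.ne pr.blk_b hs qr qs) hq
        · exact absurd qr (indep qs ⟨c, d, pr.swap_tips⟩)
      · have hs' := third qr (qs.imp (·.symm) symm) (.inl rs.symm)
        -- The block of `q`, `r` contains `s`, so its middle vertex `c'` is `s` or is adjacent to
        -- both `r` and `s`. In each case it is in the block of `p`, `r`, and then it brings `q`
        -- along.
        have hc : Blk G c d c' := by
          rcases hs' with rfl | rfl | ⟨e, -⟩
          · exact hs
          · exact pr.blk_of_two hG rs.ne pr.blk_b hs qr.bc.symm qr.cd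
          · exact pr.blk_of_two hG rs.ne pr.blk_b hs qr.bc.symm e.symm
        exact absurd (pr.blk_tips_of_blk_tip_center qr.swap_tips hG pr.blk_b hc).2 hq
    intro p q r s hpq pr ps qr qs rs
    change G.Adj p r ∨ IsTips G p r at pr
    change G.Adj p s ∨ IsTips G p s at ps
    change G.Adj q r ∨ IsTips G q r at qr
    change G.Adj q s ∨ IsTips G q s at qs
    change G.Adj r s ∨ IsTips G r s at rs
    change G.Adj p q ∨ IsTips G p q
    rcases rs with rs | ⟨c, d, rs⟩
    · by_cases h1 : IsTips G p r
      · exact main p q r s hpq pr ps qr qs rs h1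
      by_cases h2 : IsTips G p s
      · exact main p q s r hpq ps pr qs qr rs.symm h2
      by_cases h3 : IsTips G q r
      · exact (main q p r s hpq.symm qr qs pr ps rs h3).imp (·.symm) symm
      by_cases h4 : IsTips G q s
      · exact (main q p s r hpq.symm qs qr ps pr rs.symm h4).imp (·.symm) symm
      -- All five pairs are edges of `G`, so `p` and `q`, if nonadjacent, are the tips of a diamond
      -- with middle vertices `r`, `s`.
      by_contra hn
      rw [not_or] at hn
      exact hn.2 ⟨r, s, hpq, hn.1, pr.resolve_right h1, ps.resolve_right h2,
        qr.resolve_right h3, qs.resolve_right h4, rs⟩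
    · exact blk rs (third rs pr ps) (third rs qr qs) hpq
  · rintro u v (h | h) hn
    · exact absurd h hn
    · exact ⟨⟨v, h⟩, ⟨u, symm h⟩⟩

theorem exists_obstruction (h : ¬ IsProbeDiamondFree G) :
    ∃ ind, 1 ≤ ind ∧ ind ≤ 17 ∧ ∃ Q, InducesOrdered G (obstruction ind) Q := by
  by_contra hn
  exact h (ObstructionFree.isProbeDiamondFree fun ind h1 h2 Q hQ => hn ⟨ind, h1, h2, Q, hQ⟩)

end

/-! ### Reasoning about programs of the word RAM -/

namespace Ram

section
variable {W : ℕ} {s t u : State} {Q Q' : State → ℕ → Prop}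

@[simp] theorem State.reg_setReg (s : State) (x v y : ℕ) :
    (s.setReg x v).reg y = if y = x then v else s.reg y := by
  simp [State.setReg, Function.update_apply]

@[simp] theorem State.arr_setReg (s : State) (x v : ℕ) : (s.setReg x v).arr = s.arr := rfl

@[simp] theorem State.reg_setArr (s : State) (a i v : ℕ) : (s.setArr a i v).reg = s.reg := rfl

@[simp] theorem State.arr_setArr (s : State) (a i v b j : ℕ) :
    (s.setArr a i v).arr b j = if b = a ∧ j = i then v else s.arr b j := by
  by_cases h : b = a
  · subst h
    simp [State.setArr, Function.update_apply]
  · simp [State.setArr, h]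

/-- The program has a run from `s` whose final memory and number of steps satisfy `Q`. -/
def Wp (W : ℕ) (c : Prog) (s : State) (Q : State → ℕ → Prop) : Prop :=
  ∃ t k, Run W c s t k ∧ Q t k

theorem Wp.mono {c : Prog} (h : Wp W c s Q) (hQ : ∀ t k, Q t k → Q' t k) : Wp W c s Q' := by
  obtain ⟨t, k, h1, h2⟩ := h
  exact ⟨t, k, h1, hQ t k h2⟩

/-- The rules for loop-free programs are equivalences, so that rewriting executes such code
symbolically together with its step count. -/
theorem wp_skip : Wp W .skip s Q ↔ Q s 1 :=
  ⟨by rintro ⟨t, k, ⟨⟩, h⟩; exact h, fun h => ⟨_, _, .skip s, h⟩⟩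

theorem wp_const {x k : ℕ} : Wp W (.const x k) s Q ↔ k < W ∧ Q (s.setReg x k) 1 :=
  ⟨by rintro ⟨t, k, ⟨⟩, h⟩; exact ⟨‹_›, h⟩, fun h => ⟨_, _, .const s x k h.1, h.2⟩⟩

theorem wp_move {x y : ℕ} : Wp W (.move x y) s Q ↔ Q (s.setReg x (s.reg y)) 1 :=
  ⟨by rintro ⟨t, k, ⟨⟩, h⟩; exact h, fun h => ⟨_, _, .move s x y, h⟩⟩

theorem wp_add {x y z : ℕ} : Wp W (.add x y z) s Q ↔
    s.reg y + s.reg z < W ∧ Q (s.setReg x (s.reg y + s.reg z)) 1 :=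
  ⟨by rintro ⟨t, k, ⟨⟩, h⟩; exact ⟨‹_›, h⟩, fun h => ⟨_, _, .add s x y z h.1, h.2⟩⟩

theorem wp_sub {x y z : ℕ} : Wp W (.sub x y z) s Q ↔ Q (s.setReg x (s.reg y - s.reg z)) 1 :=
  ⟨by rintro ⟨t, k, ⟨⟩, h⟩; exact h, fun h => ⟨_, _, .sub s x y z, h⟩⟩

theorem wp_load {x a y : ℕ} : Wp W (.load x a y) s Q ↔ Q (s.setReg x (s.arr a (s.reg y))) 1 :=
  ⟨by rintro ⟨t, k, ⟨⟩, h⟩; exact h, fun h => ⟨_, _, .load s x a y, h⟩⟩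

theorem wp_store {a y x : ℕ} :
    Wp W (.store a y x) s Q ↔ Q (s.setArr a (s.reg y) (s.reg x)) 1 :=
  ⟨by rintro ⟨t, k, ⟨⟩, h⟩; exact h, fun h => ⟨_, _, .store s a y x, h⟩⟩

theorem wp_seq {c d : Prog} :
    Wp W (.seq c d) s Q ↔ Wp W c s fun t k => Wp W d t fun u l => Q u (k + l) := by
  constructor
  · rintro ⟨t, k, h, hQ⟩
    cases h with
    | seq h1 h2 => exact ⟨_, _, h1, _, _, h2, hQ⟩
  · rintro ⟨t, k, h1, u, l, h2, hQ⟩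
    exact ⟨u, _, .seq h1 h2, hQ⟩

theorem wp_cond {b : Test} {c d : Prog} :
    Wp W (.cond b c d) s Q ↔ (b.holds s → Wp W c s fun t k => Q t (k + 1)) ∧
      (¬ b.holds s → Wp W d s fun t k => Q t (k + 1)) := by
  constructor
  · rintro ⟨t, k, h, hQ⟩
    cases h with
    | cond_true hb h => exact ⟨fun _ => ⟨_, _, h, hQ⟩, fun hn => absurd hb hn⟩
    | cond_false hb h => exact ⟨fun hn => absurd hn hb, fun _ => ⟨_, _, h, hQ⟩⟩
  · rintro ⟨h1, h2⟩
    by_cases hb : b.holds s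
    · obtain ⟨t, k, h, hQ⟩ := h1 hb
      exact ⟨t, _, .cond_true hb h, hQ⟩
    · obtain ⟨t, k, h, hQ⟩ := h2 hb
      exact ⟨t, _, .cond_false hb h, hQ⟩

/-- The registers that a program writes. -/
def Prog.regs : Prog → List ℕ
  | .skip => []
  | .const x _ => [x]
  | .move x _ => [x]
  | .add x _ _ => [x]
  | .sub x _ _ => [x]
  | .load x _ _ => [x]
  | .store _ _ _ => []
  | .seq c d => c.regs ++ d.regs
  | .cond _ c d => c.regs ++ d.regs
  | .loop _ c => c.regs

/-- The arrays that a program writes. -/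
def Prog.arrs : Prog → List ℕ
  | .store a _ _ => [a]
  | .seq c d => c.arrs ++ d.arrs
  | .cond _ c d => c.arrs ++ d.arrs
  | .loop _ c => c.arrs
  | _ => []

/-- The memories `s` and `t` agree outside of the registers `R` and the arrays `A`. -/
def Agree (R A : List ℕ) (s t : State) : Prop :=
  (∀ x, x ∉ R → t.reg x = s.reg x) ∧ ∀ a, a ∉ A → t.arr a = s.arr a

theorem Agree.refl (R A : List ℕ) (s : State) : Agree R A s s := ⟨fun _ _ => rfl, fun _ _ => rfl⟩

theorem Agree.trans {R A : List ℕ} (h : Agree R A s t) (h' : Agree R A t u) : Agree R A s u :=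
  ⟨fun x hx => (h'.1 x hx).trans (h.1 x hx), fun a ha => (h'.2 a ha).trans (h.2 a ha)⟩

theorem Agree.mono {R A R' A' : List ℕ} (h : Agree R A s t) (hR : R ⊆ R') (hA : A ⊆ A') :
    Agree R' A' s t :=
  ⟨fun x hx => h.1 x fun h => hx (hR h), fun a ha => h.2 a fun h => ha (hA h)⟩

theorem Run.agree {c : Prog} {k : ℕ} (h : Run W c s t k) : Agree c.regs c.arrs s t := by
  induction h with
  | skip s => exact .refl _ _ _
  | const s x k _ => exact ⟨fun y hy => by simp_all [Prog.regs], fun _ _ => rfl⟩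
  | move s x y => exact ⟨fun y hy => by simp_all [Prog.regs], fun _ _ => rfl⟩
  | add s x y z _ => exact ⟨fun y hy => by simp_all [Prog.regs], fun _ _ => rfl⟩
  | sub s x y z => exact ⟨fun y hy => by simp_all [Prog.regs], fun _ _ => rfl⟩
  | load s x a y => exact ⟨fun y hy => by simp_all [Prog.regs], fun _ _ => rfl⟩
  | store s a y x =>
    refine ⟨fun _ _ => rfl, fun b hb => ?_⟩
    have : b ≠ a := by simpa [Prog.arrs] using hb
    simp [State.setArr, this]
  | seq _ _ ih1 ih2 =>
    exact (ih1.mono (List.subset_append_left _ _) (List.subset_append_left _ _)).trans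
      (ih2.mono (List.subset_append_right _ _) (List.subset_append_right _ _))
  | cond_true _ _ ih =>
    exact ih.mono (List.subset_append_left _ _) (List.subset_append_left _ _)
  | cond_false _ _ ih =>
    exact ih.mono (List.subset_append_right _ _) (List.subset_append_right _ _)
  | loop_done _ => exact .refl _ _ _
  | loop_step _ _ _ ih1 ih2 => exact ih1.trans ih2

/-- A program changes only what it writes. -/
theorem Wp.frame {c : Prog} (h : Wp W c s Q)
    (hQ : ∀ t k, Q t k → Agree c.regs c.arrs s t → Q' t k) : Wp W c s Q' := by
  obtain ⟨t, k, h1, h2⟩ := h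
  exact ⟨t, k, h1, hQ t k h2 h1.agree⟩

/-- `for i < b do body`, where register `o` contains `1`. -/
def Prog.for (i b o : ℕ) (body : Prog) : Prog :=
  .seq (.const i 0) (.loop (.lt i b) (.seq body (.add i i o)))

/-- The invariant carries the number of steps taken so far: one for the initialization, two more per
round for the increment and the test, and one for the final test. Agreement with the initial memory
is supplied as well, so invariants need not mention what the body never writes. -/
theorem wp_for {i b o : ℕ} {body : Prog} (n : ℕ) (Inv : ℕ → State → ℕ → Prop) (hW : n < W)
    (hb : s.reg b = n) (ho : s.reg o = 1)
    (hfr : i ∉ body.regs ∧ b ∉ i :: body.regs ∧ o ∉ i :: body.regs)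
    (h0 : Inv 0 (s.setReg i 0) 1)
    (hs : ∀ j < n, ∀ t k, Inv j t k → t.reg i = j → Agree (i :: body.regs) body.arrs s t →
      Wp W body t fun u l => Inv (j + 1) (u.setReg i (j + 1)) (k + l + 2))
    (hQ : ∀ t k, Inv n t k → t.reg i = n → Agree (i :: body.regs) body.arrs s t → Q t (k + 1)) :
    Wp W (.for i b o body) s Q := by
  obtain ⟨hfi, hfb, hfo⟩ := hfr
  rw [Prog.for, wp_seq, wp_const]
  refine ⟨by omega, ?_⟩
  have main : ∀ d j t k, j + d = n → Inv j t k → t.reg i = j →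
      Agree (i :: body.regs) body.arrs s t →
      Wp W (.loop (.lt i b) (.seq body (.add i i o))) t fun u l => Q u (k + l) := by
    intro d
    induction d with
    | zero =>
      intro j t k hj hI hi ha
      have e : t.reg b = n := (ha.1 b hfb).trans hb
      refine ⟨t, 1, .loop_done ?_, ?_⟩
      · simp only [Test.holds]
        omega
      · obtain rfl : j = n := hj
        exact hQ t k hI hi ha
    | succ d ih =>
      intro j t k hj hI hi ha
      have e : t.reg b = n := (ha.1 b hfb).trans hb
      obtain ⟨u, l, hr, hu⟩ := hs j (by omega) t k hI hi ha
      have ha' := hr.agree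
      have ui : u.reg i = j := (ha'.1 i hfi).trans hi
      have uo : u.reg o = 1 := by
        rw [ha'.1 o fun h => hfo (List.mem_cons_of_mem _ h), ha.1 o hfo, ho]
      have ha2 : Agree (i :: body.regs) body.arrs s (u.setReg i (j + 1)) := by
        refine ha.trans ((ha'.mono (List.subset_cons_self _ _) (List.Subset.refl _)).trans ?_)
        refine ⟨fun x hx => ?_, fun _ _ => rfl⟩
        have : x ≠ i := fun h => hx (h ▸ List.mem_cons_self)
        simp [this]
      obtain ⟨v, l', hr', hv⟩ := ih (j + 1) (u.setReg i (j + 1)) (k + l + 2) (by omega) hu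
        (by simp) ha2
      refine ⟨v, (l + 1) + l' + 1, .loop_step ?_ (.seq hr ?_) hr', ?_⟩
      · simp only [Test.holds]
        omega
      · have := Run.add (W := W) u i i o (by omega)
        rwa [ui, uo] at this
      · change Q v (k + (l + 1 + l' + 1))
        rw [show k + (l + 1 + l' + 1) = k + l + 2 + l' by omega]
        exact hv
  refine main n 0 _ 1 (by omega) h0 (by simp) ⟨fun x hx => ?_, fun _ _ => rfl⟩
  have : x ≠ i := fun h => hx (h ▸ List.mem_cons_self)
  simp [this]

end

end Ram

/-! ### The program

Registers: `0` is `n`, `2` is `1`, `8` is `2`, `5` is `0`, `3` is the number of darts, `4` is the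
failure flag, `6` is the name of the last line, `7` is the length of the completion set, `20` to
`26` describe a failure. Arrays: `0`, `1` are the adjacency lists, `6` contains the sources of the
darts, `7` the multiples of `n`, `5` the adjacency matrix, `8` the matrix of lines, `9` is
auxiliary, `11`, `12`, `13` contain the triangles of the lines, `14` the joined points of the lines, `2` the
nonprobes, `10` their partners, `3`, `4` the completion set. -/

namespace Ram

local infixr:40 " ;; " => Prog.seq

/-- `x := a[u, v]` for a matrix `a`. -/
def mget (x a u v : ℕ) : Prog := .load x 7 u ;; .add x x v ;; .load x a x

/-- `a[u, v] := x` for a matrix `a`, with the auxiliary register `r`. -/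
def mset (r a u v x : ℕ) : Prog := .load r 7 u ;; .add r r v ;; .store a r x

def initProg : Prog := .const 2 1 ;; .const 8 2 ;; .load 3 0 0

/-- The machine has no multiplication; register `11` runs through the multiples of `n`, which array
`7` keeps as row offsets. The diagonal of the adjacency matrix is set to `2`. -/
def rowsProg : Prog :=
  .for 10 0 2 (.store 7 10 11 ;; .add 12 11 10 ;; .store 5 12 8 ;; .add 11 11 0)

def sourceRow : Prog := .for 13 12 2 (.add 14 11 13 ;; .store 6 14 10)

def sourcesProg : Prog :=
  .for 10 0 2 (.load 11 0 10 ;; .add 12 10 2 ;; .load 12 0 12 ;; .sub 12 12 11 ;; sourceRow)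

def matrixProg : Prog :=
  .for 10 3 2 (.load 11 6 10 ;; .load 12 1 10 ;; mset 17 5 11 12 2)

/-- Find a common neighbor of the vertices in registers `11` and `12`. -/
def findCommon : Prog :=
  .for 15 0 2 (mget 17 5 11 15 ;; mget 18 5 12 15 ;;
    .cond (.eq 17 2) (.cond (.eq 18 2) (.move 13 15 ;; .const 14 1) .skip) .skip)

/-- Compute the points of the line of the triangle in registers `11`, `12`, `13`. -/
def scanLine : Prog :=
  .for 15 0 2 (mget 17 5 11 15 ;; mget 18 5 12 15 ;; .add 17 17 18 ;; mget 18 5 13 15 ;;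
    .add 17 17 18 ;; .store 9 15 17)

/-- Every failure is recorded as four vertices in the registers `20` to `23` and three names of
lines in `24` to `26`; unneeded places are filled by repetition. -/
def recordConflict : Prog :=
  .const 4 1 ;; .move 20 15 ;; .move 21 16 ;; .move 22 15 ;; .move 23 15 ;; .move 24 6 ;;
    .move 25 18 ;; .move 26 6

def pairRow : Prog :=
  .for 16 0 2 (.load 17 9 16 ;; .cond (.lt 17 8) .skip (.cond (.eq 15 16) .skip
    (mget 18 8 15 16 ;; .cond (.eq 18 5) (mset 17 8 15 16 6) recordConflict)))

def markPairs : Prog := .for 15 0 2 (.load 17 9 15 ;; .cond (.lt 17 8) .skip pairRow)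

/-- Names of lines are positive multiples of `n`. So `0` is free to mean that there is no line, and
the cells at name plus vertex are distinct for different lines. -/
def newLine : Prog :=
  .add 6 6 0 ;; .store 11 6 11 ;; .store 12 6 12 ;; .store 13 6 13 ;; scanLine ;; markPairs

def lineStep : Prog :=
  .load 11 6 10 ;; .load 12 1 10 ;; mget 17 8 11 12 ;;
    .cond (.eq 17 5) (.const 14 0 ;; findCommon ;; .cond (.eq 14 2) newLine .skip) .skip

/-- Compute the lines. -/
def linesProg : Prog := .for 10 3 2 (.cond (.eq 4 5) lineStep .skip)

def recordTwo : Prog :=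
  .const 4 1 ;; .move 20 15 ;; .move 21 11 ;; .move 22 18 ;; .move 23 15 ;; .move 24 13 ;;
    mget 25 8 11 15 ;; mget 26 8 18 15

/-- The cell of array `14` for a line and a vertex off it contains `0` or one more than the first
point of the line found to be joined to the vertex. A different second point is a failure. -/
def twoCell : Prog :=
  mget 17 5 11 15 ;; .cond (.eq 17 8) .skip
    (mget 18 8 11 15 ;; .cond (.eq 18 13) .skip
      (.add 17 17 18 ;; .cond (.eq 17 5) .skip
        (.add 17 13 15 ;; .load 18 14 17 ;; .cond (.eq 18 5) (.add 18 11 2 ;; .store 14 17 18)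
          (.sub 18 18 2 ;; .cond (.eq 18 11) .skip recordTwo))))

/-- Look for a vertex off a line that is joined to two points of the line. -/
def twoProg : Prog :=
  .for 10 3 2 (.load 11 6 10 ;; .load 12 1 10 ;; mget 13 8 11 12 ;;
    .cond (.eq 13 5) .skip (.for 15 0 2 twoCell))

/-- A pair is listed once for every dart at its first vertex; the repetitions are harmless, since
the list only represents a set. -/
def fillCell : Prog :=
  mget 17 5 11 15 ;; .cond (.eq 17 5) (mget 18 8 11 15 ;; .cond (.eq 18 5) .skip
    (.store 3 7 11 ;; .store 4 7 15 ;; .add 7 7 2 ;; .store 2 11 2 ;; .store 10 11 15)) .skip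

/-- List the completion set and mark the nonprobes. -/
def fillProg : Prog := .for 10 3 2 (.load 11 6 10 ;; .for 15 0 2 fillCell)

def recordAdjacent : Prog :=
  .const 4 1 ;; .move 20 11 ;; .move 21 12 ;; .load 22 10 11 ;; .load 23 10 12 ;;
    mget 24 8 11 22 ;; mget 25 8 12 23 ;; .move 26 24

/-- Look for adjacent nonprobes. -/
def indepProg : Prog :=
  .for 10 3 2 (.load 11 6 10 ;; .load 12 1 10 ;; .load 17 2 11 ;; .load 18 2 12 ;;
    .cond (.eq 17 2) (.cond (.eq 18 2) recordAdjacent .skip) .skip)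

/-- Collect the vertices of a failure in the registers `30` to `42`. -/
def gatherProg : Prog :=
  .move 30 20 ;; .move 31 21 ;; .move 32 22 ;; .move 33 23 ;;
  .load 34 11 24 ;; .load 35 12 24 ;; .load 36 13 24 ;;
  .load 37 11 25 ;; .load 38 12 25 ;; .load 39 13 25 ;;
  .load 40 11 26 ;; .load 41 12 26 ;; .load 42 13 26

/-- Run `c` if the adjacencies of the vertices in the registers from `30` on are as listed. -/
def ifMatches : List (ℕ × ℕ × Bool) → Prog → Prog
  | [], c => c
  | (i, j, b) :: l, c =>
    mget 17 5 (30 + i) (30 + j) ;; .cond (.eq 17 (if b then 2 else 5)) (ifMatches l c) .skip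

/-- Write the registers `30 + i` for the listed `i` to array `2`, from cell `k` on. -/
def writeVertices : ℕ → List ℕ → Prog
  | _, [] => .skip
  | k, i :: l => .const 17 k ;; .store 2 17 (30 + i) ;; writeVertices (k + 1) l

/-- All pairs of positions of an obstruction placed at the registers `30 + q i`. -/
def matchList (ind : ℕ) (q : List ℕ) : List (ℕ × ℕ × Bool) :=
  (List.range q.length).flatMap fun j => (List.range j).map fun i =>
    (q.getD i 0, q.getD j 0, obsAdj ind i j)

def tryPlacement (p : ℕ × List ℕ) : Prog :=
  ifMatches (matchList p.1 p.2) (.const 1 p.1 ;; writeVertices 0 p.2)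

/-- All lists of length `k` of numbers less than `m`. -/
def tuples (m : ℕ) : ℕ → List (List ℕ)
  | 0 => [[]]
  | k + 1 => (tuples m k).flatMap fun l => (List.range m).map fun i => i :: l

/-- A placement puts each position of an obstruction on one of thirteen registers. Their number does
not depend on the input, so testing all of them takes constant time. -/
def placements : List (ℕ × List ℕ) :=
  (List.range' 1 17).flatMap fun ind => (tuples 13 (obsOrder ind)).map fun q => (ind, q)

/-- The tests continue after a success; a later success overwrites register `1` and the relevant
cells of array `2`. -/
def tryAll : List (ℕ × List ℕ) → Prog
  | [] => .skip
  | p :: l => tryPlacement p ;; tryAll l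

def setupProg : Prog := initProg ;; rowsProg ;; sourcesProg ;; matrixProg

def answerProg : Prog :=
  .cond (.eq 4 5) (.const 0 1 ;; .move 1 7) (gatherProg ;; tryAll placements ;; .const 0 0)

/-- The recognition algorithm. -/
def mainProg : Prog :=
  setupProg ;; linesProg ;; .cond (.eq 4 5) (twoProg ;; fillProg ;; indepProg) .skip ;; answerProg

section
variable {W : ℕ} {s t : State} {Q : State → ℕ → Prop}

theorem wp_mget {x a u v : ℕ} (hxv : v ≠ x) :
    Wp W (mget x a u v) s Q ↔ s.arr 7 (s.reg u) + s.reg v < W ∧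
      Q (s.setReg x (s.arr a (s.arr 7 (s.reg u) + s.reg v))) 3 := by
  have e : ∀ p q : ℕ, (s.setReg x p).setReg x q = s.setReg x q := by
    intro p q
    simp [State.setReg]
  simp [mget, wp_seq, wp_load, wp_add, hxv, e]

theorem wp_mset {r a u v x : ℕ} (hv : v ≠ r) (hx : x ≠ r) :
    Wp W (mset r a u v x) s Q ↔ s.arr 7 (s.reg u) + s.reg v < W ∧
      Q ((s.setReg r (s.arr 7 (s.reg u) + s.reg v)).setArr a (s.arr 7 (s.reg u) + s.reg v)
        (s.reg x)) 3 := by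
  have e : ∀ p q : ℕ, (s.setReg r p).setReg r q = s.setReg r q := by
    intro p q
    simp [State.setReg]
  simp [mset, wp_seq, wp_load, wp_add, wp_store, hv, hx, e]

end

/-! ### The input -/

open Classical in
/-- The entries of the adjacency matrix. -/
noncomputable def adjCode (H : SimpleGraph ℕ) (u v : ℕ) : ℕ :=
  if u = v then 2 else if H.Adj u v then 1 else 0

/-- The memory after the setup, for a graph on the vertices `0, …, n - 1`. -/
structure Base (H : SimpleGraph ℕ) (n E : ℕ) (s : State) : Prop where
  reg0 : s.reg 0 = n
  reg2 : s.reg 2 = 1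
  reg3 : s.reg 3 = E
  reg5 : s.reg 5 = 0
  reg8 : s.reg 8 = 2
  bound : ∀ u v, H.Adj u v → u < n ∧ v < n
  dart : ∀ e < E, H.Adj (s.arr 6 e) (s.arr 1 e)
  surj : ∀ u v, H.Adj u v → ∃ e < E, s.arr 6 e = u ∧ s.arr 1 e = v
  row : ∀ v < n, s.arr 7 v = v * n
  mat : ∀ u < n, ∀ v < n, s.arr 5 (u * n + v) = adjCode H u v

theorem Base.of_agree {H : SimpleGraph ℕ} {n E : ℕ} {s t : State} {R A : List ℕ}
    (h : Base H n E s) (ha : Agree R A s t) (hR : ∀ x ∈ [0, 2, 3, 5, 8], x ∉ R)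
    (hA : ∀ a ∈ [1, 5, 6, 7], a ∉ A) : Base H n E t := by
  obtain ⟨h1, h2, h3, h4, h5, h6, h7, h8, h9, h10⟩ := h
  constructor
  · rwa [ha.1 0 (hR 0 (by simp))]
  · rwa [ha.1 2 (hR 2 (by simp))]
  · rwa [ha.1 3 (hR 3 (by simp))]
  · rwa [ha.1 5 (hR 5 (by simp))]
  · rwa [ha.1 8 (hR 8 (by simp))]
  · exact h6
  · rwa [ha.2 6 (hA 6 (by simp)), ha.2 1 (hA 1 (by simp))]
  · rwa [ha.2 6 (hA 6 (by simp)), ha.2 1 (hA 1 (by simp))]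
  · rwa [ha.2 7 (hA 7 (by simp))]
  · rwa [ha.2 5 (hA 5 (by simp))]

theorem cell_lt {n u v : ℕ} (hu : u < n) (hv : v < n) : u * n + v < n * n := by
  nlinarith

theorem cell_inj {n u v u' v' : ℕ} (hv : v < n) (hv' : v' < n) :
    u * n + v = u' * n + v' ↔ u = u' ∧ v = v' := by
  constructor
  · intro h
    have h1 : u = u' := by
      have e1 : (u * n + v) / n = u := by
        rw [Nat.add_comm, Nat.add_mul_div_right _ _ (by omega), Nat.div_eq_of_lt hv, zero_add]
      have e2 : (u' * n + v') / n = u' := by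
        rw [Nat.add_comm, Nat.add_mul_div_right _ _ (by omega), Nat.div_eq_of_lt hv', zero_add]
      rw [← e1, ← e2, h]
    subst h1
    exact ⟨rfl, by omega⟩
  · rintro ⟨rfl, rfl⟩
    rfl

section
variable {n : ℕ} (L : Fin n → List (Fin n))

/-- The darts of the first `j` vertices. -/
def dartList (j : ℕ) : List (Fin n × Fin n) :=
  ((List.finRange n).take j).flatMap fun v => (L v).map fun w => (v, w)

theorem dartList_length (j : ℕ) :
    (dartList L j).length = (((List.finRange n).take j).map fun v => (L v).length).sum := by
  simp [dartList, List.length_flatMap]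

theorem dartList_succ {j : ℕ} (hj : j < n) :
    dartList L (j + 1) = dartList L j ++ (L ⟨j, hj⟩).map fun w => (⟨j, hj⟩, w) := by
  have : (List.finRange n).take (j + 1) = (List.finRange n).take j ++ [⟨j, hj⟩] := by
    rw [List.take_add_one]
    simp [hj]
  rw [dartList, this, List.flatMap_append]
  simp [dartList]

theorem dartList_length_mono {i j : ℕ} (h : i ≤ j) :
    (dartList L i).length ≤ (dartList L j).length := by
  rw [dartList_length, dartList_length]
  exact ((List.take_sublist_take_left h).map _).sum_le_sum (by simp)

theorem inputState_offset {j : ℕ} (hj : j ≤ n) :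
    (inputState L).arr 0 j = (dartList L j).length := by
  simp [inputState, hj, dartList_length]

theorem inputState_target {e : ℕ} {p : Fin n × Fin n} (h : (dartList L n)[e]? = some p) :
    (inputState L).arr 1 e = p.2 := by
  have e1 : (List.finRange n).flatMap L = (dartList L n).map Prod.snd := by
    rw [dartList, List.take_of_length_le (by simp), List.map_flatMap]
    simp [Function.comp_def]
  simp only [inputState, one_ne_zero, if_false, if_true]
  rw [e1, List.getD_eq_getElem?_getD, List.getElem?_map, List.getElem?_map, h]
  rfl

end

end Ram

/-! ### Correctness and cost of the setup. -/

namespace Ram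

section
variable {W n E : ℕ} {s t : State}

theorem wp_init (hW : 2 < W) :
    Wp W initProg s fun t k => k ≤ 3 ∧ t.reg 2 = 1 ∧ t.reg 8 = 2 ∧ t.reg 3 = s.arr 0 (s.reg 0) := by
  simp [initProg, wp_seq, wp_const, wp_load]
  omega

theorem wp_rows (hW : n * n + n < W) (h0 : s.reg 0 = n) (h2 : s.reg 2 = 1) (h8 : s.reg 8 = 2)
    (h11 : s.reg 11 = 0) (h5 : ∀ i, s.arr 5 i = 0) :
    Wp W rowsProg s fun t k => k ≤ 6 * n + 2 ∧ (∀ v < n, t.arr 7 v = v * n) ∧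
      (∀ v < n, t.arr 5 (v * n + v) = 2) ∧
      ∀ i, (¬ ∃ v < n, i = v * n + v) → t.arr 5 i = 0 := by
  refine wp_for n (fun j t k => k ≤ 6 * j + 1 ∧ t.reg 11 = j * n ∧ (∀ v < j, t.arr 7 v = v * n) ∧
      (∀ v < j, t.arr 5 (v * n + v) = 2) ∧
      ∀ i, (¬ ∃ v < j, i = v * n + v) → t.arr 5 i = 0) (by nlinarith) h0 h2 (by decide) ?_ ?_ ?_
  · refine ⟨le_rfl, by simp [h11], by simp, by simp, fun i _ => h5 i⟩
  · rintro j hj t k ⟨hk, ht, h1, h3, h4⟩ hi ha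
    have e8 : t.reg 8 = 2 := (ha.1 8 (by decide)).trans h8
    have e0 : t.reg 0 = n := (ha.1 0 (by decide)).trans h0
    have b1 : j * n + j < W := (cell_lt hj hj).trans (by omega)
    have b2 : j * n + n < W := by nlinarith
    simp [wp_seq, wp_store, wp_add, ht, hi, e8, e0]
    refine ⟨b1, b2, by omega, by ring, ?_, ?_, ?_⟩
    · intro v hv
      split_ifs with h
      · rw [h]
      · exact h1 v (by omega)
    · intro v hv hne
      refine h3 v ?_
      by_contra h
      obtain rfl : v = j := by omega
      exact hne rfl
    · intro i hne
      have : i ≠ j * n + j := fun e => hne j (by omega) e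
      rw [if_neg this]
      exact h4 i fun ⟨v, hv, e⟩ => hne v (by omega) e
  · rintro t k ⟨hk, ht, h1, h3, h4⟩ hi ha
    exact ⟨by omega, h1, h3, h4⟩

theorem wp_sourceRow {d : ℕ} (hE : s.reg 11 + d < W) (h12 : s.reg 12 = d) (h2 : s.reg 2 = 1) :
    Wp W sourceRow s fun t k => k ≤ 4 * d + 2 ∧
      ∀ i, t.arr 6 i = if s.reg 11 ≤ i ∧ i < s.reg 11 + d then s.reg 10 else s.arr 6 i := by
  refine wp_for d (fun j t k => k ≤ 4 * j + 1 ∧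
      ∀ i, t.arr 6 i = if s.reg 11 ≤ i ∧ i < s.reg 11 + j then s.reg 10 else s.arr 6 i)
      (by omega) h12 h2 (by decide) ?_ ?_ ?_
  · refine ⟨by omega, fun i => ?_⟩
    rw [if_neg (by omega)]
    rfl
  · rintro j hj t k ⟨hk, h6⟩ hi ha
    have e11 : t.reg 11 = s.reg 11 := ha.1 11 (by decide)
    have e10 : t.reg 10 = s.reg 10 := ha.1 10 (by decide)
    simp [wp_seq, wp_store, wp_add, hi, e11, e10]
    refine ⟨by omega, by omega, fun i => ?_⟩
    rw [h6 i]
    split_ifs <;> first | rfl | omega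
  · rintro t k ⟨hk, h6⟩ hi ha
    exact ⟨by omega, h6⟩

theorem wp_sources (L : Fin n → List (Fin n)) (hW : n + (dartList L n).length + 1 < W)
    (ha0 : s.arr 0 = (inputState L).arr 0) (h0 : s.reg 0 = n) (h2 : s.reg 2 = 1) :
    Wp W sourcesProg s fun t k => k ≤ 8 * n + 4 * (dartList L n).length + 2 ∧
      ∀ i p, (dartList L n)[i]? = some p → t.arr 6 i = p.1 := by
  refine wp_for n (fun j t k => k ≤ 8 * j + 4 * (dartList L j).length + 1 ∧
      ∀ i p, (dartList L j)[i]? = some p → t.arr 6 i = p.1)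
      (by omega) h0 h2 (by decide) ?_ ?_ ?_
  · exact ⟨by omega, by simp [dartList]⟩
  · rintro j hj t k ⟨hk, h6⟩ hi ha
    have e2 : t.reg 2 = 1 := (ha.1 2 (by decide)).trans h2
    have e0 : t.arr 0 = (inputState L).arr 0 := (ha.2 0 (by decide)).trans ha0
    have o1 := inputState_offset L (j := j) (by omega)
    have o2 := inputState_offset L (j := j + 1) (by omega)
    have hs := dartList_succ L hj
    have hl : (dartList L (j + 1)).length = (dartList L j).length + (L ⟨j, hj⟩).length := by
      rw [hs, List.length_append, List.length_map]
    have hm := dartList_length_mono L (i := j + 1) (j := n) (by omega)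
    simp only [wp_seq, wp_load, wp_add, wp_sub, State.reg_setReg, State.arr_setReg, hi, e2, e0, o1]
    simp [o2]
    refine ⟨by omega, ?_⟩
    refine (wp_sourceRow (d := (L ⟨j, hj⟩).length) ?_ ?_ ?_).mono ?_
    · simp
      omega
    · simp
      omega
    · simpa using e2
    · rintro u l ⟨hl', hu⟩
      simp at hu
      refine ⟨by omega, ?_⟩
      suffices h : ∀ i p, (dartList L (j + 1))[i]? = some p → u.arr 6 i = p.1.val by
        simpa using h
      intro i p hp
      rw [hs, List.getElem?_append] at hp
      have hu := hu i
      split_ifs at hp with h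
      · rw [if_neg (by omega)] at hu
        rw [hu]
        exact h6 i p hp
      · rw [List.getElem?_map, Option.map_eq_some_iff] at hp
        obtain ⟨w, hw, rfl⟩ := hp
        have := (List.getElem?_eq_some_iff.1 hw).1
        rw [if_pos (by omega)] at hu
        rw [hu]
        simpa using hi
  · rintro t k ⟨hk, h6⟩ hi ha
    exact ⟨by omega, h6⟩

theorem wp_matrix (hW : n * n + n + E < W) (h2 : s.reg 2 = 1) (h3 : s.reg 3 = E)
    (lt : ∀ e < E, s.arr 6 e < n ∧ s.arr 1 e < n) (row : ∀ v < n, s.arr 7 v = v * n) :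
    Wp W matrixProg s fun t k => k ≤ 7 * E + 2 ∧
      ∀ i, ((∃ e < E, i = s.arr 6 e * n + s.arr 1 e) → t.arr 5 i = 1) ∧
        ((¬ ∃ e < E, i = s.arr 6 e * n + s.arr 1 e) → t.arr 5 i = s.arr 5 i) := by
  refine wp_for E (fun j t k => k ≤ 7 * j + 1 ∧
      ∀ i, ((∃ e < j, i = s.arr 6 e * n + s.arr 1 e) → t.arr 5 i = 1) ∧
        ((¬ ∃ e < j, i = s.arr 6 e * n + s.arr 1 e) → t.arr 5 i = s.arr 5 i))
      (by omega) h3 h2 (by decide) ?_ ?_ ?_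
  · exact ⟨by omega, fun i => ⟨by rintro ⟨e, he, -⟩; omega, fun _ => rfl⟩⟩
  · rintro j hj t k ⟨hk, h5⟩ hi ha
    have e6 : t.arr 6 = s.arr 6 := ha.2 6 (by decide)
    have e1 : t.arr 1 = s.arr 1 := ha.2 1 (by decide)
    have e7 : t.arr 7 = s.arr 7 := ha.2 7 (by decide)
    have e2 : t.reg 2 = 1 := (ha.1 2 (by decide)).trans h2
    obtain ⟨l1, l2⟩ := lt j hj
    have b := cell_lt l1 l2
    simp [wp_seq, wp_load, wp_mset, hi, e6, e1, e7, e2, row _ l1]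
    refine ⟨by omega, by omega, fun i => ⟨?_, ?_⟩⟩
    · intro e he hie hne
      refine (h5 i).1 ⟨e, ?_, hie⟩
      by_contra h
      obtain rfl : e = j := by omega
      exact hne hie
    · intro hne
      rw [if_neg (hne j (by omega))]
      exact (h5 i).2 fun ⟨e, he, h⟩ => hne e (by omega) h
  · rintro t k ⟨hk, h5⟩ hi ha
    exact ⟨by omega, h5⟩

/-- The graph on the natural numbers with the edges of `G`. -/
def natGraph (G : SimpleGraph (Fin n)) : SimpleGraph ℕ := G.map Fin.valEmbedding

theorem natGraph_adj {G : SimpleGraph (Fin n)} {u v : ℕ} :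
    (natGraph G).Adj u v ↔ ∃ (hu : u < n) (hv : v < n), G.Adj ⟨u, hu⟩ ⟨v, hv⟩ := by
  rw [natGraph, SimpleGraph.map_adj]
  constructor
  · rintro ⟨a, b, h, rfl, rfl⟩
    exact ⟨a.2, b.2, h⟩
  · rintro ⟨hu, hv, h⟩
    exact ⟨_, _, h, rfl, rfl⟩

theorem mem_dartList {G : SimpleGraph (Fin n)} {L : Fin n → List (Fin n)}
    (hL : IsAdjacencyList G L) (p : Fin n × Fin n) : p ∈ dartList L n ↔ G.Adj p.1 p.2 := by
  rw [dartList, List.take_of_length_le (by simp)]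
  simp only [List.mem_flatMap, List.mem_finRange, true_and, List.mem_map]
  constructor
  · rintro ⟨v, w, hw, rfl⟩
    exact ((hL v).2 w).1 hw
  · intro h
    exact ⟨p.1, p.2, ((hL _).2 _).2 h, rfl⟩

/-- The handshake lemma: the length of the lists is the sum of the degrees. -/
theorem dartList_length_eq {G : SimpleGraph (Fin n)} {L : Fin n → List (Fin n)}
    (hL : IsAdjacencyList G L) : (dartList L n).length = 2 * G.edgeSet.ncard := by
  classical
  rw [dartList_length, List.take_of_length_le (by simp), ← List.ofFn_eq_map, List.sum_ofFn]
  rw [← SimpleGraph.coe_edgeFinset, Set.ncard_coe_finset, ← G.sum_degrees_eq_twice_card_edges]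
  refine Finset.sum_congr rfl fun v _ => ?_
  rw [← List.toFinset_card_of_nodup (hL v).1, ← SimpleGraph.card_neighborFinset_eq_degree]
  congr 1
  ext w
  simp [(hL v).2 w]

theorem dartList_length_le {G : SimpleGraph (Fin n)} {L : Fin n → List (Fin n)}
    (hL : IsAdjacencyList G L) : (dartList L n).length ≤ n * n := by
  classical
  rw [dartList_length, List.take_of_length_le (by simp), ← List.ofFn_eq_map, List.sum_ofFn]
  calc ∑ v, (L v).length ≤ ∑ _v : Fin n, n := Finset.sum_le_sum fun v _ => by
        simpa using (hL v).1.length_le_card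
    _ = n * n := by simp

theorem wp_setup {G : SimpleGraph (Fin n)} {L : Fin n → List (Fin n)} (hL : IsAdjacencyList G L)
    (hE : (dartList L n).length = E) (hW : n * n + n + E + 2 < W) :
    Wp W setupProg (inputState L) fun t k => k ≤ 14 * n + 11 * E + 9 ∧ Base (natGraph G) n E t := by
  have hd : ∀ e, (∃ p, (dartList L n)[e]? = some p ∧ (inputState L).arr 1 e = p.2) ∨ E ≤ e := by
    intro e
    by_cases he : e < (dartList L n).length
    · exact .inl ⟨_, List.getElem?_eq_getElem he, inputState_target L (List.getElem?_eq_getElem he)⟩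
    · exact .inr (by omega)
  rw [setupProg, wp_seq]
  refine (wp_init (by omega)).frame fun s1 k1 ⟨hk1, r2, r8, r3⟩ a1 => ?_
  have i0 : (inputState L).reg 0 = n := rfl
  rw [i0, inputState_offset L le_rfl, hE] at r3
  have r0 : s1.reg 0 = n := a1.1 0 (by decide)
  rw [wp_seq]
  refine (wp_rows (n := n) (by omega) r0 r2 r8 (a1.1 11 (by decide)) fun i => by
    rw [a1.2 5 (by decide)]; rfl).frame fun s2 k2 ⟨hk2, row, diag, off⟩ a2 => ?_
  have b0 : s2.reg 0 = n := (a2.1 0 (by decide)).trans r0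
  have b2 : s2.reg 2 = 1 := (a2.1 2 (by decide)).trans r2
  rw [wp_seq]
  refine (wp_sources L (by omega) ((a2.2 0 (by decide)).trans (a1.2 0 (by decide))) b0 b2).frame
    fun s3 k3 ⟨hk3, src⟩ a3 => ?_
  have c2 : s3.reg 2 = 1 := (a3.1 2 (by decide)).trans b2
  have c3 : s3.reg 3 = E := (a3.1 3 (by decide)).trans ((a2.1 3 (by decide)).trans r3)
  have row3 : ∀ v < n, s3.arr 7 v = v * n := by
    rw [a3.2 7 (by decide)]
    exact row
  have tgt : s3.arr 1 = (inputState L).arr 1 := (a3.2 1 (by decide)).trans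
    ((a2.2 1 (by decide)).trans (a1.2 1 (by decide)))
  have dart : ∀ e < E, (natGraph G).Adj (s3.arr 6 e) (s3.arr 1 e) := by
    intro e he
    rcases hd e with ⟨p, hp, hp'⟩ | h
    · rw [src e p hp, tgt, hp']
      exact natGraph_adj.2 ⟨p.1.2, p.2.2, (mem_dartList hL p).1 (List.mem_of_getElem? hp)⟩
    · omega
  have bound : ∀ u v, (natGraph G).Adj u v → u < n ∧ v < n := by
    intro u v h
    obtain ⟨hu, hv, -⟩ := natGraph_adj.1 h
    exact ⟨hu, hv⟩
  refine (wp_matrix (n := n) (E := E) (by omega) c2 c3 (fun e he => bound _ _ (dart e he))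
    row3).frame fun s4 k4 ⟨hk4, mat⟩ a4 => ?_
  have surj : ∀ u v, (natGraph G).Adj u v → ∃ e < E, s3.arr 6 e = u ∧ s3.arr 1 e = v := by
    intro u v h
    obtain ⟨hu, hv, h⟩ := natGraph_adj.1 h
    obtain ⟨e, he, hp⟩ := List.getElem_of_mem
      ((mem_dartList hL (⟨u, hu⟩, ⟨v, hv⟩)).2 h)
    have hp' : (dartList L n)[e]? = some (⟨u, hu⟩, ⟨v, hv⟩) := by
      rw [List.getElem?_eq_getElem he, hp]
    exact ⟨e, by omega, src e _ hp', by rw [tgt, inputState_target L hp']⟩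
  have e6 : s4.arr 6 = s3.arr 6 := a4.2 6 (by decide)
  have e1 : s4.arr 1 = s3.arr 1 := a4.2 1 (by decide)
  refine ⟨by subst hE; omega, ?_⟩
  constructor
  · exact (a4.1 0 (by decide)).trans ((a3.1 0 (by decide)).trans b0)
  · exact (a4.1 2 (by decide)).trans c2
  · exact (a4.1 3 (by decide)).trans c3
  · exact (a4.1 5 (by decide)).trans ((a3.1 5 (by decide)).trans
      ((a2.1 5 (by decide)).trans (a1.1 5 (by decide))))
  · exact (a4.1 8 (by decide)).trans ((a3.1 8 (by decide)).trans ((a2.1 8 (by decide)).trans r8))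
  · exact bound
  · rwa [e6, e1]
  · rwa [e6, e1]
  · rw [a4.2 7 (by decide)]
    exact row3
  · intro u hu v hv
    have e5 : s3.arr 5 = s2.arr 5 := a3.2 5 (by decide)
    by_cases h : (natGraph G).Adj u v
    · obtain ⟨e, he, hu', hv'⟩ := surj u v h
      rw [(mat _).1 ⟨e, he, by rw [hu', hv']⟩, adjCode, if_neg h.ne, if_pos h]
    · rw [(mat _).2 ?_, e5]
      · by_cases huv : u = v
        · subst huv
          rw [diag u hu, adjCode, if_pos rfl]
        · rw [off, adjCode, if_neg huv, if_neg h]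
          rintro ⟨w, hw, e⟩
          obtain ⟨rfl, rfl⟩ := (cell_inj hv hw).1 e
          exact huv rfl
      · rintro ⟨e, he, h'⟩
        have hb := bound _ _ (dart e he)
        obtain ⟨rfl, rfl⟩ := (cell_inj hv hb.2).1 h'
        exact h (dart e he)
end
end Ram

/-! ### A single line: its triangle, its points and the marking of its pairs. -/

namespace Ram

section
variable {H : SimpleGraph ℕ} {W n E : ℕ} {s t : State}

theorem adjCode_eq_one {u v : ℕ} : adjCode H u v = 1 ↔ H.Adj u v := by
  unfold adjCode
  split_ifs with h1 h2
  · subst h1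
    simp
  · simp [h2]
  · simp [h2]

theorem adjCode_ne_zero {u v : ℕ} : adjCode H u v ≠ 0 ↔ u = v ∨ H.Adj u v := by
  unfold adjCode
  split_ifs with h1 h2 <;> simp [*]

theorem adjCode_eq_two {u v : ℕ} : adjCode H u v = 2 ↔ u = v := by
  unfold adjCode
  split_ifs with h1 h2 <;> simp [*]

theorem adjCode_le {u v : ℕ} : adjCode H u v ≤ 2 := by
  unfold adjCode
  split_ifs <;> omega

/-- The diagonal value `2` makes the vertices of the triangle pass; for any other `z` the sum counts
its neighbors in the triangle. -/
theorem two_le_adjCode {v w a z : ℕ} (ht : IsTriangle H v w a) :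
    2 ≤ adjCode H v z + adjCode H w z + adjCode H a z ↔ OnLine H v w a z := by
  obtain ⟨h1, h2, h3⟩ := ht
  have e : ∀ u, (z = u ∨ H.Adj z u) ↔ adjCode H u z ≠ 0 := fun u => by
    rw [adjCode_ne_zero, H.adj_comm, eq_comm]
  unfold OnLine
  rw [e v, e w, e a]
  by_cases hv : z = v
  · subst hv
    have := (adjCode_eq_two (H := H)).2 (rfl : z = z)
    have := adjCode_eq_one.2 h1.symm
    omega
  by_cases hw : z = w
  · subst hw
    have := (adjCode_eq_two (H := H)).2 (rfl : z = z)
    have := adjCode_eq_one.2 h1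
    omega
  by_cases ha : z = a
  · subst ha
    have := (adjCode_eq_two (H := H)).2 (rfl : z = z)
    have := adjCode_eq_one.2 h2
    omega
  have k : ∀ u, z ≠ u → adjCode H u z ≤ 1 := fun u hu => by
    have h2 : adjCode H u z ≠ 2 := fun h => hu (adjCode_eq_two.1 h).symm
    have := adjCode_le (H := H) (u := u) (v := z)
    omega
  have := k v hv
  have := k w hw
  have := k a ha
  omega

/-- A suitable vertex of the triangle serves as `y`. Hence each point of a line is the source of a
dart inside the line, on which both the enumeration of points by darts and the cost analysis rest.
-/
theorem exists_adj_onLine {v w a z : ℕ} (ht : IsTriangle H v w a) (hz : OnLine H v w a z) :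
    ∃ y, OnLine H v w a y ∧ H.Adj z y := by
  obtain ⟨h1, h2, h3⟩ := ht
  have ov : OnLine H v w a v := .inl ⟨.inl rfl, .inr h1⟩
  have ow : OnLine H v w a w := .inl ⟨.inr h1.symm, .inl rfl⟩
  have oa : OnLine H v w a a := .inr (.inl ⟨.inr h2.symm, .inl rfl⟩)
  rcases hz with ⟨rfl | e, -⟩ | ⟨rfl | e, -⟩ | ⟨rfl | e, -⟩
  · exact ⟨w, ow, h1⟩
  · exact ⟨v, ov, e⟩
  · exact ⟨w, ow, h1⟩
  · exact ⟨v, ov, e⟩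
  · exact ⟨v, ov, h1.symm⟩
  · exact ⟨w, ow, e⟩

theorem OnLine.lt (hb : Base H n E s) {v w a z : ℕ} (ht : IsTriangle H v w a)
    (hz : OnLine H v w a z) : z < n := by
  obtain ⟨y, -, h⟩ := exists_adj_onLine ht hz
  exact (hb.bound _ _ h).1

theorem wp_findCommon (hb : Base H n E s) (hW : n * n + n + 2 < W) {v w : ℕ} (hv : v < n)
    (hw : w < n) (e11 : s.reg 11 = v) (e12 : s.reg 12 = w) (e14 : s.reg 14 = 0) :
    Wp W findCommon s fun t k => k ≤ 13 * n + 2 ∧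
      (t.reg 14 = 0 ∧ (∀ z, H.Adj v z → ¬ H.Adj w z) ∨
        t.reg 14 = 1 ∧ H.Adj v (t.reg 13) ∧ H.Adj w (t.reg 13)) := by
  refine wp_for n (fun j t k => k ≤ 13 * j + 1 ∧
      (t.reg 14 = 0 ∧ (∀ z < j, H.Adj v z → ¬ H.Adj w z) ∨
        t.reg 14 = 1 ∧ H.Adj v (t.reg 13) ∧ H.Adj w (t.reg 13)))
      (by omega) hb.reg0 hb.reg2 (by decide) ?_ ?_ ?_
  · exact ⟨le_rfl, .inl ⟨by simpa using e14, by simp⟩⟩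
  · rintro j hj t k ⟨hk, h⟩ hi ha
    have hb' := hb.of_agree ha (by decide) (by decide)
    have f11 : t.reg 11 = v := (ha.1 11 (by decide)).trans e11
    have f12 : t.reg 12 = w := (ha.1 12 (by decide)).trans e12
    have b1 := cell_lt hv hj
    have b2 := cell_lt hw hj
    simp [wp_seq, wp_mget, wp_cond, wp_move, wp_const, wp_skip, Test.holds, hi, f11, f12,
      hb'.row _ hv, hb'.row _ hw, hb'.mat _ hv _ hj, hb'.mat _ hw _ hj, hb'.reg2, adjCode_eq_one]
    refine ⟨by omega, by omega, ?_⟩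
    by_cases h1 : H.Adj v j <;> by_cases h2 : H.Adj w j
    · exact ⟨fun _ => ⟨fun _ => ⟨by omega, by omega, h1, h2⟩, fun hn => absurd h2 hn⟩,
        fun hn => absurd h1 hn⟩
    all_goals
      have h' : t.reg 14 = 0 ∧ (∀ z ≤ j, H.Adj v z → ¬ H.Adj w z) ∨
          t.reg 14 = 1 ∧ H.Adj v (t.reg 13) ∧ H.Adj w (t.reg 13) := by
        refine h.imp_left fun ⟨h3, h4⟩ => ⟨h3, fun z hz => ?_⟩
        rcases Nat.lt_or_eq_of_le hz with hz | rfl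
        · exact h4 z hz
        · tauto
    · exact ⟨fun _ => ⟨fun hn => absurd hn h2, fun _ => ⟨by omega, h'⟩⟩,
        fun hn => absurd h1 hn⟩
    · exact ⟨fun hn => absurd hn h1, fun _ => ⟨by omega, h'⟩⟩
    · exact ⟨fun hn => absurd hn h1, fun _ => ⟨by omega, h'⟩⟩
  · rintro t k ⟨hk, h⟩ hi ha
    exact ⟨by omega, h.imp_left fun ⟨h1, h2⟩ => ⟨h1, fun z hz => h2 z (hb.bound _ _ hz).2 hz⟩⟩

theorem wp_scanLine (hb : Base H n E s) (hW : n * n + n + 6 < W) {v w a : ℕ} (hv : v < n)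
    (hw : w < n) (ha : a < n) (e11 : s.reg 11 = v) (e12 : s.reg 12 = w) (e13 : s.reg 13 = a) :
    Wp W scanLine s fun t k => k ≤ 14 * n + 2 ∧
      ∀ z < n, t.arr 9 z = adjCode H v z + adjCode H w z + adjCode H a z := by
  refine wp_for n (fun j t k => k ≤ 14 * j + 1 ∧
      ∀ z < j, t.arr 9 z = adjCode H v z + adjCode H w z + adjCode H a z)
      (by omega) hb.reg0 hb.reg2 (by decide) ?_ ?_ ?_
  · exact ⟨le_rfl, by simp⟩
  · rintro j hj t k ⟨hk, h⟩ hi hag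
    have hb' := hb.of_agree hag (by decide) (by decide)
    have f11 : t.reg 11 = v := (hag.1 11 (by decide)).trans e11
    have f12 : t.reg 12 = w := (hag.1 12 (by decide)).trans e12
    have f13 : t.reg 13 = a := (hag.1 13 (by decide)).trans e13
    have b1 := cell_lt hv hj
    have b2 := cell_lt hw hj
    have b3 := cell_lt ha hj
    have c1 := adjCode_le (H := H) (u := v) (v := j)
    have c2 := adjCode_le (H := H) (u := w) (v := j)
    have c3 := adjCode_le (H := H) (u := a) (v := j)
    simp [wp_seq, wp_mget, wp_add, wp_store, hi, f11, f12, f13,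
      hb'.row _ hv, hb'.row _ hw, hb'.row _ ha, hb'.mat _ hv _ hj, hb'.mat _ hw _ hj,
      hb'.mat _ ha _ hj]
    refine ⟨by omega, by omega, by omega, by omega, by omega, by omega, fun z hz => ?_⟩
    split_ifs with hzj
    · rw [hzj]
    · exact h z (by omega)
  · rintro t k ⟨hk, h⟩ hi hag
    exact ⟨by omega, h⟩

/-- A recorded pair of points of the line `id` that is on another line by the matrix `L`. -/
def Conflict (on : ℕ → Prop) (n id : ℕ) (L : ℕ → ℕ) (t : State) : Prop :=
  ∃ x y, x < n ∧ y < n ∧ x ≠ y ∧ on x ∧ on y ∧ L (x * n + y) ≠ 0 ∧ t.reg 20 = x ∧ t.reg 21 = y ∧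
    t.reg 22 = x ∧ t.reg 23 = x ∧ t.reg 24 = id ∧ t.reg 25 = L (x * n + y) ∧ t.reg 26 = id

theorem Conflict.congr {on : ℕ → Prop} {id : ℕ} {L : ℕ → ℕ} (h : Conflict on n id L s)
    (hr : ∀ x, 20 ≤ x → x ≤ 26 → t.reg x = s.reg x) : Conflict on n id L t := by
  obtain ⟨x, y, h⟩ := h
  refine ⟨x, y, ?_⟩
  simp (discharger := omega) only [hr]
  exact h

-- Here `L` is the matrix before the new line is marked. Only zero cells are overwritten and each
-- cell is visited once, so testing the current matrix amounts to testing `L`.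
open Classical in
theorem wp_pairRow (hb : Base H n E s) (hW : n * n + n + 6 < W) (on : ℕ → Prop) {id x : ℕ}
    {L : ℕ → ℕ} (hon : ∀ z < n, 2 ≤ s.arr 9 z ↔ on z) (hx : x < n) (hxo : on x)
    (e6 : s.reg 6 = id) (e15 : s.reg 15 = x) (hL : ∀ y < n, s.arr 8 (x * n + y) = L (x * n + y)) :
    Wp W pairRow s fun t k => k ≤ 18 * n + 2 ∧
      (∀ u < n, ∀ v < n, t.arr 8 (u * n + v) =
        if u = x ∧ v ≠ x ∧ on v ∧ L (u * n + v) = 0 then id else s.arr 8 (u * n + v)) ∧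
      ((∀ r, 4 ≤ r → r ≤ 26 → r < 10 ∨ 20 ≤ r → t.reg r = s.reg r) ∧
          (∀ y < n, y ≠ x → on y → L (x * n + y) = 0) ∨
        t.reg 4 = 1 ∧ Conflict on n id L t) := by
  refine wp_for n (fun j t k => k ≤ 18 * j + 1 ∧
      (∀ u < n, ∀ v < n, t.arr 8 (u * n + v) =
        if u = x ∧ v < j ∧ v ≠ x ∧ on v ∧ L (u * n + v) = 0 then id else s.arr 8 (u * n + v)) ∧
      ((∀ r, 4 ≤ r → r ≤ 26 → r < 10 ∨ 20 ≤ r → t.reg r = s.reg r) ∧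
          (∀ y < j, y ≠ x → on y → L (x * n + y) = 0) ∨
        t.reg 4 = 1 ∧ Conflict on n id L t))
      (by omega) hb.reg0 hb.reg2 (by decide) ?_ ?_ ?_
  · refine ⟨le_rfl, fun u _ v _ => by simp, .inl ⟨fun r _ _ _ => ?_, by simp⟩⟩
    rw [State.reg_setReg, if_neg (by omega)]
  · rintro j hj t k ⟨hk, h8, hf⟩ hi ha
    have hb' := hb.of_agree ha (by decide) (by decide)
    have f15 : t.reg 15 = x := (ha.1 15 (by decide)).trans e15
    have f6 : t.reg 6 = id := (ha.1 6 (by decide)).trans e6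
    have f9 : t.arr 9 = s.arr 9 := ha.2 9 (by decide)
    have b1 := cell_lt hx hj
    have g8 : t.arr 8 (x * n + j) = L (x * n + j) := by
      rw [h8 x hx j hj, if_neg (by simp), hL j hj]
    -- the invariant is preserved by doing nothing at a pair that needs nothing
    have skip : ¬ (j ≠ x ∧ on j) → ∀ l ≤ 16, ∀ u : State, u.arr 8 = t.arr 8 →
        (∀ r, 4 ≤ r → r ≤ 26 → r < 10 ∨ 20 ≤ r → u.reg r = t.reg r) →
        (k + l + 2 ≤ 18 * (j + 1) + 1 ∧
        (∀ u' < n, ∀ v < n, u.arr 8 (u' * n + v) =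
          if u' = x ∧ v < j + 1 ∧ v ≠ x ∧ on v ∧ L (u' * n + v) = 0 then id
          else s.arr 8 (u' * n + v)) ∧
        ((∀ r, 4 ≤ r → r ≤ 26 → r < 10 ∨ 20 ≤ r → (u.setReg 16 (j + 1)).reg r = s.reg r) ∧
            (∀ y < j + 1, y ≠ x → on y → L (x * n + y) = 0) ∨
          (u.setReg 16 (j + 1)).reg 4 = 1 ∧ Conflict on n id L (u.setReg 16 (j + 1)))) := by
      intro hn l hl u hu8 hur
      refine ⟨by omega, fun u' hu' v hv => ?_, hf.imp ?_ ?_⟩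
      · rw [hu8, h8 u' hu' v hv]
        refine if_congr ?_ rfl rfl
        constructor
        · rintro ⟨h1, h2, h3⟩
          exact ⟨h1, by omega, h3⟩
        · rintro ⟨h1, h2, h3, h4, h5⟩
          refine ⟨h1, ?_, h3, h4, h5⟩
          by_contra h
          obtain rfl : v = j := by omega
          exact hn ⟨h3, h4⟩
      · rintro ⟨h1, h2⟩
        refine ⟨fun r r1 r2 r3 => ?_, fun y hy h3 h4 => ?_⟩
        · rw [State.reg_setReg, if_neg (by omega), hur r r1 r2 r3, h1 r r1 r2 r3]
        · refine h2 y ?_ h3 h4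
          by_contra h
          obtain rfl : y = j := by omega
          exact hn ⟨h3, h4⟩
      · rintro ⟨h1, h2⟩
        refine ⟨?_, h2.congr fun r r1 r2 => ?_⟩
        · rw [State.reg_setReg, if_neg (by omega), hur 4 le_rfl (by omega) (by omega), h1]
        · rw [State.reg_setReg, if_neg (by omega), hur r (by omega) r2 (by omega)]
    rw [wp_seq, wp_load, wp_cond]
    have c1 : (Test.lt 17 8).holds (t.setReg 17 (t.arr 9 (t.reg 16))) ↔ s.arr 9 j < 2 := by
      simp [Test.holds, hb'.reg8, hi, f9]
    rw [c1]
    refine ⟨fun h2 => ?_, fun h2 => ?_⟩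
    · rw [wp_skip]
      refine skip (fun h => ?_) _ ?_ (t.setReg 17 (t.arr 9 (t.reg 16))) rfl
        fun r _ _ _ => ?_
      · have := (hon j hj).2 h.2
        omega
      · omega
      · rw [State.reg_setReg, if_neg (by omega)]
    have onj : on j := (hon j hj).1 (by omega)
    rw [wp_cond]
    have c2 : (Test.eq 15 16).holds (t.setReg 17 (t.arr 9 (t.reg 16))) ↔ x = j := by
      simp [Test.holds, f15, hi]
    rw [c2]
    refine ⟨fun h3 => ?_, fun h3 => ?_⟩
    · rw [wp_skip]
      refine skip (fun h => h.1 h3.symm) _ ?_ (t.setReg 17 (t.arr 9 (t.reg 16))) rfl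
        fun r _ _ _ => ?_
      · omega
      · rw [State.reg_setReg, if_neg (by omega)]
    rw [wp_seq, wp_mget (by decide)]
    simp [hi, f15, hb'.row _ hx, g8]
    refine ⟨by omega, ?_⟩
    rw [wp_cond]
    simp [Test.holds, hb'.reg5, wp_mset, f15, hi, hb'.row _ hx, recordConflict, wp_seq, wp_move,
      wp_const, f6]
    refine ⟨fun h0 => ⟨by omega, by omega, ?_, ?_⟩, fun h0 => ⟨by omega, by omega, ?_, ?_⟩⟩
    · intro u hu v hv
      by_cases hc : u * n + v = x * n + j
      · obtain ⟨rfl, rfl⟩ := (cell_inj hv hj).1 hc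
        rw [if_pos rfl, if_pos ⟨rfl, by omega, Ne.symm h3, onj, h0⟩]
      · rw [if_neg hc, h8 u hu v hv]
        refine if_congr ?_ rfl rfl
        constructor
        · rintro ⟨h1, h2, h3⟩
          exact ⟨h1, by omega, h3⟩
        · rintro ⟨h1, h2, h3⟩
          refine ⟨h1, ?_, h3⟩
          by_contra h
          obtain rfl : v = j := by omega
          exact hc (by rw [h1])
    · refine hf.imp ?_ ?_
      · rintro ⟨h1, h2⟩
        refine ⟨fun r r1 r2 r3 => ?_, fun y hy h3 h4 => ?_⟩
        · rw [if_neg (by omega), if_neg (by omega), if_neg (by omega), if_neg (by omega),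
            h1 r r1 r2 r3]
        · by_cases hyj : y = j
          · rw [hyj]
            exact h0
          · exact h2 y (by omega) h3 h4
      · rintro ⟨h1, h2⟩
        refine ⟨h1, h2.congr fun r r1 r2 => ?_⟩
        simp only [State.reg_setReg, State.reg_setArr]
        rw [if_neg (by omega), if_neg (by omega), if_neg (by omega), if_neg (by omega)]
    · intro u hu v hv
      rw [h8 u hu v hv]
      refine if_congr ?_ rfl rfl
      constructor
      · rintro ⟨h1, h2, h3⟩
        exact ⟨h1, by omega, h3⟩
      · rintro ⟨rfl, h2, h3, h4, h5⟩
        refine ⟨rfl, ?_, h3, h4, h5⟩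
        by_contra h
        obtain rfl : v = j := by omega
        exact h0 h5
    · right
      exact ⟨x, j, hx, hj, h3, hxo, onj, h0, by simp⟩
  · rintro t k ⟨hk, h8, hf⟩ hi ha
    refine ⟨by omega, fun u hu v hv => ?_, hf⟩
    rw [h8 u hu v hv]
    exact if_congr (by simp [hv]) rfl rfl

-- The inner loop runs only for points of the line, so the factor of `18 * n + 4` is the size of the
-- line and not `n`.
open Classical in
theorem wp_markPairs (hb : Base H n E s) (hW : n * n + n + 6 < W) (on : ℕ → Prop) {id : ℕ}
    {L : ℕ → ℕ} (hon : ∀ z < n, 2 ≤ s.arr 9 z ↔ on z) (e6 : s.reg 6 = id) (hL : s.arr 8 = L) :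
    Wp W markPairs s fun t k => k ≤ 5 * n + (18 * n + 4) * ((Finset.range n).filter on).card + 2 ∧
      (∀ u < n, ∀ v < n, t.arr 8 (u * n + v) =
        if v ≠ u ∧ on u ∧ on v ∧ L (u * n + v) = 0 then id else L (u * n + v)) ∧
      ((∀ r, 4 ≤ r → r ≤ 26 → r < 10 ∨ 20 ≤ r → t.reg r = s.reg r) ∧
          (∀ x < n, ∀ y < n, y ≠ x → on x → on y → L (x * n + y) = 0) ∨
        t.reg 4 = 1 ∧ Conflict on n id L t) := by
  refine wp_for n (fun j t k => k ≤ 5 * j + (18 * n + 4) * ((Finset.range j).filter on).card + 1 ∧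
      (∀ u < n, ∀ v < n, t.arr 8 (u * n + v) =
        if u < j ∧ v ≠ u ∧ on u ∧ on v ∧ L (u * n + v) = 0 then id else L (u * n + v)) ∧
      ((∀ r, 4 ≤ r → r ≤ 26 → r < 10 ∨ 20 ≤ r → t.reg r = s.reg r) ∧
          (∀ x < j, ∀ y < n, y ≠ x → on x → on y → L (x * n + y) = 0) ∨
        t.reg 4 = 1 ∧ Conflict on n id L t))
      (by omega) hb.reg0 hb.reg2 (by decide) ?_ ?_ ?_
  · refine ⟨by omega, fun u _ v _ => by simp [hL], .inl ⟨fun r _ _ _ => ?_, by simp⟩⟩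
    rw [State.reg_setReg, if_neg (by omega)]
  · rintro j hj t k ⟨hk, h8, hf⟩ hi ha
    have hb' := hb.of_agree ha (by decide) (by decide)
    have f6 : t.reg 6 = id := (ha.1 6 (by decide)).trans e6
    have f9 : t.arr 9 = s.arr 9 := ha.2 9 (by decide)
    have card : ((Finset.range (j + 1)).filter on).card =
        ((Finset.range j).filter on).card + if on j then 1 else 0 := by
      rw [Finset.range_add_one, Finset.filter_insert]
      split_ifs
      · rw [Finset.card_insert_of_notMem (by simp)]
      · rfl
    rw [wp_seq, wp_load, wp_cond]
    have c1 : (Test.lt 17 8).holds (t.setReg 17 (t.arr 9 (t.reg 15))) ↔ ¬ on j := by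
      simp only [Test.holds, State.reg_setReg, Nat.reduceEqDiff, reduceIte, hb'.reg8, hi, f9]
      rw [← hon j hj, not_le]
    rw [c1]
    refine ⟨fun h => ?_, fun h => ?_⟩
    · rw [wp_skip]
      refine ⟨?_, fun u hu v hv => ?_, hf.imp ?_ ?_⟩
      · rw [if_neg h] at card
        rw [card]
        simp only [Nat.add_zero]
        omega
      · simp only [State.arr_setReg]
        rw [h8 u hu v hv]
        refine if_congr ?_ rfl rfl
        constructor
        · rintro ⟨h1, h2⟩
          exact ⟨by omega, h2⟩
        · rintro ⟨h1, h2, h3, h4⟩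
          refine ⟨?_, h2, h3, h4⟩
          by_contra h'
          obtain rfl : u = j := by omega
          exact h h3
      · rintro ⟨h1, h2⟩
        refine ⟨fun r r1 r2 r3 => ?_, fun x hx y hy h3 h4 h5 => ?_⟩
        · rw [State.reg_setReg, if_neg (by omega), State.reg_setReg, if_neg (by omega),
            h1 r r1 r2 r3]
        · refine h2 x ?_ y hy h3 h4 h5
          by_contra h'
          obtain rfl : x = j := by omega
          exact h h4
      · rintro ⟨h1, h2⟩
        refine ⟨?_, h2.congr fun r r1 r2 => ?_⟩
        · rw [State.reg_setReg, if_neg (by omega), State.reg_setReg, if_neg (by omega), h1]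
        · rw [State.reg_setReg, if_neg (by omega), State.reg_setReg, if_neg (by omega)]
    · rw [not_not] at h
      have hrow : ∀ y < n, t.arr 8 (j * n + y) = L (j * n + y) := fun y hy => by
        rw [h8 j hj y hy, if_neg (by simp)]
      refine (wp_pairRow (s := t.setReg 17 (t.arr 9 (t.reg 15))) (L := L) (id := id) (x := j)
        (hb'.of_agree (R := [17]) (A := []) ⟨fun x hx => ?_, fun _ _ => rfl⟩ (by decide)
        (by decide)) hW on ?_ hj h ?_ ?_ hrow).mono ?_
      · simp only [List.mem_singleton] at hx
        rw [State.reg_setReg, if_neg hx]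
      · rwa [State.arr_setReg, f9]
      · simpa using f6
      · simpa using hi
      rintro u l ⟨hl, g8, g⟩
      refine ⟨?_, fun u' hu v hv => ?_, ?_⟩
      · rw [if_pos h] at card
        rw [card]
        simp only [Nat.mul_add, Nat.mul_one]
        omega
      · simp only [State.arr_setReg] at g8 ⊢
        rw [g8 u' hu v hv, h8 u' hu v hv]
        by_cases hj' : u' = j
        · subst hj'
          simp [h]
        · rw [if_neg (by tauto)]
          refine if_congr ⟨fun h1 => ⟨by omega, h1.2⟩, fun h1 => ⟨by omega, h1.2⟩⟩ rfl rfl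
      · rcases g with ⟨g1, g2⟩ | ⟨g1, g2⟩
        · refine hf.imp ?_ ?_
          · rintro ⟨h1, h2⟩
            refine ⟨fun r r1 r2 r3 => ?_, fun x hx y hy h3 h4 h5 => ?_⟩
            · rw [State.reg_setReg, if_neg (by omega), g1 r r1 r2 r3, State.reg_setReg,
                if_neg (by omega), h1 r r1 r2 r3]
            · by_cases hxj : x = j
              · subst hxj
                exact g2 y hy h3 h5
              · exact h2 x (by omega) y hy h3 h4 h5
          · rintro ⟨h1, h2⟩
            refine ⟨?_, h2.congr fun r r1 r2 => ?_⟩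
            · rw [State.reg_setReg, if_neg (by omega), g1 4 le_rfl (by omega) (by omega),
                State.reg_setReg, if_neg (by omega), h1]
            · rw [State.reg_setReg, if_neg (by omega), g1 r (by omega) r2 (by omega),
                State.reg_setReg, if_neg (by omega)]
        · right
          refine ⟨?_, g2.congr fun r r1 r2 => ?_⟩
          · rw [State.reg_setReg, if_neg (by omega), g1]
          · rw [State.reg_setReg, if_neg (by omega)]
  · rintro t k ⟨hk, h8, hf⟩ hi ha
    refine ⟨by omega, fun u hu v hv => ?_, hf⟩
    rw [h8 u hu v hv]
    exact if_congr (by simp [hu]) rfl rfl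

end
end Ram

/-! ### All lines, and the amortized cost of marking them. -/

namespace Ram

section
variable {H : SimpleGraph ℕ} {W n E r : ℕ} {s t : State}

/-- `x` is a point of the line with name `id`. -/
def LineAt (H : SimpleGraph ℕ) (s : State) (id x : ℕ) : Prop :=
  OnLine H (s.arr 11 id) (s.arr 12 id) (s.arr 13 id) x

/-- The vertices that describe a failure. -/
def gathered (s : State) : List ℕ :=
  [s.reg 20, s.reg 21, s.reg 22, s.reg 23,
    s.arr 11 (s.reg 24), s.arr 12 (s.reg 24), s.arr 13 (s.reg 24),
    s.arr 11 (s.reg 25), s.arr 12 (s.reg 25), s.arr 13 (s.reg 25),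
    s.arr 11 (s.reg 26), s.arr 12 (s.reg 26), s.arr 13 (s.reg 26)]

/-- A failure has been recorded. -/
def Bad (H : SimpleGraph ℕ) (n : ℕ) (s : State) : Prop :=
  (∀ x ∈ gathered s, x < n) ∧ ¬ IsProbeDiamondFree (H.induce {x | x ∈ gathered s})

theorem Bad.of_agree {R A : List ℕ} (h : Bad H n s) (ha : Agree R A s t)
    (hR : ∀ x ∈ [20, 21, 22, 23, 24, 25, 26], x ∉ R) (hA : ∀ a ∈ [11, 12, 13], a ∉ A) :
    Bad H n t := by
  have e : gathered t = gathered s := by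
    simp only [gathered, ha.1 20 (hR 20 (by simp)), ha.1 21 (hR 21 (by simp)),
      ha.1 22 (hR 22 (by simp)), ha.1 23 (hR 23 (by simp)), ha.1 24 (hR 24 (by simp)),
      ha.1 25 (hR 25 (by simp)), ha.1 26 (hR 26 (by simp)), ha.2 11 (hA 11 (by simp)),
      ha.2 12 (hA 12 (by simp)), ha.2 13 (hA 13 (by simp))]
  unfold Bad
  rwa [e]

theorem Agree.setReg (s : State) (x v : ℕ) : Agree [x] [] s (s.setReg x v) :=
  ⟨fun y hy => by simp_all, fun _ _ => rfl⟩

theorem Agree.setArr (s : State) (a i v : ℕ) : Agree [] [a] s (s.setArr a i v) := by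
  refine ⟨fun _ _ => rfl, fun b hb => ?_⟩
  have : b ≠ a := by simpa using hb
  simp [State.setArr, this]

/-- The first `r` lines have been computed. -/
structure Lines (H : SimpleGraph ℕ) (n r : ℕ) (s : State) : Prop where
  last : s.reg 6 = n * r
  zero : s.arr 11 0 = 0 ∧ s.arr 12 0 = 0 ∧ s.arr 13 0 = 0
  triangle : ∀ i, 1 ≤ i → i ≤ r →
    IsTriangle H (s.arr 11 (n * i)) (s.arr 12 (n * i)) (s.arr 13 (n * i))
  sound : ∀ x < n, ∀ y < n, s.arr 8 (x * n + y) ≠ 0 → x ≠ y ∧ ∃ i, 1 ≤ i ∧ i ≤ r ∧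
    s.arr 8 (x * n + y) = n * i ∧ LineAt H s (n * i) x ∧ LineAt H s (n * i) y
  full : ∀ i, 1 ≤ i → i ≤ r → ∀ x y, x ≠ y → LineAt H s (n * i) x → LineAt H s (n * i) y →
    s.arr 8 (x * n + y) = n * i

theorem Lines.of_agree {R A : List ℕ} (h : Lines H n r s) (ha : Agree R A s t) (hR : 6 ∉ R)
    (hA : ∀ a ∈ [8, 11, 12, 13], a ∉ A) : Lines H n r t := by
  obtain ⟨h1, h0, h2, h3, h4⟩ := h
  have e8 := ha.2 8 (hA 8 (by simp))
  have e11 := ha.2 11 (hA 11 (by simp))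
  have e12 := ha.2 12 (hA 12 (by simp))
  have e13 := ha.2 13 (hA 13 (by simp))
  refine ⟨(ha.1 6 hR).trans h1, ?_, ?_, ?_, ?_⟩
  · rwa [e11, e12, e13]
  · rwa [e11, e12, e13]
  · simp only [LineAt, e8, e11, e12, e13]
    exact h3
  · simp only [LineAt, e8, e11, e12, e13]
    exact h4

theorem Lines.lt (hb : Base H n E s) (h : Lines H n r s) {i x : ℕ} (h1 : 1 ≤ i) (h2 : i ≤ r)
    (hx : LineAt H s (n * i) x) : x < n :=
  OnLine.lt hb (h.triangle i h1 h2) hx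

theorem IsTriangle.onLine {v w a : ℕ} (ht : IsTriangle H v w a) :
    OnLine H v w a v ∧ OnLine H v w a w ∧ OnLine H v w a a :=
  ⟨.inl ⟨.inl rfl, .inr ht.1⟩, .inl ⟨.inr ht.1.symm, .inl rfl⟩,
    .inr (.inl ⟨.inr ht.2.1.symm, .inl rfl⟩)⟩

theorem IsTriangle.lt (hb : Base H n E s) {v w a : ℕ} (ht : IsTriangle H v w a) :
    v < n ∧ w < n ∧ a < n :=
  ⟨(hb.bound _ _ ht.1).1, (hb.bound _ _ ht.1).2, (hb.bound _ _ ht.2.1).2⟩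

/-- Every point of a line is the source of a dart of the line. -/
theorem exists_dart_onLine (hb : Base H n E s) {v w a : ℕ} (ht : IsTriangle H v w a) :
    ∃ f : ℕ → ℕ, ∀ x, OnLine H v w a x →
      f x < E ∧ s.arr 6 (f x) = x ∧ OnLine H v w a (s.arr 1 (f x)) := by
  have : ∀ x, ∃ e, OnLine H v w a x →
      e < E ∧ s.arr 6 e = x ∧ OnLine H v w a (s.arr 1 e) := by
    intro x
    by_cases hx : OnLine H v w a x
    · obtain ⟨y, hy, hxy⟩ := exists_adj_onLine ht hx
      obtain ⟨e, he, e1, e2⟩ := hb.surj x y hxy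
      exact ⟨e, fun _ => ⟨he, e1, by rwa [e2]⟩⟩
    · exact ⟨0, fun h => absurd h hx⟩
  choose f hf using this
  exact ⟨f, hf⟩

/-- The indices of the darts that are on a line in the matrix of lines. -/
def covered (n E : ℕ) (s : State) : Finset ℕ :=
  (Finset.range E).filter fun e => s.arr 8 (s.arr 6 e * n + s.arr 1 e) ≠ 0

theorem card_covered_le : (covered n E s).card ≤ E :=
  (Finset.card_filter_le _ _).trans_eq (Finset.card_range E)

open Classical in
theorem card_line_le (hb : Base H n E s) {v w a : ℕ} (ht : IsTriangle H v w a) :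
    ((Finset.range n).filter (OnLine H v w a)).card ≤ E := by
  obtain ⟨f, hf⟩ := exists_dart_onLine hb ht
  rw [← Finset.card_range E]
  refine Finset.card_le_card_of_injOn f (fun x hx => ?_) fun x hx y hy h => ?_
  · simpa using (hf x (Finset.mem_filter.1 hx).2).1
  · rw [← (hf x (Finset.mem_filter.1 hx).2).2.1, ← (hf y (Finset.mem_filter.1 hy).2).2.1, h]

-- The amortization: choosing for each point a dart that starts there and stays in the line is
-- injective, and all chosen darts become covered only now. A line with `b` points thus pays for its
-- marking with `b` new darts.
open Classical in
theorem card_line_add_covered_le (hb : Base H n E s) {v w a : ℕ} (ht : IsTriangle H v w a)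
    (h6 : t.arr 6 = s.arr 6) (h1 : t.arr 1 = s.arr 1)
    (hmono : ∀ x < n, ∀ y < n, s.arr 8 (x * n + y) ≠ 0 → t.arr 8 (x * n + y) ≠ 0)
    (hnew : ∀ x y, x ≠ y → OnLine H v w a x → OnLine H v w a y →
      s.arr 8 (x * n + y) = 0 ∧ t.arr 8 (x * n + y) ≠ 0) :
    ((Finset.range n).filter (OnLine H v w a)).card + (covered n E s).card ≤
      (covered n E t).card := by
  obtain ⟨f, hf⟩ := exists_dart_onLine hb ht
  have sub : covered n E s ⊆ covered n E t := by
    intro e he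
    simp only [covered, Finset.mem_filter, Finset.mem_range, h6, h1] at he ⊢
    have := hb.bound _ _ (hb.dart e he.1)
    exact ⟨he.1, hmono _ this.1 _ this.2 he.2⟩
  have le : ((Finset.range n).filter (OnLine H v w a)).card ≤
      (covered n E t \ covered n E s).card := by
    refine Finset.card_le_card_of_injOn f (fun x hx => ?_) fun x hx y hy h => ?_
    · obtain ⟨g1, g2, g3⟩ := hf x (Finset.mem_filter.1 hx).2
      have g4 := (hb.dart _ g1).ne
      have := hnew _ _ g4 (by rw [g2]; exact (Finset.mem_filter.1 hx).2) g3
      simp only [covered, Finset.coe_sdiff, Set.mem_sdiff, Finset.mem_coe, Finset.mem_filter,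
        Finset.mem_range, h6, h1]
      exact ⟨⟨g1, this.2⟩, fun h => h.2 this.1⟩
    · rw [← (hf x (Finset.mem_filter.1 hx).2).2.1, ← (hf y (Finset.mem_filter.1 hy).2).2.1, h]
  rw [Finset.card_sdiff_of_subset sub] at le
  have := Finset.card_le_card sub
  omega

open Classical in
theorem three_le_card_line (hb : Base H n E s) {v w a : ℕ} (ht : IsTriangle H v w a) :
    3 ≤ ((Finset.range n).filter (OnLine H v w a)).card := by
  have e : ({v, w, a} : Finset ℕ).card = 3 :=
    Finset.card_eq_three.2 ⟨v, w, a, ht.1.ne, ht.2.1.ne, ht.2.2.ne, rfl⟩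
  rw [← e]
  refine Finset.card_le_card fun x hx => ?_
  obtain ⟨h1, h2, h3⟩ := IsTriangle.onLine ht
  obtain ⟨g1, g2, g3⟩ := IsTriangle.lt hb ht
  simp only [Finset.mem_insert, Finset.mem_singleton] at hx
  rw [Finset.mem_filter, Finset.mem_range]
  rcases hx with rfl | rfl | rfl
  exacts [⟨g1, h1⟩, ⟨g2, h2⟩, ⟨g3, h3⟩]

/-- The new line shares two points `x`, `y` with an old one. The edge `vw` was on no line, so `v` or
`w` is off the old line; yet it is joined to `x` and `y` through the new line. -/
theorem bad_of_conflict (hb : Base H n E s) (hl : Lines H n r s) {v w a : ℕ}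
    (ht : IsTriangle H v w a) (h0 : s.arr 8 (v * n + w) = 0)
    (hold : ∀ i, 1 ≤ i → i ≤ r → t.arr 11 (n * i) = s.arr 11 (n * i) ∧
      t.arr 12 (n * i) = s.arr 12 (n * i) ∧ t.arr 13 (n * i) = s.arr 13 (n * i))
    {id : ℕ} (hnew : t.arr 11 id = v ∧ t.arr 12 id = w ∧ t.arr 13 id = a)
    (hc : Conflict (OnLine H v w a) n id (s.arr 8) t) : Bad H n t := by
  obtain ⟨x, y, hx, hy, hxy, ox, oy, hL, e20, e21, e22, e23, e24, e25, e26⟩ := hc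
  obtain ⟨-, i, i1, i2, ei, lx, ly⟩ := hl.sound x hx y hy hL
  have ht' := hl.triangle i i1 i2
  obtain ⟨g1, g2, g3⟩ := IsTriangle.lt hb ht
  obtain ⟨g1', g2', g3'⟩ := IsTriangle.lt hb ht'
  obtain ⟨o1, o2, o3⟩ := hold i i1 i2
  obtain ⟨n1, n2, n3⟩ := hnew
  obtain ⟨p1, p2, p3⟩ := IsTriangle.onLine ht
  rw [ei] at e25
  have eg : gathered t = [x, y, x, x, v, w, a, s.arr 11 (n * i), s.arr 12 (n * i),
      s.arr 13 (n * i), v, w, a] := by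
    simp [gathered, *]
  have key : ∀ z, (z = v ∨ z = w) → ¬ LineAt H s (n * i) z → Bad H n t := by
    intro z hz hzl
    refine ⟨?_, ?_⟩
    · rw [eg]
      simp [*]
    · rw [eg]
      have oz : OnLine H v w a z := by
        rcases hz with rfl | rfl
        exacts [p1, p2]
      have com : ∀ u, OnLine H v w a u → z = u ∨ H.Adj z u ∨ OnCommonLine H
          {u | u ∈ [x, y, x, x, v, w, a, s.arr 11 (n * i), s.arr 12 (n * i),
            s.arr 13 (n * i), v, w, a]} z u := by
        intro u hu
        by_cases h : z = u
        · exact .inl h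
        · exact .inr (.inr ⟨h, v, w, a, by simp, by simp, by simp, ht, oz, hu⟩)
      refine not_isProbeDiamondFree_of_two (by simp) (by simp) (by simp) (by simp) (by simp)
        ?_ ht' hxy lx ly (com x ox) (com y oy) hzl
      rcases hz with rfl | rfl <;> simp
  by_cases hv : LineAt H s (n * i) v
  · refine key w (.inr rfl) fun hw => ?_
    have h := hl.full i i1 i2 v w ht.1.ne hv hw
    rw [h0] at h
    have : 0 < n * i := Nat.mul_pos (by omega) i1
    omega
  · exact key v (.inl rfl) hv

open Classical in
theorem wp_newLine (hb : Base H n E s) (hl : Lines H n r s) (hW : n * n + n + 6 < W)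
    (hW' : n * (r + 1) < W) {v w a : ℕ} (ht : IsTriangle H v w a) (e11 : s.reg 11 = v)
    (e12 : s.reg 12 = w) (e13 : s.reg 13 = a) (e4 : s.reg 4 = 0)
    (h0 : s.arr 8 (v * n + w) = 0) :
    Wp W newLine s fun t k =>
      k ≤ 25 * (n + 1) * ((Finset.range n).filter (OnLine H v w a)).card ∧
      (t.reg 4 = 0 ∧ Lines H n (r + 1) t ∧
          (∀ x < n, ∀ y < n, s.arr 8 (x * n + y) ≠ 0 → t.arr 8 (x * n + y) ≠ 0) ∧
          (∀ x y, x ≠ y → OnLine H v w a x → OnLine H v w a y →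
            s.arr 8 (x * n + y) = 0 ∧ t.arr 8 (x * n + y) ≠ 0) ∨
        t.reg 4 = 1 ∧ Bad H n t) := by
  obtain ⟨g1, g2, g3⟩ := IsTriangle.lt hb ht
  have hid : n * r + n = n * (r + 1) := by ring
  have hpos : ∀ i, 1 ≤ i → 0 < n * i := fun i hi => Nat.mul_pos (by omega) hi
  have hne : ∀ i, i ≤ r → n * i ≠ n * (r + 1) := fun i hi h => by
    have := Nat.eq_of_mul_eq_mul_left (by omega) h
    omega
  simp only [newLine, wp_seq, wp_add, wp_store, hl.last, hb.reg0, hid]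
  refine ⟨hW', ?_⟩
  simp only [State.reg_setReg, State.reg_setArr, e11, e12, e13, Nat.reduceEqDiff, reduceIte]
  set u := ((((s.setReg 6 (n * (r + 1))).setArr 11 (n * (r + 1)) v).setArr 12 (n * (r + 1))
    w).setArr 13 (n * (r + 1)) a) with hu
  have hag : Agree [6] [11, 12, 13] s u := by
    refine ⟨fun x hx => ?_, fun b hb => ?_⟩
    · simp only [List.mem_singleton] at hx
      simp [hu, hx]
    · simp only [List.mem_cons, List.not_mem_nil, or_false, not_or] at hb
      simp [hu, State.setArr, State.setReg, hb]
  have hbu := hb.of_agree hag (by decide) (by decide)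
  have u11 : ∀ j, u.arr 11 j = if j = n * (r + 1) then v else s.arr 11 j := by simp [hu]
  have u12 : ∀ j, u.arr 12 j = if j = n * (r + 1) then w else s.arr 12 j := by simp [hu]
  have u13 : ∀ j, u.arr 13 j = if j = n * (r + 1) then a else s.arr 13 j := by simp [hu]
  have u6 : u.reg 6 = n * (r + 1) := by simp [hu]
  refine (wp_scanLine hbu hW g1 g2 g3 ((hag.1 11 (by decide)).trans e11)
    ((hag.1 12 (by decide)).trans e12) ((hag.1 13 (by decide)).trans e13)).frame ?_
  rintro p k ⟨hk, h9⟩ hap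
  have hbp := hbu.of_agree hap (by decide) (by decide)
  have p8 : p.arr 8 = s.arr 8 := (hap.2 8 (by decide)).trans (hag.2 8 (by decide))
  refine (wp_markPairs hbp hW (OnLine H v w a) (id := n * (r + 1)) (L := s.arr 8)
    (fun z hz => by rw [h9 z hz]; exact two_le_adjCode ht)
    ((hap.1 6 (by decide)).trans u6) p8).frame ?_
  rintro q l ⟨hl', h8, hc⟩ haq
  have q11 : q.arr 11 = u.arr 11 := (haq.2 11 (by decide)).trans (hap.2 11 (by decide))
  have q12 : q.arr 12 = u.arr 12 := (haq.2 12 (by decide)).trans (hap.2 12 (by decide))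
  have q13 : q.arr 13 = u.arr 13 := (haq.2 13 (by decide)).trans (hap.2 13 (by decide))
  have hold : ∀ i, 1 ≤ i → i ≤ r → q.arr 11 (n * i) = s.arr 11 (n * i) ∧
      q.arr 12 (n * i) = s.arr 12 (n * i) ∧ q.arr 13 (n * i) = s.arr 13 (n * i) := by
    intro i _ hi
    rw [q11, q12, q13, u11, u12, u13, if_neg (hne i hi), if_neg (hne i hi), if_neg (hne i hi)]
    exact ⟨rfl, rfl, rfl⟩
  have hnew : q.arr 11 (n * (r + 1)) = v ∧ q.arr 12 (n * (r + 1)) = w ∧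
      q.arr 13 (n * (r + 1)) = a := by
    rw [q11, q12, q13, u11, u12, u13, if_pos rfl, if_pos rfl, if_pos rfl]
    exact ⟨rfl, rfl, rfl⟩
  refine ⟨?_, ?_⟩
  · have h3 := three_le_card_line hb ht
    generalize ((Finset.range n).filter (OnLine H v w a)).card = b at *
    -- A line has at least three points, so the linear cost of scanning all vertices fits into a
    -- multiple of the size `b` of the line.
    have e1 := Nat.mul_le_mul_left (7 * n + 3) h3
    have e2 : 25 * (n + 1) * b = (18 * n + 4) * b + (7 * n + 3) * b + 18 * b := by ring
    rw [e2]
    omega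
  rcases hc with ⟨hr, hz⟩ | ⟨h4, hc⟩
  · have hzero : ∀ x y, x ≠ y → OnLine H v w a x → OnLine H v w a y →
        s.arr 8 (x * n + y) = 0 ∧ q.arr 8 (x * n + y) = n * (r + 1) := by
      intro x y hxy hx hy
      have hx' := OnLine.lt hb ht hx
      have hy' := OnLine.lt hb ht hy
      have := hz x hx' y hy' (Ne.symm hxy) hx hy
      refine ⟨this, ?_⟩
      rw [h8 x hx' y hy', if_pos ⟨Ne.symm hxy, hx, hy, this⟩]
    left
    refine ⟨?_, ⟨?_, ?_, ?_, ?_, ?_⟩, ?_, ?_⟩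
    · rw [hr 4 le_rfl (by omega) (by omega), hap.1 4 (by decide), hag.1 4 (by decide), e4]
    · rw [haq.1 6 (by decide), hap.1 6 (by decide), u6]
    · have := hpos (r + 1) (by omega)
      rw [q11, q12, q13, u11, u12, u13, if_neg (by omega), if_neg (by omega), if_neg (by omega)]
      exact hl.zero
    · intro i i1 i2
      by_cases hi : i = r + 1
      · rw [hi, hnew.1, hnew.2.1, hnew.2.2]
        exact ht
      · obtain ⟨o1, o2, o3⟩ := hold i i1 (by omega)
        rw [o1, o2, o3]
        exact hl.triangle i i1 (by omega)
    · intro x hx y hy hxy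
      rw [h8 x hx y hy] at hxy ⊢
      split_ifs at hxy ⊢ with hi
      · refine ⟨Ne.symm hi.1, r + 1, by omega, le_rfl, rfl, ?_, ?_⟩
        · rw [LineAt, hnew.1, hnew.2.1, hnew.2.2]
          exact hi.2.1
        · rw [LineAt, hnew.1, hnew.2.1, hnew.2.2]
          exact hi.2.2.1
      · obtain ⟨h1, i, i1, i2, h3, h4, h5⟩ := hl.sound x hx y hy hxy
        obtain ⟨o1, o2, o3⟩ := hold i i1 i2
        refine ⟨h1, i, i1, by omega, h3, ?_, ?_⟩
        · rw [LineAt, o1, o2, o3]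
          exact h4
        · rw [LineAt, o1, o2, o3]
          exact h5
    · intro i i1 i2 x y hxy hx hy
      by_cases hi : i = r + 1
      · rw [hi, LineAt, hnew.1, hnew.2.1, hnew.2.2] at hx hy
        rw [hi]
        exact (hzero x y hxy hx hy).2
      · obtain ⟨o1, o2, o3⟩ := hold i i1 (by omega)
        rw [LineAt, o1, o2, o3] at hx hy
        have hx' := hl.lt hb i1 (by omega) hx
        have hy' := hl.lt hb i1 (by omega) hy
        have := hl.full i i1 (by omega) x y hxy hx hy
        rw [h8 x hx' y hy', if_neg, this]
        rintro ⟨-, -, -, h⟩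
        have := hpos i i1
        omega
    · intro x hx y hy hxy
      rw [h8 x hx y hy]
      split_ifs with hi
      · exact (hpos (r + 1) (by omega)).ne'
      · exact hxy
    · intro x y hxy hx hy
      obtain ⟨h1, h2⟩ := hzero x y hxy hx hy
      refine ⟨h1, ?_⟩
      rw [h2]
      exact (hpos (r + 1) (by omega)).ne'
  · exact .inr ⟨h4, bad_of_conflict hb hl ht h0 hold hnew hc⟩

/-- Every edge in a triangle is on a line, as far as the first `j` darts are concerned. -/
def CoveredUpTo (H : SimpleGraph ℕ) (n j : ℕ) (s : State) : Prop :=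
  ∀ e < j, ∀ z, H.Adj (s.arr 6 e) z → H.Adj (s.arr 1 e) z →
    s.arr 8 (s.arr 6 e * n + s.arr 1 e) ≠ 0

/-- The number of covered darts, times `25 * (n + 1)`, is a potential that pays for marking. A
failing step gains no potential and gets the crude bound by `E`; this happens at most once. -/
theorem wp_lineStep (hb : Base H n E s) (hl : Lines H n r s) (hW : n * n + n + 6 < W)
    (hW' : n * (r + 1) < W) (e4 : s.reg 4 = 0) {j : ℕ} (hj : j < E) (e10 : s.reg 10 = j)
    (hc : CoveredUpTo H n j s) :
    Wp W lineStep s fun t k =>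
      t.reg 4 = 0 ∧ k + 25 * (n + 1) * (covered n E s).card ≤
          25 * (n + 1) * (covered n E t).card + 13 * n + 13 ∧
          (∃ r' ≤ r + 1, Lines H n r' t) ∧ CoveredUpTo H n (j + 1) t ∨
        t.reg 4 = 1 ∧ k ≤ 25 * (n + 1) * E + 13 * n + 13 ∧ Bad H n t := by
  have had := hb.dart j hj
  obtain ⟨b1, b2⟩ := hb.bound _ _ had
  have cell := cell_lt b1 b2
  have cov : ∀ p : State, p.arr = s.arr →
      (s.arr 8 (s.arr 6 j * n + s.arr 1 j) = 0 →
        ∀ z, H.Adj (s.arr 6 j) z → ¬ H.Adj (s.arr 1 j) z) → CoveredUpTo H n (j + 1) p := by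
    intro p hp hz e he z h1 h2 h3
    rw [hp] at h1 h2 h3
    by_cases hej : e = j
    · rw [hej] at h1 h2 h3
      exact hz h3 z h1 h2
    · exact hc e (by omega) z h1 h2 h3
  simp only [lineStep, wp_seq, wp_load, e10]
  rw [wp_mget (by decide)]
  simp only [State.reg_setReg, State.arr_setReg, e10, Nat.reduceEqDiff, reduceIte, hb.row _ b1]
  refine ⟨by omega, ?_⟩
  rw [wp_cond]
  simp only [Test.holds, State.reg_setReg, Nat.reduceEqDiff, reduceIte, hb.reg5]
  set u := ((s.setReg 11 (s.arr 6 j)).setReg 12 (s.arr 1 j)).setReg 17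
    (s.arr 8 (s.arr 6 j * n + s.arr 1 j)) with hu
  have hau : Agree [11, 12, 17] [] s u := by
    refine ⟨fun x hx => ?_, fun _ _ => rfl⟩
    simp only [List.mem_cons, List.not_mem_nil, or_false, not_or] at hx
    simp [hu, hx]
  refine ⟨fun h0 => ?_, fun h0 => ?_⟩
  · rw [wp_seq, wp_const]
    refine ⟨by omega, ?_⟩
    rw [wp_seq]
    have hau' : Agree [11, 12, 14, 17] [] s (u.setReg 14 0) :=
      (hau.mono (by decide) (by decide)).trans ((Agree.setReg u 14 0).mono (by decide) (by decide))
    refine (wp_findCommon (hb.of_agree hau' (by decide) (by decide)) (by omega) b1 b2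
      (by simp [hu]) (by simp [hu]) (by simp)).frame ?_
    rintro p k ⟨hk, hp⟩ hap
    have hap' : Agree [11, 12, 13, 14, 15, 17, 18] [] s p :=
      (hau'.mono (by decide) (by decide)).trans (hap.mono (by decide) (by decide))
    have hbp := hb.of_agree hap' (by decide) (by decide)
    have arrs : p.arr = s.arr := funext fun x => hap'.2 x (by simp)
    have p4 : p.reg 4 = 0 := (hap'.1 4 (by decide)).trans e4
    rw [wp_cond]
    simp only [Test.holds, hbp.reg2]
    rcases hp with ⟨p14, hp⟩ | ⟨p14, hp1, hp2⟩
    · refine ⟨fun h => by omega, fun _ => ?_⟩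
      rw [wp_skip]
      refine .inl ⟨p4, ?_, ⟨r, by omega, hl.of_agree hap' (by decide) (by decide)⟩,
        cov p arrs fun _ => hp⟩
      rw [covered, covered, arrs]
      omega
    · refine ⟨fun _ => ?_, fun h => absurd p14 h⟩
      have ht : IsTriangle H (s.arr 6 j) (s.arr 1 j) (p.reg 13) := ⟨had, hp1, hp2⟩
      refine (wp_newLine hbp (hl.of_agree hap' (by decide) (by decide)) hW hW' ht
        ((hap.1 11 (by decide)).trans (by simp [hu])) ((hap.1 12 (by decide)).trans (by simp [hu]))
        rfl p4 (by rw [arrs]; exact h0)).frame ?_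
      rintro q l ⟨hl', hq⟩ haq
      rcases hq with ⟨q4, hq, mono, new⟩ | ⟨q4, hq⟩
      · have le := card_line_add_covered_le hbp ht (haq.2 6 (by decide)) (haq.2 1 (by decide))
          mono new
        have le2 := Nat.mul_le_mul_left (25 * (n + 1)) le
        rw [Nat.mul_add] at le2
        have e : covered n E p = covered n E s := by
          rw [covered, covered, arrs]
        rw [e] at le2
        refine .inl ⟨q4, by omega, ⟨r + 1, le_rfl, hq⟩, ?_⟩
        intro e he z h1 h2
        have f6 : q.arr 6 = s.arr 6 := by rw [haq.2 6 (by decide), arrs]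
        have f1 : q.arr 1 = s.arr 1 := by rw [haq.2 1 (by decide), arrs]
        rw [f6] at h1 ⊢
        rw [f1] at h2 ⊢
        rw [arrs] at mono new
        by_cases hej : e = j
        · rw [hej]
          exact (new _ _ had.ne (IsTriangle.onLine ht).1 (IsTriangle.onLine ht).2.1).2
        · obtain ⟨c1, c2⟩ := hb.bound _ _ (hb.dart e (by omega))
          exact mono _ c1 _ c2 (hc e (by omega) z h1 h2)
      · have le2 := Nat.mul_le_mul_left (25 * (n + 1)) (card_line_le hbp ht)
        exact .inr ⟨q4, by omega, hq⟩
  · rw [wp_skip]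
    refine .inl ⟨(hau.1 4 (by decide)).trans e4, ?_, ⟨r, by omega,
      hl.of_agree hau (by decide) (by decide)⟩, cov u rfl fun h => absurd h h0⟩
    have e : covered n E u = covered n E s := rfl
    rw [e]
    omega

theorem wp_linesProg (hb : Base H n E s) (hl : Lines H n 0 s) (hW : n * n + n + 6 < W)
    (hW' : n * E + E < W) (e4 : s.reg 4 = 0) :
    Wp W linesProg s fun t k => k ≤ 75 * (n + 1) * E + 2 ∧
      (t.reg 4 = 0 ∧ (∃ r ≤ E, Lines H n r t) ∧ CoveredUpTo H n E t ∨
        t.reg 4 = 1 ∧ Bad H n t) := by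
  -- After a failure the potential is replaced by its maximum `25 * (n + 1) * E`, and the same
  -- amount again covers the failing step; later rounds only test the flag.
  refine wp_for E (fun j t k =>
      t.reg 4 = 0 ∧ k ≤ 25 * (n + 1) * (covered n E t).card + 25 * (n + 1) * j + 1 ∧
          (∃ r ≤ j, Lines H n r t) ∧ CoveredUpTo H n j t ∨
        t.reg 4 = 1 ∧ k ≤ 50 * (n + 1) * E + 25 * (n + 1) * j + 1 ∧ Bad H n t)
      (by omega) hb.reg3 hb.reg2 (by decide) ?_ ?_ ?_
  · have := Agree.setReg s 10 0
    exact .inl ⟨by simpa using e4, by omega, ⟨0, le_rfl, hl.of_agree this (by decide) (by decide)⟩,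
      fun e he => absurd he (by omega)⟩
  · rintro j hj t k h hi ha
    have hb' := hb.of_agree ha (by decide) (by decide)
    have e1 : 25 * (n + 1) * (j + 1) = 25 * (n + 1) * j + 25 * n + 25 := by ring
    rw [wp_cond]
    simp only [Test.holds, hb'.reg5]
    rcases h with ⟨t4, hk, ⟨r, hr, hl'⟩, hc⟩ | ⟨t4, hk, hbad⟩
    · refine ⟨fun _ => ?_, fun h => absurd t4 h⟩
      have : n * (r + 1) ≤ n * E := Nat.mul_le_mul_left _ (by omega)
      refine (wp_lineStep hb' hl' hW (by omega) t4 hj hi hc).mono ?_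
      rintro u l (⟨u4, hl2, ⟨r', hr', hlu⟩, hcu⟩ | ⟨u4, hl2, hbad⟩)
      · have hau := Agree.setReg u 10 (j + 1)
        refine .inl ⟨by simpa using u4, ?_, ⟨r', by omega,
          hlu.of_agree hau (by decide) (by decide)⟩, hcu⟩
        have e : covered n E (u.setReg 10 (j + 1)) = covered n E u := rfl
        rw [e, e1]
        omega
      · have hau := Agree.setReg u 10 (j + 1)
        refine .inr ⟨by simpa using u4, ?_, hbad.of_agree hau (by decide) (by decide)⟩
        have := Nat.mul_le_mul_left (25 * (n + 1)) (card_covered_le (n := n) (E := E) (s := t))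
        have e2 : 50 * (n + 1) * E = 25 * (n + 1) * E + 25 * (n + 1) * E := by ring
        rw [e1, e2]
        omega
    · refine ⟨fun h => by omega, fun _ => ?_⟩
      rw [wp_skip]
      have hau := Agree.setReg t 10 (j + 1)
      refine .inr ⟨by simpa using t4, by omega, hbad.of_agree hau (by decide) (by decide)⟩
  · rintro t k (⟨t4, hk, ⟨r, hr, hl'⟩, hc⟩ | ⟨t4, hk, hbad⟩) hi ha
    · have := Nat.mul_le_mul_left (25 * (n + 1)) (card_covered_le (n := n) (E := E) (s := t))
      have e2 : 75 * (n + 1) * E = 25 * (n + 1) * E + 25 * (n + 1) * E + 25 * (n + 1) * E := by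
        ring
      exact ⟨by omega, .inl ⟨t4, ⟨r, hr, hl'⟩, hc⟩⟩
    · have e2 : 75 * (n + 1) * E = 50 * (n + 1) * E + 25 * (n + 1) * E := by ring
      exact ⟨by omega, .inr ⟨t4, hbad⟩⟩

end
end Ram

/-! ### The tests for two joined points and for adjacent nonprobes, and the completion set. -/

namespace Ram

section
variable {H : SimpleGraph ℕ} {W n E r : ℕ} {s t : State}

/-- The vertex `z` is off the line `id` and joined to the point `x` of this line. -/
def Joined (H : SimpleGraph ℕ) (n : ℕ) (s : State) (id x z : ℕ) : Prop :=
  LineAt H s id x ∧ ¬ LineAt H s id z ∧ x < n ∧ z < n ∧ (H.Adj x z ∨ s.arr 8 (x * n + z) ≠ 0)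

/-- The triples `P` of a line, a point of this line and a vertex have been processed in the search
for a vertex off a line that is joined to two of its points. -/
def TwoInv (H : SimpleGraph ℕ) (n r : ℕ) (P : ℕ → ℕ → ℕ → Prop) (t : State) : Prop :=
  (∀ i, 1 ≤ i → i ≤ r → ∀ z < n, t.arr 14 (n * i + z) ≠ 0 →
      Joined H n t (n * i) (t.arr 14 (n * i + z) - 1) z) ∧
    (t.reg 4 = 0 ∧ (∀ i, 1 ≤ i → i ≤ r → ∀ x z, P i x z → Joined H n t (n * i) x z →
        t.arr 14 (n * i + z) = x + 1) ∨
      t.reg 4 = 1 ∧ Bad H n t)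

theorem joined_congr {n : ℕ} {id x z : ℕ} (h8 : t.arr 8 = s.arr 8) (h11 : t.arr 11 = s.arr 11)
    (h12 : t.arr 12 = s.arr 12) (h13 : t.arr 13 = s.arr 13) :
    Joined H n t id x z ↔ Joined H n s id x z := by
  simp only [Joined, LineAt, h8, h11, h12, h13]

theorem TwoInv.of_agree {P P' : ℕ → ℕ → ℕ → Prop} {R A : List ℕ} (h : TwoInv H n r P s)
    (ha : Agree R A s t) (hR : ∀ x ∈ [4, 20, 21, 22, 23, 24, 25, 26], x ∉ R)
    (hA : ∀ a ∈ [8, 11, 12, 13, 14], a ∉ A)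
    (hP : ∀ i x z, 1 ≤ i → i ≤ r → P' i x z → P i x z ∨ ¬ Joined H n s (n * i) x z) :
    TwoInv H n r P' t := by
  have e14 := ha.2 14 (hA 14 (by simp))
  have hj : ∀ {id x z}, Joined H n t id x z ↔ Joined H n s id x z :=
    joined_congr (ha.2 8 (hA 8 (by simp))) (ha.2 11 (hA 11 (by simp)))
      (ha.2 12 (hA 12 (by simp))) (ha.2 13 (hA 13 (by simp)))
  obtain ⟨h1, h2⟩ := h
  refine ⟨?_, h2.imp ?_ ?_⟩
  · intro i i1 i2 z hz
    rw [e14, hj]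
    exact h1 i i1 i2 z hz
  · rintro ⟨h3, h4⟩
    refine ⟨(ha.1 4 (hR 4 (by simp))).trans h3, fun i i1 i2 x z hp h => ?_⟩
    rw [hj] at h
    rw [e14]
    exact h4 i i1 i2 x z ((hP i x z i1 i2 hp).resolve_right fun h' => h' h) h
  · rintro ⟨h3, h4⟩
    refine ⟨(ha.1 4 (hR 4 (by simp))).trans h3,
      h4.of_agree ha (fun x hx => hR x (List.mem_cons_of_mem _ hx))
        fun x hx => hA x (by simp only [List.mem_cons] at hx ⊢; tauto)⟩

/-- Two vertices that are on a line by the matrix of lines are on a line with vertices in the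
given set. -/
theorem joined_cases (hl : Lines H n r s) {x z : ℕ} (hx : x < n) (hz : z < n) {X : Set ℕ}
    (h : H.Adj x z ∨ s.arr 8 (x * n + z) ≠ 0)
    (hX : s.arr 11 (s.arr 8 (x * n + z)) ∈ X ∧ s.arr 12 (s.arr 8 (x * n + z)) ∈ X ∧
      s.arr 13 (s.arr 8 (x * n + z)) ∈ X) :
    z = x ∨ H.Adj z x ∨ OnCommonLine H X z x := by
  rcases h with h | h
  · exact .inr (.inl h.symm)
  · obtain ⟨hxz, i, i1, i2, e, lx, lz⟩ := hl.sound x hx z hz h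
    rw [e] at hX
    exact .inr (.inr ⟨hxz.symm, _, _, _, hX.1, hX.2.1, hX.2.2, hl.triangle i i1 i2, lz, lx⟩)

/-- When `x`, `y` are on no line, the name read is `0`, and the triangle stored there consists of
three copies of the vertex `0`. Gathering it is harmless. -/
theorem Lines.triangle_lt (hb : Base H n E s) (hl : Lines H n r s) (h0 : 0 < n) {x y : ℕ}
    (hx : x < n) (hy : y < n) :
    s.arr 11 (s.arr 8 (x * n + y)) < n ∧ s.arr 12 (s.arr 8 (x * n + y)) < n ∧
      s.arr 13 (s.arr 8 (x * n + y)) < n := by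
  by_cases h : s.arr 8 (x * n + y) = 0
  · obtain ⟨h1, h2, h3⟩ := hl.zero
    rw [h, h1, h2, h3]
    exact ⟨h0, h0, h0⟩
  · obtain ⟨-, i, i1, i2, e, -, -⟩ := hl.sound x hx y hy h
    rw [e]
    exact IsTriangle.lt hb (hl.triangle i i1 i2)

theorem bad_of_joined (hb : Base H n E s) (hl : Lines H n r s) {i x y z : ℕ} (i1 : 1 ≤ i)
    (i2 : i ≤ r) (hx : Joined H n s (n * i) x z) (hy : Joined H n s (n * i) y z) (hxy : x ≠ y)
    (ha : t.arr 11 = s.arr 11 ∧ t.arr 12 = s.arr 12 ∧ t.arr 13 = s.arr 13)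
    (hr : t.reg 20 = z ∧ t.reg 21 = x ∧ t.reg 22 = y ∧ t.reg 23 = z ∧ t.reg 24 = n * i ∧
      t.reg 25 = s.arr 8 (x * n + z) ∧ t.reg 26 = s.arr 8 (y * n + z)) : Bad H n t := by
  obtain ⟨lx, lz, x1, z1, jx⟩ := hx
  obtain ⟨ly, -, y1, -, jy⟩ := hy
  have ht := hl.triangle i i1 i2
  obtain ⟨g1, g2, g3⟩ := IsTriangle.lt hb ht
  obtain ⟨p1, p2, p3⟩ := hl.triangle_lt hb (by omega) x1 z1
  obtain ⟨q1, q2, q3⟩ := hl.triangle_lt hb (by omega) y1 z1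
  obtain ⟨a1, a2, a3⟩ := ha
  obtain ⟨r0, r1, r2, r3, r4, r5, r6⟩ := hr
  have eg : gathered t = [z, x, y, z, s.arr 11 (n * i), s.arr 12 (n * i), s.arr 13 (n * i),
      s.arr 11 (s.arr 8 (x * n + z)), s.arr 12 (s.arr 8 (x * n + z)),
      s.arr 13 (s.arr 8 (x * n + z)), s.arr 11 (s.arr 8 (y * n + z)),
      s.arr 12 (s.arr 8 (y * n + z)), s.arr 13 (s.arr 8 (y * n + z))] := by
    simp only [gathered, a1, a2, a3, r0, r1, r2, r3, r4, r5, r6]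
  refine ⟨?_, ?_⟩
  · rw [eg]
    simp only [List.mem_cons, List.not_mem_nil, or_false]
    intro u hu
    rcases hu with h | h | h | h | h | h | h | h | h | h | h | h | h <;> rw [h] <;> assumption
  · rw [eg]
    exact not_isProbeDiamondFree_of_two (by simp) (by simp) (by simp) (by simp) (by simp)
      (by simp) ht hxy lx ly (joined_cases hl x1 z1 jx (by simp))
      (joined_cases hl y1 z1 jy (by simp)) lz

theorem wp_twoCell (hb : Base H n E s) (hl : Lines H n r s) (hW : n * n + n * r + n + 6 < W)
    {P : ℕ → ℕ → ℕ → Prop} (hP : TwoInv H n r P s) {i x z : ℕ} (i1 : 1 ≤ i) (i2 : i ≤ r)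
    (hx : LineAt H s (n * i) x) (hz : z < n) (e11 : s.reg 11 = x) (e13 : s.reg 13 = n * i)
    (e15 : s.reg 15 = z) :
    Wp W twoCell s fun t k => k ≤ 28 ∧
      TwoInv H n r (fun i' x' z' => P i' x' z' ∨ i' = i ∧ x' = x ∧ z' = z) t := by
  have x1 := hl.lt hb i1 i2 hx
  have c1 := cell_lt x1 hz
  have le : n * i ≤ n * r := Nat.mul_le_mul_left _ i2
  have hn : 0 < n * i := Nat.mul_pos (by omega) i1
  have code := adjCode_le (H := H) (u := x) (v := z)
  have hLle : s.arr 8 (x * n + z) ≤ n * r := by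
    by_cases h : s.arr 8 (x * n + z) = 0
    · omega
    · obtain ⟨-, i', -, h2, e, -, -⟩ := hl.sound x x1 z hz h
      rw [e]
      exact Nat.mul_le_mul_left _ h2
  have skip : ¬ Joined H n s (n * i) x z → ∀ u R A, Agree R A s u →
      (∀ x ∈ [4, 20, 21, 22, 23, 24, 25, 26], x ∉ R) → (∀ a ∈ [8, 11, 12, 13, 14], a ∉ A) →
      TwoInv H n r (fun i' x' z' => P i' x' z' ∨ i' = i ∧ x' = x ∧ z' = z) u := by
    intro hn u R A ha hR hA
    refine hP.of_agree ha hR hA fun i' x' z' _ _ h => h.imp_right ?_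
    rintro ⟨rfl, rfl, rfl⟩
    exact hn
  have upd : ∀ p q, Agree [17, 18] [] s ((s.setReg 17 p).setReg 18 q) := fun p q =>
    ((Agree.setReg s 17 p).mono (by decide) (by decide)).trans
      ((Agree.setReg _ 18 q).mono (by decide) (by decide))
  rw [twoCell, wp_seq, wp_mget (by decide)]
  simp only [e11, e15, hb.row _ x1, hb.mat _ x1 _ hz]
  refine ⟨by omega, ?_⟩
  rw [wp_cond]
  simp only [Test.holds, State.reg_setReg, Nat.reduceEqDiff, reduceIte, hb.reg8]
  refine ⟨fun h => ?_, fun hc2 => ?_⟩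
  · rw [wp_skip]
    refine ⟨by omega, skip ?_ _ _ _ (Agree.setReg _ _ _) (by decide) (by decide)⟩
    rintro ⟨-, h2, -⟩
    rw [adjCode_eq_two] at h
    exact h2 (h ▸ hx)
  rw [adjCode_eq_two] at hc2
  rw [wp_seq, wp_mget (by decide)]
  simp only [State.reg_setReg, State.arr_setReg, Nat.reduceEqDiff, reduceIte, e11, e15,
    hb.row _ x1]
  refine ⟨by omega, ?_⟩
  rw [wp_cond]
  simp only [Test.holds, State.reg_setReg, Nat.reduceEqDiff, reduceIte, e13]
  refine ⟨fun h => ?_, fun hid => ?_⟩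
  · rw [wp_skip]
    refine ⟨by omega, skip ?_ _ _ _ (upd _ _) (by decide) (by decide)⟩
    rintro ⟨-, h2, -⟩
    obtain ⟨-, i', h3, h4, h5, h6, h7⟩ := hl.sound x x1 z hz (by omega)
    rw [← h5, h] at h7
    exact h2 h7
  -- As `x` is a point of the line and `z ≠ x`, a single entry of the matrix of lines decides
  -- whether `z` is on the line.
  have hzl : ¬ LineAt H s (n * i) z := fun h => hid (hl.full i i1 i2 x z hc2 hx h)
  rw [wp_seq, wp_add]
  simp only [State.reg_setReg, Nat.reduceEqDiff, reduceIte]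
  refine ⟨by omega, ?_⟩
  rw [wp_cond]
  simp only [Test.holds, State.reg_setReg, Nat.reduceEqDiff, reduceIte, hb.reg5]
  refine ⟨fun h => ?_, fun hne => ?_⟩
  · rw [wp_skip]
    refine ⟨by omega, skip ?_ _ [17, 18] [] (((upd _ _).trans
      ((Agree.setReg _ 17 _).mono (by decide) (by decide)))) (by decide) (by decide)⟩
    rintro ⟨-, -, -, -, h2 | h2⟩
    · have := adjCode_eq_one.2 h2
      omega
    · omega
  have hj : Joined H n s (n * i) x z := by
    refine ⟨hx, hzl, x1, hz, ?_⟩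
    by_cases h : s.arr 8 (x * n + z) = 0
    · have : adjCode H x z ≠ 2 := fun h => hc2 (adjCode_eq_two.1 h)
      exact .inl (adjCode_eq_one.1 (by omega))
    · exact .inr h
  simp only [wp_seq, wp_add, wp_load]
  simp only [State.reg_setReg, State.arr_setReg, Nat.reduceEqDiff, reduceIte, e13, e15]
  refine ⟨by omega, ?_⟩
  simp only [wp_cond, Test.holds, State.reg_setReg, Nat.reduceEqDiff, reduceIte, hb.reg5, wp_seq,
    wp_add, wp_store, wp_sub, wp_skip, e11, hb.reg2]
  set u := ((((s.setReg 17 (adjCode H x z)).setReg 18 (s.arr 8 (x * n + z))).setReg 17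
    (adjCode H x z + s.arr 8 (x * n + z))).setReg 17 (n * i + z)).setReg 18
      (s.arr 14 (n * i + z)) with hu
  have hau : Agree [17, 18] [] s u :=
    (((upd _ _).trans ((Agree.setReg _ 17 _).mono (by decide) (by decide))).trans
      ((Agree.setReg _ 17 _).mono (by decide) (by decide))).trans
      ((Agree.setReg _ 18 _).mono (by decide) (by decide))
  obtain ⟨hs, hd⟩ := hP
  refine ⟨fun h0 => ⟨by omega, by omega, ?_⟩, fun h0 => ⟨fun hx1 => ⟨by omega, ?_⟩,
    fun hx1 => ?_⟩⟩
  · set p := (u.setReg 18 (x + 1)).setArr 14 (n * i + z) (x + 1) with hp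
    have hap : Agree [17, 18] [14] s p :=
      ((hau.mono (by decide) (by decide)).trans ((Agree.setReg u 18 _).mono (by decide)
        (by decide))).trans ((Agree.setArr _ 14 _ _).mono (by decide) (by decide))
    have hjp : ∀ {id x z}, Joined H n p id x z ↔ Joined H n s id x z :=
      joined_congr (hap.2 8 (by decide)) (hap.2 11 (by decide)) (hap.2 12 (by decide))
        (hap.2 13 (by decide))
    have p14 : ∀ c, p.arr 14 c = if c = n * i + z then x + 1 else s.arr 14 c := by
      intro c
      simp [hp, hu]
    have inj : ∀ i' z', z' < n → (n * i' + z' = n * i + z ↔ i' = i ∧ z' = z) := by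
      intro i' z' hz'
      rw [Nat.mul_comm n i', Nat.mul_comm n i]
      exact cell_inj hz' hz
    refine ⟨?_, hd.imp ?_ ?_⟩
    · intro i' h1 h2 z' hz' h3
      rw [hjp]
      rw [p14] at h3 ⊢
      split_ifs at h3 ⊢ with h
      · obtain ⟨rfl, rfl⟩ := (inj i' z' hz').1 h
        exact hj
      · exact hs i' h1 h2 z' hz' h3
    · rintro ⟨h4, hd⟩
      refine ⟨(hap.1 4 (by decide)).trans h4, fun i' h1 h2 x' z' h3 h5 => ?_⟩
      rw [hjp] at h5
      rw [p14]
      split_ifs with h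
      · obtain ⟨rfl, rfl⟩ := (inj i' z' h5.2.2.2.1).1 h
        rcases h3 with h3 | ⟨-, rfl, -⟩
        · have := hd i' h1 h2 x' z' h3 h5
          omega
        · rfl
      · rcases h3 with h3 | ⟨rfl, rfl, rfl⟩
        · exact hd i' h1 h2 x' z' h3 h5
        · exact absurd rfl h
    · rintro ⟨h4, hd⟩
      exact ⟨(hap.1 4 (by decide)).trans h4, hd.of_agree hap (by decide) (by decide)⟩
  · have hap : Agree [17, 18] [] s (u.setReg 18 (s.arr 14 (n * i + z) - 1)) :=
      hau.trans ((Agree.setReg u 18 _).mono (by decide) (by decide))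
    have hP' : TwoInv H n r (fun i' x' z' => P i' x' z' ∨ i' = i ∧ x' = x ∧ z' = z) s := by
      refine ⟨hs, hd.imp_left ?_⟩
      rintro ⟨h4, hd⟩
      refine ⟨h4, ?_⟩
      rintro i' h1 h2 x' z' (h3 | ⟨rfl, rfl, rfl⟩) h5
      · exact hd i' h1 h2 x' z' h3 h5
      · omega
    exact hP'.of_agree hap (by decide) (by decide) fun i x z _ _ h => .inl h
  · have hjy := hs i i1 i2 z hz h0
    set y := s.arr 14 (n * i + z) - 1 with hy
    have y1 := hjy.2.2.1
    have c2 := cell_lt y1 hz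
    have W0 : 1 < W := by omega
    simp [recordTwo, wp_seq, wp_mget, wp_const, wp_move, hu, e11, e13, e15, hb.row _ x1,
      hb.row _ y1, W0]
    refine ⟨by omega, by omega, ?_⟩
    set p : State := _ with hp
    change TwoInv H n r _ p
    have hap : Agree [4, 17, 18, 20, 21, 22, 23, 24, 25, 26] [] s p := by
      refine ⟨fun x hx => ?_, fun _ _ => rfl⟩
      simp only [List.mem_cons, List.not_mem_nil, or_false, not_or] at hx
      simp [hp, hx]
    have hjp : ∀ {id x z}, Joined H n p id x z ↔ Joined H n s id x z :=
      joined_congr rfl rfl rfl rfl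
    refine ⟨fun i' h1 h2 z' hz' h3 => hjp.2 (hs i' h1 h2 z' hz' h3), .inr ⟨by simp [hp], ?_⟩⟩
    refine bad_of_joined hb hl i1 i2 hj hjy (Ne.symm hx1) ⟨rfl, rfl, rfl⟩ ?_
    simp [hp]

/-- No vertex off a line is joined to two of its points. -/
def NoTwo (H : SimpleGraph ℕ) (n r : ℕ) (s : State) : Prop :=
  ∀ i, 1 ≤ i → i ≤ r → ∀ x y z, Joined H n s (n * i) x z → Joined H n s (n * i) y z → x = y

/-- Each dart on a line makes its source a processed point of that line. Since every point of a line
is the source of such a dart, no point is missed. -/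
theorem wp_twoProg (hb : Base H n E s) (hl : Lines H n r s) (hW : n * n + n * r + n + E + 6 < W)
    (e4 : s.reg 4 = 0) (e14 : ∀ c, s.arr 14 c = 0) :
    Wp W twoProg s fun t k => k ≤ 42 * (n + 1) * E + 2 ∧
      (t.reg 4 = 0 ∧ NoTwo H n r t ∨ t.reg 4 = 1 ∧ Bad H n t) := by
  refine wp_for E (fun j t k => k ≤ 42 * (n + 1) * j + 1 ∧ TwoInv H n r (fun i x _ => ∃ e < j,
      s.arr 6 e = x ∧ s.arr 8 (x * n + s.arr 1 e) = n * i) t)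
      (by omega) hb.reg3 hb.reg2 (by decide) ?_ ?_ ?_
  · refine ⟨by omega, ?_, .inl ⟨by simpa using e4, ?_⟩⟩
    · intro i _ _ z _ h
      exact absurd (e14 _) h
    · rintro i _ _ x z ⟨e, he, -⟩
      omega
  · rintro j hj t k ⟨hk, hI⟩ hi ha
    have hb' := hb.of_agree ha (by decide) (by decide)
    have hl' := hl.of_agree ha (by decide) (by decide)
    have a6 : t.arr 6 = s.arr 6 := ha.2 6 (by decide)
    have a1 : t.arr 1 = s.arr 1 := ha.2 1 (by decide)
    have a8 : t.arr 8 = s.arr 8 := ha.2 8 (by decide)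
    have had := hb.dart j hj
    obtain ⟨b1, b2⟩ := hb.bound _ _ had
    have cell := cell_lt b1 b2
    have e1 : 42 * (n + 1) * (j + 1) = 42 * (n + 1) * j + 42 * n + 42 := by ring
    simp only [wp_seq, wp_load, hi]
    rw [wp_mget (by decide)]
    simp only [State.reg_setReg, State.arr_setReg, hi, Nat.reduceEqDiff, reduceIte, a6, a1, a8,
      hb'.row _ b1]
    refine ⟨by omega, ?_⟩
    rw [wp_cond]
    simp only [Test.holds, State.reg_setReg, Nat.reduceEqDiff, reduceIte, hb'.reg5]
    set u := ((t.setReg 11 (s.arr 6 j)).setReg 12 (s.arr 1 j)).setReg 13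
      (s.arr 8 (s.arr 6 j * n + s.arr 1 j)) with hu
    have hau : Agree [11, 12, 13] [] t u :=
      (((Agree.setReg t 11 _).mono (by decide) (by decide)).trans
        ((Agree.setReg _ 12 _).mono (by decide) (by decide))).trans
        ((Agree.setReg _ 13 _).mono (by decide) (by decide))
    have hau10 : ∀ u : State, Agree [10] [] u (u.setReg 10 (j + 1)) := fun u =>
      Agree.setReg _ _ _
    refine ⟨fun h0 => ?_, fun h0 => ?_⟩
    · rw [wp_skip]
      refine ⟨by omega, (hI.of_agree hau (by decide) (by decide)
        fun i x z i1 i2 h => .inl ?_).of_agree (hau10 u) (by decide) (by decide) fun i x z _ _ h => .inl h⟩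
      obtain ⟨e, he, h1, h2⟩ := h
      have : 0 < n * i := Nat.mul_pos (by omega) i1
      refine ⟨e, ?_, h1, h2⟩
      by_contra hne
      obtain rfl : e = j := by omega
      rw [← h1, h0] at h2
      omega
    · obtain ⟨-, i, i1, i2, ei, lx, -⟩ := hl'.sound _ b1 _ b2 (by rw [a8]; exact h0)
      rw [a8] at ei
      have hbu := hb'.of_agree hau (by decide) (by decide)
      have hlu := hl'.of_agree hau (by decide) (by decide)
      refine (wp_for (s := u) (Q := fun p k => k ≤ 30 * n + 2 ∧ TwoInv H n r (fun i' x z =>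
          (∃ e < j, s.arr 6 e = x ∧ s.arr 8 (x * n + s.arr 1 e) = n * i') ∨
            i' = i ∧ x = s.arr 6 j ∧ z < n) p) n (fun m p k => k ≤ 30 * m + 1 ∧
        TwoInv H n r (fun i' x z =>
          (∃ e < j, s.arr 6 e = x ∧ s.arr 8 (x * n + s.arr 1 e) = n * i') ∨ i' = i ∧ x = s.arr 6 j ∧ z < m) p) (by omega) hbu.reg0 hbu.reg2 (by decide)
        ?_ ?_ fun p k h _ _ => ⟨by omega, h.2⟩).mono ?_
      · refine ⟨by omega, (hI.of_agree hau (by decide) (by decide)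
          fun _ _ _ _ _ h => .inl h).of_agree (Agree.setReg u 15 0) (by decide) (by decide) ?_⟩
        rintro i' x z _ _ (h | ⟨-, -, h⟩)
        · exact .inl h
        · omega
      · rintro m hm p k' ⟨hk', hp⟩ hpi hap
        have hbp := hbu.of_agree hap (by decide) (by decide)
        have hlp := hlu.of_agree hap (by decide) (by decide)
        have p11 : p.arr 11 = t.arr 11 := (hap.2 11 (by decide)).trans (hau.2 11 (by decide))
        have p12 : p.arr 12 = t.arr 12 := (hap.2 12 (by decide)).trans (hau.2 12 (by decide))
        have p13 : p.arr 13 = t.arr 13 := (hap.2 13 (by decide)).trans (hau.2 13 (by decide))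
        have hw : n * n + n * r + n + 6 < W := by omega
        have lp : LineAt H p (n * i) (s.arr 6 j) := by
          rw [LineAt, p11, p12, p13]
          exact lx
        refine (wp_twoCell hbp hlp hw hp i1 i2 lp hm
          ((hap.1 11 (by decide)).trans (by simp [hu]))
          ((hap.1 13 (by decide)).trans (by simp [hu, ei])) hpi).mono ?_
        rintro q l ⟨hl2, hq⟩
        refine ⟨by omega, hq.of_agree (Agree.setReg q 15 (m + 1)) (by decide) (by decide) ?_⟩
        rintro i' x z _ _ (h | ⟨h1, h2, h3⟩)
        · exact .inl (.inl (.inl h))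
        · by_cases h : z = m
          · exact .inl (.inr ⟨h1, h2, h⟩)
          · exact .inl (.inl (.inr ⟨h1, h2, by omega⟩))
      · rintro p l ⟨hl2, hp⟩
        refine ⟨by omega, hp.of_agree (hau10 p) (by decide) (by decide) ?_⟩
        rintro i' x z _ _ ⟨e, he, h1, h2⟩
        by_cases hej : e = j
        · subst hej
          by_cases hz : z < n
          · refine .inl (.inr ⟨?_, h1.symm, hz⟩)
            rw [← h1, ei] at h2
            exact (Nat.eq_of_mul_eq_mul_left (by omega) h2).symm
          · exact .inr fun h => hz h.2.2.2.1
        · exact .inl (.inl ⟨e, by omega, h1, h2⟩)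
  · rintro t k ⟨hk, hs, hd⟩ hi ha
    refine ⟨by omega, hd.imp_left ?_⟩
    rintro ⟨h4, hd⟩
    refine ⟨h4, fun i i1 i2 x y z hx hy => ?_⟩
    have hj : ∀ {id x z}, Joined H n t id x z ↔ Joined H n s id x z :=
      joined_congr (ha.2 8 (by decide)) (ha.2 11 (by decide)) (ha.2 12 (by decide))
        (ha.2 13 (by decide))
    obtain ⟨f, hf⟩ := exists_dart_onLine hb (hl.triangle i i1 i2)
    -- One cell holds one value, so two joined points of the same line must coincide.
    have key : ∀ x, Joined H n t (n * i) x z → t.arr 14 (n * i + z) = x + 1 := by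
      intro x hx
      obtain ⟨f1, f2, f3⟩ := hf x (hj.1 hx).1
      have hne := (hb.dart _ f1).ne
      rw [f2] at hne
      exact hd i i1 i2 x z ⟨f x, f1, f2, hl.full i i1 i2 _ _ hne (hj.1 hx).1 f3⟩ hx
    have := key x hx
    have := key y hy
    omega

/-- The nonadjacent pairs of different points of a line. -/
def NewPair (H : SimpleGraph ℕ) (n : ℕ) (s : State) (u v : ℕ) : Prop :=
  adjCode H u v = 0 ∧ s.arr 8 (u * n + v) ≠ 0

/-- The memory contains a list of the pairs in `S`, of length at most `m`. -/
def Fill (S : ℕ → ℕ → Prop) (m : ℕ) (t : State) : Prop :=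
  (∃ l : List (ℕ × ℕ), t.reg 7 = l.length ∧ l.length ≤ m ∧
    (∀ (i : ℕ) (hi : i < l.length), t.arr 3 i = l[i].1 ∧ t.arr 4 i = l[i].2) ∧
    ∀ u v, (u, v) ∈ l ↔ S u v) ∧
  ∀ v, t.arr 2 v = 0 ∧ (∀ w, ¬ S v w) ∨ t.arr 2 v = 1 ∧ S v (t.arr 10 v)

theorem Fill.of_agree {S S' : ℕ → ℕ → Prop} {m m' : ℕ} {R A : List ℕ} (h : Fill S m s)
    (ha : Agree R A s t) (hR : 7 ∉ R) (hA : ∀ a ∈ [2, 3, 4, 10], a ∉ A)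
    (hS : ∀ u v, S u v ↔ S' u v) (hm : m ≤ m') : Fill S' m' t := by
  obtain rfl : S = S' := by
    ext u v
    exact hS u v
  obtain ⟨⟨l, h1, h2, h3⟩, h4⟩ := h
  rw [Fill, ha.1 7 hR, ha.2 2 (hA 2 (by simp)), ha.2 3 (hA 3 (by simp)), ha.2 4 (hA 4 (by simp)),
    ha.2 10 (hA 10 (by simp))]
  exact ⟨⟨l, h1, h2.trans hm, h3⟩, h4⟩

theorem wp_fillCell (hb : Base H n E s) {m x z : ℕ} (hW : n * n + m + 6 < W)
    {S : ℕ → ℕ → Prop} (hS : Fill S m s) (hx : x < n) (hz : z < n) (e11 : s.reg 11 = x)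
    (e15 : s.reg 15 = z) :
    Wp W fillCell s fun t k => k ≤ 14 ∧
      Fill (fun u v => S u v ∨ u = x ∧ v = z ∧ NewPair H n s u v) (m + 1) t := by
  have c1 := cell_lt hx hz
  have skip : ¬ NewPair H n s x z → ∀ u R, Agree R [] s u → 7 ∉ R →
      Fill (fun u v => S u v ∨ u = x ∧ v = z ∧ NewPair H n s u v) (m + 1) u := by
    intro hn u R ha hR
    refine hS.of_agree ha hR (by simp) (fun u v => (or_iff_left ?_).symm) (by omega)
    rintro ⟨rfl, rfl, h⟩
    exact hn h
  rw [fillCell, wp_seq, wp_mget (by decide)]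
  simp only [e11, e15, hb.row _ hx, hb.mat _ hx _ hz]
  refine ⟨by omega, ?_⟩
  rw [wp_cond]
  simp only [Test.holds, State.reg_setReg, Nat.reduceEqDiff, reduceIte, hb.reg5]
  refine ⟨fun h0 => ?_, fun h0 => ?_⟩
  swap
  · rw [wp_skip]
    exact ⟨by omega, skip (fun h => h0 h.1) _ [17] (Agree.setReg s 17 _) (by decide)⟩
  rw [wp_seq, wp_mget (by decide)]
  simp only [State.reg_setReg, State.arr_setReg, Nat.reduceEqDiff, reduceIte, e11, e15,
    hb.row _ hx]
  refine ⟨by omega, ?_⟩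
  rw [wp_cond]
  simp only [Test.holds, State.reg_setReg, Nat.reduceEqDiff, reduceIte, hb.reg5]
  refine ⟨fun h1 => ?_, fun h1 => ?_⟩
  · rw [wp_skip]
    exact ⟨by omega, skip (fun h => h.2 h1) _ [17, 18]
      (((Agree.setReg s 17 _).mono (by decide) (by decide)).trans
        ((Agree.setReg _ 18 _).mono (by decide) (by decide))) (by decide)⟩
  obtain ⟨⟨l, l1, l2, l3, l4⟩, h2⟩ := hS
  simp only [wp_seq, wp_store, wp_add]
  simp [e11, e15, hb.reg2, l1]
  refine ⟨by omega, ⟨l ++ [(x, z)], by simp, by simpa using l2, ?_, ?_⟩, ?_⟩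
  · intro i hi
    simp only [List.length_append, List.length_cons, List.length_nil] at hi
    by_cases hil : i = l.length
    · subst hil
      simp
    · have := l3 i (by omega)
      simp [hil, this, List.getElem_append_left (show i < l.length by omega)]
  · intro u v
    rw [List.mem_append, l4, List.mem_singleton, Prod.mk.injEq]
    refine or_congr_right ⟨fun ⟨h3, h4⟩ => ⟨h3, h4, ?_⟩, fun h => ⟨h.1, h.2.1⟩⟩
    rw [h3, h4]
    exact ⟨h0, h1⟩
  · intro v
    by_cases hv : v = x
    · subst hv
      right
      simp
      exact .inr ⟨h0, h1⟩
    · simp only [hv, State.arr_setArr, false_and, and_false, or_false, Nat.reduceEqDiff, if_false,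
        State.arr_setReg]
      exact h2 v

theorem wp_fillProg (hb : Base H n E s) (hW : n * n + n * E + n + E + 6 < W) (e7 : s.reg 7 = 0)
    (e2 : ∀ c, s.arr 2 c = 0) :
    Wp W fillProg s fun t k => k ≤ 21 * (n + 1) * E + 2 ∧
      Fill (fun u v => v < n ∧ (∃ e < E, s.arr 6 e = u) ∧ NewPair H n s u v) (n * E) t := by
  refine wp_for E (fun j t k => k ≤ 21 * (n + 1) * j + 1 ∧
      Fill (fun u v => v < n ∧ (∃ e < j, s.arr 6 e = u) ∧ NewPair H n s u v) (n * j) t)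
      (by omega) hb.reg3 hb.reg2 (by decide) ?_ ?_ fun t k h _ _ => ⟨by omega, h.2⟩
  · refine ⟨by omega, ⟨[], by simpa using e7, by simp, by simp, fun u v => ?_⟩,
      fun v => .inl ⟨e2 v, fun w => ?_⟩⟩
    · simp
    · simp
  · rintro j hj t k ⟨hk, hI⟩ hi ha
    have hb' := hb.of_agree ha (by decide) (by decide)
    have a6 : t.arr 6 = s.arr 6 := ha.2 6 (by decide)
    have a8 : t.arr 8 = s.arr 8 := ha.2 8 (by decide)
    have b1 := (hb.bound _ _ (hb.dart j hj)).1
    have e1 : 21 * (n + 1) * (j + 1) = 21 * (n + 1) * j + 21 * n + 21 := by ring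
    have e3 : n * (j + 1) = n * j + n := by ring
    have e4 : n * (j + 1) ≤ n * E := Nat.mul_le_mul_left _ (by omega)
    rw [wp_seq, wp_load]
    simp only [hi, a6]
    set u := t.setReg 11 (s.arr 6 j) with hu
    have hau : Agree [11] [] t u := Agree.setReg _ _ _
    have hbu := hb'.of_agree hau (by decide) (by decide)
    refine (wp_for (s := u) (Q := fun p k => k ≤ 16 * n + 2 ∧
        Fill (fun u v => v < n ∧ (∃ e < j, s.arr 6 e = u) ∧ NewPair H n s u v ∨
          u = s.arr 6 j ∧ v < n ∧ NewPair H n s u v) (n * j + n) p) n (fun m p k => k ≤ 16 * m + 1 ∧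
        Fill (fun u v => v < n ∧ (∃ e < j, s.arr 6 e = u) ∧ NewPair H n s u v ∨
          u = s.arr 6 j ∧ v < m ∧ NewPair H n s u v) (n * j + m) p)
        (by omega) hbu.reg0 hbu.reg2 (by decide) ?_ ?_
        fun p k h _ _ => ⟨by omega, h.2⟩).mono ?_
    · refine ⟨by omega, (hI.of_agree hau (by decide) (by decide) (fun _ _ => Iff.rfl)
        le_rfl).of_agree (Agree.setReg u 15 0) (by decide) (by decide) (fun u v => ?_) le_rfl⟩
      refine (or_iff_left ?_).symm
      rintro ⟨-, h, -⟩
      omega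
    · rintro m hm p k' ⟨hk', hp⟩ hpi hap
      have hbp := hbu.of_agree hap (by decide) (by decide)
      have p8 : p.arr 8 = s.arr 8 := (hap.2 8 (by decide)).trans a8
      refine (wp_fillCell hbp (by omega) hp b1 hm ((hap.1 11 (by decide)).trans (by simp [hu]))
        hpi).mono ?_
      rintro q l ⟨hl2, hq⟩
      refine ⟨by omega, hq.of_agree (Agree.setReg q 15 (m + 1)) (by decide) (by decide)
        (fun u v => ?_) (by omega)⟩
      rw [or_assoc]
      refine or_congr_right ?_
      rw [NewPair, NewPair, p8]
      constructor
      · rintro (⟨h1, h2, h3⟩ | ⟨h1, h2, h3⟩)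
        · exact ⟨h1, by omega, h3⟩
        · exact ⟨h1, by omega, h3⟩
      · rintro ⟨h1, h2, h3⟩
        by_cases h : v = m
        · exact .inr ⟨h1, h, h3⟩
        · exact .inl ⟨h1, by omega, h3⟩
    · rintro p l ⟨hl2, hp⟩
      refine ⟨by omega, hp.of_agree (Agree.setReg p 10 (j + 1)) (by decide) (by decide)
        (fun u v => ?_) (by omega)⟩
      constructor
      · rintro (⟨h1, ⟨e, h2, h3⟩, h4⟩ | ⟨h1, h2, h3⟩)
        · exact ⟨h1, ⟨e, by omega, h3⟩, h4⟩
        · exact ⟨h2, ⟨j, by omega, h1.symm⟩, h3⟩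
      · rintro ⟨h1, ⟨e, h2, h3⟩, h4⟩
        by_cases h : e = j
        · exact .inr ⟨by rw [← h3, h], h1, h4⟩
        · exact .inl ⟨h1, ⟨e, by omega, h3⟩, h4⟩

theorem bad_of_adj (hb : Base H n E s) (hl : Lines H n r s) {x y x' y' : ℕ} (hxx : H.Adj x x')
    (hy : y < n) (hy' : y' < n) (h : NewPair H n s x y) (h' : NewPair H n s x' y')
    (ha : t.arr 11 = s.arr 11 ∧ t.arr 12 = s.arr 12 ∧ t.arr 13 = s.arr 13)
    (hr : t.reg 20 = x ∧ t.reg 21 = x' ∧ t.reg 22 = y ∧ t.reg 23 = y' ∧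
      t.reg 24 = s.arr 8 (x * n + y) ∧ t.reg 25 = s.arr 8 (x' * n + y') ∧
      t.reg 26 = s.arr 8 (x * n + y)) : Bad H n t := by
  obtain ⟨hx, hx'⟩ := hb.bound _ _ hxx
  obtain ⟨ne, i, i1, i2, ei, lx, ly⟩ := hl.sound x hx y hy h.2
  obtain ⟨ne', i', i1', i2', ei', lx', ly'⟩ := hl.sound x' hx' y' hy' h'.2
  have ht := hl.triangle i i1 i2
  have ht' := hl.triangle i' i1' i2'
  obtain ⟨g1, g2, g3⟩ := IsTriangle.lt hb ht
  obtain ⟨p1, p2, p3⟩ := IsTriangle.lt hb ht'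
  obtain ⟨a1, a2, a3⟩ := ha
  obtain ⟨r0, r1, r2, r3, r4, r5, r6⟩ := hr
  have eg : gathered t = [x, x', y, y', s.arr 11 (n * i), s.arr 12 (n * i), s.arr 13 (n * i),
      s.arr 11 (n * i'), s.arr 12 (n * i'), s.arr 13 (n * i'), s.arr 11 (n * i),
      s.arr 12 (n * i), s.arr 13 (n * i)] := by
    simp only [gathered, a1, a2, a3, r0, r1, r2, r3, r4, r5, r6, ei, ei']
  have nadj : ∀ {u v}, NewPair H n s u v → ¬ H.Adj u v := fun h h1 => by
    have := adjCode_eq_one.2 h1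
    have := h.1
    omega
  refine ⟨?_, ?_⟩
  · rw [eg]
    simp only [List.mem_cons, List.not_mem_nil, or_false]
    intro u hu
    rcases hu with h | h | h | h | h | h | h | h | h | h | h | h | h <;> rw [h] <;> assumption
  · rw [eg]
    exact not_isProbeDiamondFree_of_tips (x := x) (y := y) (x' := x') (y' := y') (by simp)
      (by simp) (by simp) (by simp)
      ⟨ne, _, _, _, by simp, by simp, by simp, ht, lx, ly⟩
      ⟨ne', _, _, _, by simp, by simp, by simp, ht', lx', ly'⟩ (nadj h) (nadj h') hxx

/-- This pass also runs after a failure of the preceding search. A failure recorded earlier stays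
valid unless it is overwritten by another valid one. -/
theorem wp_indepProg (hb : Base H n E s) (hl : Lines H n r s) (hW : n * n + E + n + 6 < W)
    (h4 : s.reg 4 = 0 ∨ s.reg 4 = 1 ∧ Bad H n s)
    (h2 : ∀ x, s.arr 2 x = 1 → s.arr 10 x < n ∧ NewPair H n s x (s.arr 10 x)) :
    Wp W indepProg s fun t k => k ≤ 22 * E + 2 ∧
      (t.reg 4 = 0 ∧ s.reg 4 = 0 ∧ (∀ u v, H.Adj u v → s.arr 2 u = 1 → s.arr 2 v ≠ 1) ∨
        t.reg 4 = 1 ∧ Bad H n t) := by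
  refine wp_for E (fun j t k => k ≤ 22 * j + 1 ∧
      (t.reg 4 = 0 ∧ s.reg 4 = 0 ∧
          (∀ e < j, s.arr 2 (s.arr 6 e) = 1 → s.arr 2 (s.arr 1 e) ≠ 1) ∨
        t.reg 4 = 1 ∧ Bad H n t))
      (by omega) hb.reg3 hb.reg2 (by decide) ?_ ?_ ?_
  · refine ⟨by omega, h4.imp (fun h => ⟨by simpa using h, h, by simp⟩) fun h => ⟨by simpa using h.1,
      h.2.of_agree (Agree.setReg s 10 0) (by decide) (by decide)⟩⟩
  · rintro j hj t k ⟨hk, hI⟩ hi ha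
    have hb' := hb.of_agree ha (by decide) (by decide)
    have arrs : t.arr = s.arr := funext fun a => ha.2 a (by simp [recordAdjacent, mget, Prog.arrs])
    have had := hb.dart j hj
    obtain ⟨b1, b2⟩ := hb.bound _ _ had
    have skip : (s.arr 2 (s.arr 6 j) = 1 → s.arr 2 (s.arr 1 j) ≠ 1) →
        ∀ u, Agree [10, 11, 12, 17, 18] [] t u →
        (t.reg 4 = 0 ∧ s.reg 4 = 0 ∧
          (∀ e < j + 1, s.arr 2 (s.arr 6 e) = 1 → s.arr 2 (s.arr 1 e) ≠ 1) ∨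
        t.reg 4 = 1 ∧ Bad H n u) := by
      intro hn u hau
      refine hI.imp ?_ ?_
      · rintro ⟨h5, h6, h7⟩
        refine ⟨h5, h6, fun e he => ?_⟩
        by_cases hej : e = j
        · rw [hej]
          exact hn
        · exact h7 e (by omega)
      · rintro ⟨h5, h6⟩
        exact ⟨h5, h6.of_agree hau (by decide) (by decide)⟩
    simp only [wp_seq, wp_load, wp_cond, wp_skip]
    simp only [State.reg_setReg, State.arr_setReg, hi, Nat.reduceEqDiff, reduceIte, arrs,
      Test.holds, hb'.reg2]
    set u := (((t.setReg 11 (s.arr 6 j)).setReg 12 (s.arr 1 j)).setReg 17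
      (s.arr 2 (s.arr 6 j))).setReg 18 (s.arr 2 (s.arr 1 j)) with hu
    have hau : Agree [10, 11, 12, 17, 18] [] t (u.setReg 10 (j + 1)) := by
      refine ⟨fun x hx => ?_, fun _ _ => rfl⟩
      simp only [List.mem_cons, List.not_mem_nil, or_false, not_or] at hx
      simp [hu, hx]
    refine ⟨fun h5 => ⟨fun h6 => ?_, fun h6 => ⟨by omega, skip (fun _ => h6) _ hau⟩⟩, fun h5 =>
      ⟨by omega, skip (fun h => absurd h h5) _ hau⟩⟩
    obtain ⟨w1, w2⟩ := h2 _ h5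
    obtain ⟨w3, w4⟩ := h2 _ h6
    have c1 := cell_lt b1 w1
    have c2 := cell_lt b2 w3
    have W0 : 1 < W := by omega
    simp [recordAdjacent, wp_seq, wp_mget, wp_const, wp_move, wp_load, hu, hb'.row _ b1,
      hb'.row _ b2, W0, arrs]
    refine ⟨by omega, by omega, by omega, ?_⟩
    refine bad_of_adj hb hl had w1 w3 w2 w4 (by simp [arrs]) ?_
    simp
  · rintro t k ⟨hk, hI⟩ hi ha
    refine ⟨by omega, hI.imp_left ?_⟩
    rintro ⟨h5, h6, h7⟩
    refine ⟨h5, h6, fun u v huv => ?_⟩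
    obtain ⟨e, he, rfl, rfl⟩ := hb.surj u v huv
    exact h7 e he

end
end Ram

/-! ### Finding an obstruction among the recorded vertices. -/

namespace Ram

section
variable {H : SimpleGraph ℕ} {W n E : ℕ} {s t : State} {Q : State → Prop}

/-- The vertices in the registers from `30` on are in the adjacency relation given by the list. -/
def Matches (H : SimpleGraph ℕ) (x : ℕ → ℕ) (l : List (ℕ × ℕ × Bool)) : Prop :=
  ∀ p ∈ l, adjCode H (x p.1) (x p.2.1) = if p.2.2 then 1 else 0

theorem wp_ifMatches {x : ℕ → ℕ} (hx : ∀ i < 13, x i < n) (hW : n * n + n < W) {c : Prog} {B : ℕ}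
    (l : List (ℕ × ℕ × Bool)) (hl : ∀ p ∈ l, p.1 < 13 ∧ p.2.1 < 13) :
    ∀ s : State, Base H n E s → (∀ i < 13, s.reg (30 + i) = x i) →
      (Matches H x l → ∀ u, Agree [17] [] s u → Wp W c u fun t k => k ≤ B ∧ Q t) →
      (¬ Matches H x l → ∀ u, Agree [17] [] s u → Q u) →
      Wp W (ifMatches l c) s fun t k => k ≤ B + 4 * l.length + 1 ∧ Q t := by
  induction l with
  | nil =>
    intro s hb hs h1 h2
    refine (h1 (by simp [Matches]) s (.refl _ _ _)).mono ?_
    rintro t k ⟨h3, h4⟩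
    exact ⟨by omega, h4⟩
  | cons p l ih =>
    obtain ⟨i, j, b⟩ := p
    intro s hb hs h1 h2
    obtain ⟨hi, hj⟩ := hl (i, j, b) (by simp)
    simp only at hi hj
    rw [ifMatches, wp_seq, wp_mget (by omega), hs i hi, hs j hj, hb.row _ (hx i hi),
      hb.mat _ (hx i hi) _ (hx j hj)]
    have := cell_lt (hx i hi) (hx j hj)
    refine ⟨by omega, ?_⟩
    rw [wp_cond]
    have hag := Agree.setReg s 17 (adjCode H (x i) (x j))
    have e : (s.setReg 17 (adjCode H (x i) (x j))).reg (if b = true then 2 else 5) =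
        if b = true then 1 else 0 := by
      cases b <;> simp [hb.reg2, hb.reg5]
    simp only [Test.holds, e]
    simp only [State.reg_setReg, reduceIte]
    have cons : Matches H x ((i, j, b) :: l) ↔
        adjCode H (x i) (x j) = (if b = true then 1 else 0) ∧ Matches H x l := by
      simp only [Matches, List.forall_mem_cons]
    refine ⟨fun h => ?_, fun h => ?_⟩
    · refine (ih (fun p hp => hl p (List.mem_cons_of_mem _ hp)) _
        (hb.of_agree hag (by decide) (by decide)) ?_ ?_ ?_).mono ?_
      · intro i hi
        rw [hag.1 _ (by simp; omega), hs i hi]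
      · intro hm u hu
        exact h1 (cons.2 ⟨h, hm⟩) u (hag.trans hu)
      · intro hm u hu
        exact h2 (fun h => hm (cons.1 h).2) u (hag.trans hu)
      · rintro t k ⟨h3, h4⟩
        simp only [List.length_cons]
        exact ⟨by omega, h4⟩
    · rw [wp_skip]
      simp only [List.length_cons]
      exact ⟨by omega, h2 (fun h' => h (cons.1 h').1) _ hag⟩

theorem wp_writeVertices (l : List ℕ) (hl : ∀ i ∈ l, i < 13) :
    ∀ (k : ℕ) (s : State), k + l.length < W →
      Wp W (writeVertices k l) s fun t m => m ≤ 2 * l.length + 1 ∧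
        (∀ i (hi : i < l.length), t.arr 2 (k + i) = s.reg (30 + l[i])) ∧
        ∀ i < k, t.arr 2 i = s.arr 2 i := by
  induction l with
  | nil =>
    intro k s hk
    rw [writeVertices, wp_skip]
    exact ⟨by simp, by simp, fun _ _ => rfl⟩
  | cons a l ih =>
    intro k s hk
    simp only [List.length_cons] at hk
    rw [writeVertices, wp_seq, wp_const]
    refine ⟨by omega, ?_⟩
    rw [wp_seq, wp_store]
    refine (ih (fun i hi => hl i (List.mem_cons_of_mem _ hi)) (k + 1) _ (by omega)).mono ?_
    rintro t m ⟨h1, h2, h3⟩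
    refine ⟨by simp only [List.length_cons]; omega, ?_, ?_⟩
    · rintro (_ | i) hi
      · rw [Nat.add_zero, h3 k (by omega)]
        simp
        omega
      · have := h2 i (by simpa using hi)
        rw [show k + (i + 1) = k + 1 + i by omega, this]
        simp
        omega
    · intro i hi
      rw [h3 i (by omega)]
      simp
      omega

/-- A number of steps that suffices to test a list of placements. -/
def tryCost (l : List (ℕ × List ℕ)) : ℕ :=
  (l.map fun p => 4 * (matchList p.1 p.2).length + 2 * p.2.length + 3).sum + 1

/-- The memory contains the answer that one of the placements in `l` yields. -/
def Found (H : SimpleGraph ℕ) (x : ℕ → ℕ) (l : List (ℕ × List ℕ)) (t : State) : Prop :=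
  ∃ p ∈ l, Matches H x (matchList p.1 p.2) ∧ t.reg 1 = p.1 ∧
    ∀ i (hi : i < p.2.length), t.arr 2 i = x p.2[i]

theorem mem_matchList {ind i j : ℕ} {q : List ℕ} (hij : i < j) (hj : j < q.length) :
    (q[i], q[j], obsAdj ind i j) ∈ matchList ind q := by
  simp only [matchList, List.mem_flatMap, List.mem_range, List.mem_map, Prod.mk.injEq]
  refine ⟨j, hj, i, hij, ?_, ?_, rfl⟩
  · rw [List.getD_eq_getElem _ _ (by omega)]
  · rw [List.getD_eq_getElem _ _ hj]

theorem exists_of_mem_matchList {ind : ℕ} {q : List ℕ} {p : ℕ × ℕ × Bool}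
    (h : p ∈ matchList ind q) :
    ∃ i j, ∃ (hij : i < j) (hj : j < q.length), p = (q[i], q[j], obsAdj ind i j) := by
  simp only [matchList, List.mem_flatMap, List.mem_range, List.mem_map] at h
  obtain ⟨j, hj, i, hij, rfl⟩ := h
  refine ⟨i, j, hij, hj, ?_⟩
  rw [List.getD_eq_getElem _ _ (by omega), List.getD_eq_getElem _ _ hj]

theorem wp_tryPlacement {x : ℕ → ℕ} (hx : ∀ i < 13, x i < n) (hW : n * n + n + 18 < W)
    {all : List (ℕ × List ℕ)} {p : ℕ × List ℕ} (hp : p ∈ all)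
    (h17 : p.1 ≤ 17) (h9 : p.2.length ≤ 9) (h13 : ∀ i ∈ p.2, i < 13)
    (hb : Base H n E s) (hs : ∀ i < 13, s.reg (30 + i) = x i) :
    Wp W (tryPlacement p) s fun t k =>
      k ≤ 4 * (matchList p.1 p.2).length + 2 * p.2.length + 3 ∧
        (Found H x all s ∨ Matches H x (matchList p.1 p.2) → Found H x all t) := by
  rw [tryPlacement]
  refine (wp_ifMatches (B := 2 * p.2.length + 2)
    (Q := fun t => Found H x all s ∨ Matches H x (matchList p.1 p.2) → Found H x all t) hx
    (by omega) (matchList p.1 p.2) ?_ s hb hs ?_ ?_).mono ?_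
  · intro q hq
    obtain ⟨i, j, hij, hj, rfl⟩ := exists_of_mem_matchList hq
    exact ⟨h13 _ (List.getElem_mem _), h13 _ (List.getElem_mem _)⟩
  · intro hm u hu
    rw [wp_seq, wp_const]
    refine ⟨by omega, ?_⟩
    refine (wp_writeVertices p.2 h13 0 _ (by omega)).frame ?_
    rintro t k ⟨h1, h2, -⟩ ha
    refine ⟨by omega, fun _ => ⟨p, hp, hm, ?_, ?_⟩⟩
    · have h : ∀ (l : List ℕ) k, 1 ∉ (writeVertices k l).regs := by
        intro l
        induction l with
        | nil => simp [writeVertices, Prog.regs]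
        | cons a l ih => simp [writeVertices, Prog.regs, ih]
      rw [ha.1 1 (h _ _)]
      simp
    · intro i hi
      have hi13 := h13 _ (List.getElem_mem hi)
      have := h2 i hi
      rw [Nat.zero_add] at this
      rw [this, State.reg_setReg, if_neg (by omega), hu.1 _ (by simp; omega), hs _ hi13]
  · rintro hm u hu (⟨q, hq, h1, h2, h3⟩ | h)
    · refine ⟨q, hq, h1, (hu.1 1 (by decide)).trans h2, ?_⟩
      rw [hu.2 2 (by decide)]
      exact h3
    · exact absurd h hm
  · rintro t k ⟨h1, h2⟩
    exact ⟨by omega, h2⟩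

theorem notMem_regs_tryPlacement (p : ℕ × List ℕ) {r : ℕ} (h1 : r ≠ 1) (h17 : r ≠ 17) :
    r ∉ (tryPlacement p).regs := by
  have w : ∀ (l : List ℕ) k, r ∉ (writeVertices k l).regs := by
    intro l
    induction l with
    | nil => simp [writeVertices, Prog.regs]
    | cons a l ih => simp [writeVertices, Prog.regs, ih, h17]
  have m : ∀ l c, r ∉ Prog.regs c → r ∉ (ifMatches l c).regs := by
    intro l c hc
    induction l with
    | nil => exact hc
    | cons a l ih => simp [ifMatches, Prog.regs, mget, ih, h17]
  exact m _ _ (by simp [Prog.regs, h1, w])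

theorem notMem_arrs_tryPlacement (p : ℕ × List ℕ) {a : ℕ} (h2 : a ≠ 2) :
    a ∉ (tryPlacement p).arrs := by
  have w : ∀ (l : List ℕ) k, a ∉ (writeVertices k l).arrs := by
    intro l
    induction l with
    | nil => simp [writeVertices, Prog.arrs]
    | cons a l ih => simp [writeVertices, Prog.arrs, ih, h2]
  have m : ∀ l c, a ∉ Prog.arrs c → a ∉ (ifMatches l c).arrs := by
    intro l c hc
    induction l with
    | nil => exact hc
    | cons a l ih => simp [ifMatches, Prog.arrs, mget, ih]
  exact m _ _ (by simp [Prog.arrs, w])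

/-- The full list `all` stays fixed during the induction, because an answer found by an earlier
placement must survive the remaining tests or be replaced by another valid one. -/
theorem wp_tryAll {x : ℕ → ℕ} (hx : ∀ i < 13, x i < n) (hW : n * n + n + 18 < W)
    {all : List (ℕ × List ℕ)} (l : List (ℕ × List ℕ)) (hl : ∀ p ∈ l, p ∈ all ∧ p.1 ≤ 17 ∧
      p.2.length ≤ 9 ∧ ∀ i ∈ p.2, i < 13) :
    ∀ s, Base H n E s → (∀ i < 13, s.reg (30 + i) = x i) →
    Wp W (tryAll l) s fun t k => k ≤ tryCost l ∧
      (Found H x all s ∨ (∃ p ∈ l, Matches H x (matchList p.1 p.2)) → Found H x all t) := by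
  induction l with
  | nil =>
    intro s hb hs
    rw [tryAll, wp_skip]
    exact ⟨by simp [tryCost], by simp⟩
  | cons p l ih =>
    intro s hb hs
    obtain ⟨h1, h2, h3, h4⟩ := hl p (by simp)
    rw [tryAll, wp_seq]
    refine (wp_tryPlacement hx hW h1 h2 h3 h4 hb hs).frame ?_
    rintro u k ⟨hk, hu⟩ ha
    have hr : ∀ r, r ≠ 1 → r ≠ 17 → u.reg r = s.reg r := fun r r1 r2 =>
      ha.1 r (notMem_regs_tryPlacement p r1 r2)
    have hbu : Base H n E u := by
      refine hb.of_agree ha (fun r hr => notMem_regs_tryPlacement p ?_ ?_)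
        fun a ha => notMem_arrs_tryPlacement p ?_
      · rintro rfl
        simp at hr
      · rintro rfl
        simp at hr
      · rintro rfl
        simp at ha
    refine (ih (fun q hq => hl q (List.mem_cons_of_mem _ hq)) u hbu fun i hi => by
      rw [hr _ (by omega) (by omega), hs i hi]).mono ?_
    rintro t m ⟨hm, ht⟩
    refine ⟨?_, ?_⟩
    · simp only [tryCost, List.map_cons, List.sum_cons] at hm ⊢
      omega
    · rintro (h | ⟨q, hq, h⟩)
      · exact ht (.inl (hu (.inl h)))
      · rcases List.mem_cons.1 hq with rfl | hq
        · exact ht (.inl (hu (.inr h)))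
        · exact ht (.inr ⟨q, hq, h⟩)

theorem mem_tuples {m k : ℕ} {l : List ℕ} : l ∈ tuples m k ↔ l.length = k ∧ ∀ i ∈ l, i < m := by
  induction k generalizing l with
  | zero =>
    simp only [tuples, List.mem_singleton, List.length_eq_zero_iff]
    exact ⟨fun h => ⟨h, by simp [h]⟩, fun h => h.1⟩
  | succ k ih =>
    simp only [tuples, List.mem_flatMap, List.mem_map, List.mem_range, ih]
    constructor
    · rintro ⟨l, ⟨h1, h2⟩, i, hi, rfl⟩
      exact ⟨by simp [h1], by simpa using ⟨hi, h2⟩⟩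
    · rintro ⟨h1, h2⟩
      cases l with
      | nil => simp at h1
      | cons i l =>
        simp only [List.length_cons, Nat.add_right_cancel_iff, List.mem_cons, forall_eq_or_imp]
          at h1 h2
        exact ⟨l, ⟨h1, h2.2⟩, i, h2.1, rfl⟩

theorem mem_placements {p : ℕ × List ℕ} :
    p ∈ placements ↔ 1 ≤ p.1 ∧ p.1 ≤ 17 ∧ p.2.length = obsOrder p.1 ∧ ∀ i ∈ p.2, i < 13 := by
  obtain ⟨ind, q⟩ := p
  simp only [placements, List.mem_flatMap, List.mem_map, List.mem_range'_1, mem_tuples,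
    Prod.mk.injEq]
  constructor
  · rintro ⟨ind, ⟨h1, h2⟩, q, h3, rfl, rfl⟩
    exact ⟨h1, by omega, h3⟩
  · rintro ⟨h1, h2, h3⟩
    exact ⟨ind, ⟨h1, by omega⟩, q, h3, rfl, rfl⟩

theorem obsOrder_le {ind : ℕ} (h1 : 1 ≤ ind) (h2 : ind ≤ 17) : obsOrder ind ≤ 9 := by
  interval_cases ind <;> decide

/-- A placement that passes the test is an induced copy of the obstruction. -/
theorem inducesOrdered_of_matches {x : ℕ → ℕ} {ind : ℕ} {q : List ℕ} (h1 : 1 ≤ ind)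
    (h2 : ind ≤ 17) (hq : q.length = obsOrder ind) (h : Matches H x (matchList ind q))
    {f : Fin (obstruction ind).order → ℕ}
    (hf : ∀ (i : Fin (obstruction ind).order) (hi : i < q.length), f i = x q[i]) :
    InducesOrdered H (obstruction ind) f := by
  have hq : q.length = (obstruction ind).order := hq
  have key : ∀ i j : Fin (obstruction ind).order, i < j →
      adjCode H (f i) (f j) = if obsAdj ind i j then 1 else 0 := fun i j hij => by
    rw [hf i (by omega), hf j (by omega)]
    exact h _ (mem_matchList hij (by omega))
  have ne : ∀ i j : Fin (obstruction ind).order, i < j → f i ≠ f j := by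
    intro i j hij he
    have := key i j hij
    rw [adjCode_eq_two.2 he] at this
    split_ifs at this
    omega
  have adj : ∀ i j : Fin (obstruction ind).order, i < j →
      (H.Adj (f i) (f j) ↔ (obstruction ind).graph.Adj i j) := by
    intro i j hij
    rw [← adjCode_eq_one, key i j hij, obstruction_adj h1 h2]
    split_ifs with hc <;> simp [hc]
  refine ⟨fun i j hij => ?_, fun i j => ?_⟩
  · rcases lt_trichotomy i j with h | h | h
    · exact absurd hij (ne i j h)
    · exact h
    · exact absurd hij.symm (ne j i h)
  · rcases lt_trichotomy i j with h | h | h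
    · exact adj i j h
    · subst h
      simp
    · rw [H.adj_comm, (obstruction ind).graph.adj_comm]
      exact adj j i h

/-- If the listed vertices do not induce a probe diamond-free graph, some placement passes the
test. -/
theorem exists_matches {x : ℕ → ℕ} {X : Set ℕ} (hX : ∀ v ∈ X, ∃ i < 13, x i = v)
    (h : ¬ IsProbeDiamondFree (H.induce X)) :
    ∃ p ∈ placements, Matches H x (matchList p.1 p.2) := by
  -- The structure theorem is applied to the subgraph induced by the recorded vertices, so each
  -- vertex of the obstruction found is held by one of the thirteen registers.
  obtain ⟨ind, h1, h2, Q, hQ⟩ := exists_obstruction h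
  have : ∀ i, ∃ j < 13, x j = Q i := fun i => hX _ (Q i).2
  choose f hf hxf using this
  have get : ∀ i (hi : i < (List.ofFn f).length),
      x (List.ofFn f)[i] = Q ⟨i, by simpa using hi⟩ := by
    intro i hi
    rw [List.getElem_ofFn, hxf]
  refine ⟨(ind, List.ofFn f), mem_placements.2 ⟨h1, h2, by simp [obsOrder], ?_⟩, ?_⟩
  · simpa using hf
  · intro p hp
    obtain ⟨i, j, hij, hj, rfl⟩ := exists_of_mem_matchList hp
    have hj' : j < (obstruction ind).order := by simpa using hj
    simp only
    rw [get, get]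
    have ha := hQ.2 ⟨i, by omega⟩ ⟨j, hj'⟩
    rw [obstruction_adj h1 h2] at ha
    simp only [SimpleGraph.comap_adj, Function.Embedding.subtype_apply] at ha
    split_ifs with hc
    · exact adjCode_eq_one.2 (ha.2 hc)
    · have hn := mt ha.1 hc
      have hne : (Q ⟨i, by omega⟩ : ℕ) ≠ Q ⟨j, hj'⟩ := fun he => by
        have := Fin.mk.inj_iff.1 (hQ.1 (Subtype.ext he))
        omega
      rw [adjCode, if_neg hne, if_neg hn]

theorem wp_gatherProg : Wp W gatherProg s fun t k => k = 13 ∧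
    ∀ i (hi : i < 13), t.reg (30 + i) = (gathered s)[i]'hi := by
  simp only [gatherProg, wp_seq, wp_move, wp_load]
  refine ⟨trivial, fun i hi => ?_⟩
  interval_cases i <;> simp [gathered]

theorem wp_answerProg_of_bad (hb : Base H n E s) (hW : n * n + n + 18 < W) (h4 : s.reg 4 = 1)
    (hbad : Bad H n s) :
    Wp W answerProg s fun t k => k ≤ tryCost placements + 15 ∧ t.reg 0 = 0 ∧
      ∃ ind, 1 ≤ ind ∧ ind ≤ 17 ∧ t.reg 1 = ind ∧
        InducesOrdered H (obstruction ind) (fun i => t.arr 2 i) ∧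
        ∀ i : Fin (obstruction ind).order, t.arr 2 i < n := by
  rw [answerProg, wp_cond]
  simp only [Test.holds, h4, hb.reg5]
  refine ⟨fun h => absurd h one_ne_zero, fun _ => ?_⟩
  rw [wp_seq]
  refine wp_gatherProg.frame ?_
  rintro u k ⟨rfl, hu⟩ ha
  have hbu := hb.of_agree ha (by decide) (by decide)
  let x : ℕ → ℕ := fun i => (gathered s).getD i 0
  have hx : ∀ i (hi : i < 13), x i = (gathered s)[i]'hi := fun i hi =>
    List.getD_eq_getElem _ _ hi
  have hxn : ∀ i < 13, x i < n := fun i hi => by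
    rw [hx i hi]
    exact hbad.1 _ (List.getElem_mem _)
  have hex := exists_matches (H := H) (x := x) (fun v hv => by
    obtain ⟨i, hi, rfl⟩ := List.getElem_of_mem hv
    exact ⟨i, hi, hx i hi⟩) hbad.2
  rw [wp_seq]
  refine (wp_tryAll hxn hW (all := placements) placements (fun p hp => ?_) u hbu
    fun i hi => by rw [hu i hi, hx i hi]).mono ?_
  · obtain ⟨h1, h2, h3, h5⟩ := mem_placements.1 hp
    exact ⟨hp, h2, h3 ▸ obsOrder_le h1 h2, h5⟩
  rintro t k ⟨hk, ht⟩
  obtain ⟨p, hp, hm, e1, e2⟩ := ht (.inr hex)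
  obtain ⟨h1, h2, h3, h5⟩ := mem_placements.1 hp
  rw [wp_const]
  refine ⟨by omega, by omega, by simp, p.1, h1, h2, by simpa using e1,
    inducesOrdered_of_matches h1 h2 h3 hm fun i hi => e2 i hi, fun i => ?_⟩
  have hi : i < p.2.length := by
    rw [h3]
    exact i.2
  simp only [State.arr_setReg]
  rw [e2 i hi]
  exact hxn _ (h5 _ (List.getElem_mem _))

end
end Ram

/-! ### Correctness and running time of the whole algorithm. -/

namespace Ram

section
variable {H : SimpleGraph ℕ} {W n E r : ℕ} {s t : State}

/-- The lines describe a completion of the graph, which has been computed. -/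
structure Accepted (H : SimpleGraph ℕ) (n E r : ℕ) (s : State) : Prop where
  lines : Lines H n r s
  cover : CoveredUpTo H n E s
  two : NoTwo H n r s
  fill : Fill (fun u v => u < n ∧ v < n ∧ NewPair H n s u v) (n * E) s
  indep : ∀ u v, H.Adj u v → s.arr 2 u = 1 → s.arr 2 v ≠ 1

theorem wp_checkProg (hb : Base H n E s) (hl : Lines H n r s) (hr : r ≤ E)
    (hc : CoveredUpTo H n E s) (hW : n * n + n * E + n + E + 6 < W) (e4 : s.reg 4 = 0)
    (e7 : s.reg 7 = 0) (e2 : ∀ c, s.arr 2 c = 0) (e14 : ∀ c, s.arr 14 c = 0) :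
    Wp W (.seq twoProg (.seq fillProg indepProg)) s fun t k => k ≤ 85 * (n + 1) * E + 6 ∧
      (t.reg 4 = 0 ∧ Accepted H n E r t ∨ t.reg 4 = 1 ∧ Bad H n t) := by
  have hnr : n * r ≤ n * E := Nat.mul_le_mul_left _ hr
  rw [wp_seq]
  refine (wp_twoProg hb hl (by omega) e4 e14).frame ?_
  rintro p k ⟨hk, hp⟩ ap
  have hbp := hb.of_agree ap (by decide) (by decide)
  have hlp := hl.of_agree ap (by decide) (by decide)
  rw [wp_seq]
  refine (wp_fillProg hbp hW ((ap.1 7 (by decide)).trans e7) (fun c => by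
    rw [ap.2 2 (by decide), e2])).frame ?_
  rintro q l ⟨hl', hq⟩ aq
  have hbq := hbp.of_agree aq (by decide) (by decide)
  have hlq := hlp.of_agree aq (by decide) (by decide)
  have q8 : q.arr 8 = p.arr 8 := aq.2 8 (by decide)
  -- Looping over sources of darts loses no pair: the first vertex of a new pair is on a line and
  -- therefore has a neighbor.
  have hS : ∀ u v, (v < n ∧ (∃ e < E, p.arr 6 e = u) ∧ NewPair H n p u v) ↔
      u < n ∧ v < n ∧ NewPair H n p u v := by
    intro u v
    constructor
    · rintro ⟨h1, ⟨e, he, rfl⟩, h2⟩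
      exact ⟨(hb.bound _ _ (hbp.dart e he)).1, h1, h2⟩
    · rintro ⟨h1, h2, h3⟩
      obtain ⟨-, i, i1, i2, -, lu, -⟩ := hlp.sound u h1 v h2 h3.2
      obtain ⟨f, hf⟩ := exists_dart_onLine hbp (hlp.triangle i i1 i2)
      exact ⟨h2, ⟨f u, (hf u lu).1, (hf u lu).2.1⟩, h3⟩
  have hq' := hq.of_agree (.refl [] [] q) (by simp) (by simp) hS le_rfl
  refine (wp_indepProg hbq hlq (by omega) ?_ ?_).frame ?_
  · rw [aq.1 4 (by decide)]
    exact hp.imp (fun h => h.1) fun h => ⟨h.1, h.2.of_agree aq (by decide) (by decide)⟩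
  · intro x hx
    rcases hq'.2 x with ⟨h, -⟩ | ⟨-, h⟩
    · omega
    · rw [NewPair, q8]
      exact ⟨h.2.1, h.2.2⟩
  · rintro t m ⟨hm, ht⟩ at'
    refine ⟨?_, ht.imp_left ?_⟩
    · have e : 85 * (n + 1) * E = 42 * (n + 1) * E + 21 * (n + 1) * E + 22 * n * E + 22 * E := by
        ring
      have := Nat.zero_le (22 * n * E)
      omega
    rintro ⟨t4, q4, hi⟩
    have p4 : p.reg 4 = 0 := by rw [← q4, aq.1 4 (by decide)]
    have t8 : t.arr 8 = q.arr 8 := at'.2 8 (by decide)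
    refine ⟨t4, hlq.of_agree at' (by decide) (by decide), ?_, ?_, ?_, ?_⟩
    · rw [CoveredUpTo, t8, q8, ap.2 8 (by decide), at'.2 6 (by decide), aq.2 6 (by decide),
        ap.2 6 (by decide), at'.2 1 (by decide), aq.2 1 (by decide), ap.2 1 (by decide)]
      exact hc
    · rcases hp with ⟨-, hp⟩ | ⟨hp, -⟩
      · intro i i1 i2 x y z
        rw [joined_congr (t8.trans q8) ((at'.2 11 (by decide)).trans (aq.2 11 (by decide)))
          ((at'.2 12 (by decide)).trans (aq.2 12 (by decide)))
          ((at'.2 13 (by decide)).trans (aq.2 13 (by decide))),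
          joined_congr (t8.trans q8) ((at'.2 11 (by decide)).trans (aq.2 11 (by decide)))
          ((at'.2 12 (by decide)).trans (aq.2 12 (by decide)))
          ((at'.2 13 (by decide)).trans (aq.2 13 (by decide)))]
        exact hp i i1 i2 x y z
      · omega
    · refine hq'.of_agree at' (by decide) (by decide) (fun u v => ?_) le_rfl
      rw [NewPair, NewPair, t8, q8]
    · rw [at'.2 2 (by decide)]
      exact hi

variable {G : SimpleGraph (Fin n)}

theorem natGraph_adj_val {u v : Fin n} : (natGraph G).Adj u v ↔ G.Adj u v := by
  rw [natGraph_adj]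
  exact ⟨fun ⟨_, _, h⟩ => h, fun h => ⟨u.2, v.2, h⟩⟩

theorem newPair_iff (hl : Lines (natGraph G) n r s) {u v : Fin n} :
    NewPair (natGraph G) n s u v ↔ (u ≠ v ∧ ∃ i, 1 ≤ i ∧ i ≤ r ∧
      LineAt (natGraph G) s (n * i) u ∧ LineAt (natGraph G) s (n * i) v) ∧ ¬ G.Adj u v := by
  have n0 : 0 < n := u.pos
  rw [NewPair, ← natGraph_adj_val]
  constructor
  · rintro ⟨h1, h2⟩
    obtain ⟨h3, i, i1, i2, -, h4⟩ := hl.sound u u.2 v v.2 h2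
    refine ⟨⟨fun h => h3 (congrArg _ h), i, i1, i2, h4⟩, fun h => ?_⟩
    rw [adjCode_eq_one.2 h] at h1
    exact absurd h1 one_ne_zero
  · rintro ⟨⟨h1, i, i1, i2, h3, h4⟩, h5⟩
    have h1' : (u : ℕ) ≠ v := fun h => h1 (Fin.ext h)
    refine ⟨by rw [adjCode, if_neg h1', if_neg h5], ?_⟩
    rw [hl.full i i1 i2 u v h1' h3 h4]
    exact (Nat.mul_pos n0 i1).ne'

/-- The conditions established by the tests are those of `completes_of_lines` for the computed
lines, and the list in memory enumerates exactly the edges added by this completion. -/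
theorem Accepted.outputsYes (hb : Base (natGraph G) n E s) (h : Accepted (natGraph G) n E r s)
    (h0 : t.reg 0 = 1) (h1 : t.reg 1 = s.reg 7) (ha : t.arr = s.arr) :
    ∃ (P N : Set (Fin n)) (F : Set (Sym2 (Fin n))), OutputsYes t P N F ∧
      IsProbePartition G P N ∧ IsDiamondFreeCompletion G N F := by
  obtain ⟨hl, hc, h2, ⟨⟨l, l1, -, l3, l4⟩, hN⟩, hi⟩ := h
  let mem : {i // 1 ≤ i ∧ i ≤ r} → Fin n → Prop := fun i v => LineAt (natGraph G) s (n * i) v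
  let K : SimpleGraph (Fin n) :=
    { Adj := fun u v => G.Adj u v ∨ u ≠ v ∧ ∃ j, mem j u ∧ mem j v
      symm := ⟨fun u v h => h.imp (fun h => h.symm) fun ⟨h1, j, h2, h3⟩ => ⟨h1.symm, j, h3, h2⟩⟩
      loopless := ⟨fun u h => h.elim (fun h => G.loopless.irrefl u h) fun h => h.1 rfl⟩ }
  have new : ∀ u v, K.Adj u v ∧ ¬ G.Adj u v ↔ NewPair (natGraph G) n s u v := by
    intro u v
    rw [newPair_iff hl]
    constructor
    · rintro ⟨h3 | ⟨h3, ⟨j, j1, j2⟩, h4⟩, h5⟩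
      · exact absurd h3 h5
      · exact ⟨⟨h3, j, j1, j2, h4⟩, h5⟩
    · rintro ⟨⟨h3, j, j1, j2, h4⟩, h5⟩
      exact ⟨.inr ⟨h3, ⟨j, j1, j2⟩, h4⟩, h5⟩
  have hcomp : Completes G {v | s.arr 2 v = 1} K := by
    refine completes_of_lines mem (fun u v => Iff.rfl) ?_ ?_ ?_ ?_
    · intro u v c huv huc hvc
      obtain ⟨e, he, e1, e2⟩ := hb.surj u v (natGraph_adj_val.2 huv)
      have := hc e he c (by rw [e1]; exact natGraph_adj_val.2 huc)
        (by rw [e2]; exact natGraph_adj_val.2 hvc)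
      rw [e1, e2] at this
      obtain ⟨-, i, i1, i2, -, h3⟩ := hl.sound u u.2 v v.2 this
      exact ⟨⟨i, i1, i2⟩, h3⟩
    · rintro ⟨i, i1, i2⟩ x y z hxy hx hy hzx hzy
      by_contra hz
      have key : ∀ w, mem ⟨i, i1, i2⟩ w → K.Adj z w → Joined (natGraph G) n s (n * i) w z := by
        intro w hw hzw
        refine ⟨hw, hz, w.2, z.2, ?_⟩
        rcases hzw with h | ⟨h3, ⟨j, j1, j2⟩, h4, h5⟩
        · exact .inl (natGraph_adj_val.2 h.symm)
        · right
          rw [hl.full j j1 j2 w z (fun h => h3 (Fin.ext h.symm)) h5 h4]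
          exact (Nat.mul_pos x.pos j1).ne'
      exact hxy (Fin.ext (h2 i i1 i2 x y z (key x hx hzx) (key y hy hzy)))
    · intro u v hu hv huv
      exact hi u v (natGraph_adj_val.2 huv) hu hv
    · intro u v huv hn
      rcases hN u with ⟨-, h3⟩ | ⟨h3, -⟩
      · exact absurd ⟨u.2, v.2, (new u v).1 ⟨huv, hn⟩⟩ (h3 v)
      · exact h3
  have hlt : ∀ p ∈ l, p.1 < n ∧ p.2 < n := fun p hp => by
    obtain ⟨h3, h4, -⟩ := (l4 p.1 p.2).1 hp
    exact ⟨h3, h4⟩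
  let l' : List (Fin n × Fin n) :=
    l.pmap (fun p hp => (⟨p.1, hp.1⟩, ⟨p.2, hp.2⟩)) hlt
  have hl' : ∀ u v : Fin n, (u, v) ∈ l' ↔ K.Adj u v ∧ ¬ G.Adj u v := by
    intro u v
    rw [new, List.mem_pmap]
    constructor
    · rintro ⟨p, hp, h⟩
      simp only [Prod.mk.injEq] at h
      obtain ⟨rfl, rfl⟩ := h
      exact ((l4 p.1 p.2).1 hp).2.2
    · intro h
      exact ⟨(u, v), (l4 u v).2 ⟨u.2, v.2, h⟩, rfl⟩
  refine ⟨_, _, {e | ∃ p ∈ l', e = s(p.1, p.2)}, ⟨h0, fun v => ⟨?_, ?_⟩, l', ?_, ?_, rfl⟩,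
    hcomp.isProbePartition, hcomp.isDiamondFreeCompletion fun u v => ?_⟩
  · rw [ha, Set.mem_compl_iff, Set.mem_ofPred_eq]
    rcases hN v with ⟨h3, -⟩ | ⟨h3, -⟩ <;> omega
  · rw [ha, Set.mem_ofPred_eq]
  · rw [h1, l1, List.length_pmap]
  · intro i hi'
    rw [ha]
    have := l3 i (by simpa [l'] using hi')
    simp only [l', List.getElem_pmap]
    exact this
  · rw [Set.mem_ofPred_eq, ← hl']
    constructor
    · rintro ⟨p, hp, h⟩
      rcases Sym2.eq_iff.1 h with ⟨rfl, rfl⟩ | ⟨rfl, rfl⟩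
      · exact hp
      · obtain ⟨h3, h4⟩ := (hl' p.1 p.2).1 hp
        exact (hl' p.2 p.1).2 ⟨h3.symm, fun h => h4 h.symm⟩
    · intro h
      exact ⟨(u, v), h, rfl⟩

/-- The class is hereditary, so the recorded vertices refute membership of the whole graph. -/
theorem Bad.not_isProbeDiamondFree (h : Bad (natGraph G) n s) : ¬ IsProbeDiamondFree G := by
  intro hG
  refine h.2 (hG.of_embedding ⟨⟨fun v => ⟨v.1, h.1 v.1 v.2⟩, fun u v huv => ?_⟩, ?_⟩)
  · exact Subtype.ext (Fin.mk.inj_iff.1 huv)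
  · intro u v
    simp only [SimpleGraph.comap_adj, Function.Embedding.subtype_apply]
    rw [← natGraph_adj_val]
    rfl

/-- The recognition algorithm is correct and takes time `O(nm + n + 1)`. -/
theorem wp_mainProg {L : Fin n → List (Fin n)} (hL : IsAdjacencyList G L)
    (hE : 2 * G.edgeSet.ncard = E) (hW : n * n + n * E + n + E + 18 < W) :
    Wp W mainProg (inputState L) fun t k =>
      k ≤ 160 * (n + 1) * E + 14 * n + 11 * E + 20 + (tryCost placements + 15) ∧
        (IsProbeDiamondFree G → ∃ (P N : Set (Fin n)) (F : Set (Sym2 (Fin n))),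
          OutputsYes t P N F ∧ IsProbePartition G P N ∧ IsDiamondFreeCompletion G N F) ∧
        (¬ IsProbeDiamondFree G → ∃ (ind : ℕ) (Q : Fin (obstruction ind).order → Fin n),
          OutputsNo t ind Q ∧ 1 ≤ ind ∧ ind ≤ 17 ∧ InducesOrdered G (obstruction ind) Q) := by
  have in0 : ∀ x, x ≠ 0 → (inputState L).reg x = 0 := fun x hx => by simp [inputState, hx]
  have ina : ∀ a, 2 ≤ a → ∀ i, (inputState L).arr a i = 0 := fun a h i => by
    simp [inputState, show a ≠ 0 by omega, show a ≠ 1 by omega]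
  rw [mainProg, wp_seq]
  refine (wp_setup hL ((dartList_length_eq hL).trans hE) (by omega)).frame ?_
  rintro s1 k1 ⟨hk1, hb1⟩ a1
  have z8 : ∀ c, s1.arr 8 c = 0 := fun c => by rw [a1.2 8 (by decide), ina 8 (by omega)]
  have l1 : Lines (natGraph G) n 0 s1 := by
    refine ⟨?_, ⟨?_, ?_, ?_⟩, ?_, ?_, ?_⟩
    · rw [a1.1 6 (by decide), in0 6 (by omega), Nat.mul_zero]
    · rw [a1.2 11 (by decide), ina 11 (by omega)]
    · rw [a1.2 12 (by decide), ina 12 (by omega)]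
    · rw [a1.2 13 (by decide), ina 13 (by omega)]
    · intro i h1 h2
      omega
    · intro x _ y _ h
      exact absurd (z8 _) h
    · intro i h1 h2
      omega
  rw [wp_seq]
  refine (wp_linesProg hb1 l1 (by omega) (by omega) (by
    rw [a1.1 4 (by decide), in0 4 (by omega)])).frame ?_
  rintro s2 k2 ⟨hk2, h2⟩ a2
  have hb2 := hb1.of_agree a2 (by decide) (by decide)
  rw [wp_seq]
  have mid : Wp W (.cond (.eq 4 5) (.seq twoProg (.seq fillProg indepProg)) .skip) s2
      fun t k => k ≤ 85 * (n + 1) * E + 7 ∧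
        (t.reg 4 = 0 ∧ (∃ r, Accepted (natGraph G) n E r t) ∨
          t.reg 4 = 1 ∧ Bad (natGraph G) n t) := by
    rw [wp_cond]
    simp only [Test.holds, hb2.reg5]
    rcases h2 with ⟨h4, ⟨r, hr, hl⟩, hc⟩ | ⟨h4, hbad⟩
    · refine ⟨fun _ => ?_, fun h => absurd h4 h⟩
      refine (wp_checkProg hb2 hl hr hc (by omega) h4 ?_ ?_ ?_).mono ?_
      · rw [a2.1 7 (by decide), a1.1 7 (by decide), in0 7 (by omega)]
      · intro c
        rw [a2.2 2 (by decide), a1.2 2 (by decide), ina 2 (by omega)]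
      · intro c
        rw [a2.2 14 (by decide), a1.2 14 (by decide), ina 14 (by omega)]
      · rintro t k ⟨hk, ht⟩
        exact ⟨by omega, ht.imp_left fun h => ⟨h.1, r, h.2⟩⟩
    · refine ⟨fun h => by omega, fun _ => ?_⟩
      rw [wp_skip]
      exact ⟨by omega, .inr ⟨h4, hbad⟩⟩
  refine mid.frame ?_
  rintro s3 k3 ⟨hk3, h3⟩ a3
  have hb3 := hb2.of_agree a3 (by decide) (by decide)
  have eE : 160 * (n + 1) * E = 75 * (n + 1) * E + 85 * (n + 1) * E := by ring
  rcases h3 with ⟨h4, r, hacc⟩ | ⟨h4, hbad⟩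
  · have yes : ∀ t : State, t.reg 0 = 1 → t.reg 1 = s3.reg 7 → t.arr = s3.arr → _ :=
      fun t h0 h1 ha => hacc.outputsYes hb3 h0 h1 ha
    rw [answerProg, wp_cond]
    simp only [Test.holds, h4, hb3.reg5]
    refine ⟨fun _ => ?_, fun h => absurd trivial h⟩
    rw [wp_seq, wp_const]
    refine ⟨by omega, ?_⟩
    rw [wp_move]
    have := yes ((s3.setReg 0 1).setReg 1 ((s3.setReg 0 1).reg 7)) (by simp) (by simp) rfl
    refine ⟨by omega, fun _ => this, fun hn => ?_⟩
    obtain ⟨P, N, F, -, hP, hF⟩ := this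
    exact absurd ⟨P, N, F, hP, hF⟩ hn
  · refine (wp_answerProg_of_bad hb3 (by omega) h4 hbad).mono ?_
    rintro t k ⟨hk, h0, ind, i1, i2, e1, hQ, hlt⟩
    refine ⟨by omega, fun h => absurd h hbad.not_isProbeDiamondFree, fun _ =>
      ⟨ind, fun i => ⟨t.arr 2 i, hlt i⟩, ⟨h0, e1, fun i => rfl⟩, i1, i2, ?_, ?_⟩⟩
    · exact fun i j hij => hQ.1 (Fin.mk.inj_iff.1 hij)
    · intro i j
      rw [← hQ.2, ← natGraph_adj_val]

end
end Ram

theorem mainTheorem2 :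
    ∃ (prog : Ram.Prog) (c : ℕ),
      ∀ (n : ℕ) (G : SimpleGraph (Fin n)) (L : Fin n → List (Fin n)), IsAdjacencyList G L →
        ∃ (t : Ram.State) (steps : ℕ),
          Ram.Run ((n + 2) ^ c) prog (inputState L) t steps ∧
          steps ≤ c * (n * G.edgeSet.ncard + n + 1) ∧
          (IsProbeDiamondFree G →
            ∃ (P N : Set (Fin n)) (F : Set (Sym2 (Fin n))),
              OutputsYes t P N F ∧
              IsProbePartition G P N ∧ IsDiamondFreeCompletion G N F) ∧
          (¬ IsProbeDiamondFree G →
            ∃ (ind : ℕ) (Q : Fin (obstruction ind).order → Fin n),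
              OutputsNo t ind Q ∧
              1 ≤ ind ∧ ind ≤ 17 ∧
              InducesOrdered G (obstruction ind) Q ∧
              IsDegreeLex G Q ∧
              IsMinimalForbidden (G.induce (Set.range Q))) := by
  -- One constant serves as the exponent of the word bound and as the time factor. With `E = 2m` and
  -- `m ≤ nm` the terms in `E` add up to `662nm`, and the cost of testing the placements enters only
  -- additively.
  refine ⟨Ram.mainProg, 700 + Ram.tryCost Ram.placements, fun n G L hL => ?_⟩
  have hm : G.edgeSet.ncard ≤ n * G.edgeSet.ncard := by
    rcases Nat.eq_zero_or_pos n with rfl | h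
    · simp [Set.eq_empty_of_isEmpty]
    · exact Nat.le_mul_of_pos_left _ h
  have hE : 2 * G.edgeSet.ncard ≤ n * n :=
    (Ram.dartList_length_eq hL).symm.trans_le (Ram.dartList_length_le hL)
  -- The largest numbers, the names of lines and the length of the completion list, are at most `n *
  -- E ≤ n ^ 3`, so words of `O(log n)` bits suffice.
  have hW : n * n + n * (2 * G.edgeSet.ncard) + n + 2 * G.edgeSet.ncard + 18 <
      (n + 2) ^ (700 + Ram.tryCost Ram.placements) := by
    calc n * n + n * (2 * G.edgeSet.ncard) + n + 2 * G.edgeSet.ncard + 18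
        ≤ n * n + n * (n * n) + n + n * n + 18 := by gcongr
      _ < (n + 2) ^ 5 := by
          have : (n + 2) ^ 5 = n ^ 5 + 10 * n ^ 4 + 40 * n ^ 3 + 80 * n ^ 2 + 80 * n + 32 := by
            ring
          rw [this]
          ring_nf
          have h3 := Nat.zero_le (n ^ 3)
          have h2 := Nat.zero_le (n ^ 2)
          omega
      _ ≤ (n + 2) ^ (700 + Ram.tryCost Ram.placements) :=
          Nat.pow_le_pow_right (by omega) (by omega)
  obtain ⟨t, k, hrun, hk, yes, no⟩ := Ram.wp_mainProg hL rfl hW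
  refine ⟨t, k, hrun, hk.trans ?_, yes, fun h => ?_⟩
  · generalize Ram.tryCost Ram.placements = T
    generalize G.edgeSet.ncard = m at *
    have e1 : 160 * (n + 1) * (2 * m) = 320 * (n * m) + 320 * m := by ring
    have e2 : (700 + T) * (n * m + n + 1) =
        700 * (n * m) + 700 * n + 700 + T * (n * m) + T * n + T := by ring
    have h1 := Nat.zero_le (T * (n * m))
    have h2 := Nat.zero_le (T * n)
    omega
  · obtain ⟨ind, Q, hout, h1, h2, hQ⟩ := no h
    exact ⟨ind, Q, hout, h1, h2, hQ, hQ.isDegreeLex h1 h2, hQ.isMinimalForbidden h1 h2⟩
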